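/- **Setting.** Let $1\le p$, $f:\mathbb R^n\to\mathbb R$, $c:\mathbb R^n\to\mathbb R^p$, $\mathcal M=\{x:c(x)=0\}$, and write $J_c(x)\in\mathbb R^{n\times p}$ for the transposed Jacobian of $c$ (similarly $J_A(x)\in\mathbb R^{n\times n}$ for a map $A:\mathbb R^n\to\mathbb R^n$); norms are $\ell_2$/operator norms. Assume: 1. $\nabla f$ and $J_c$ are locally Lipschitz on $\mathbb R^n$, and $J_c(x)$ has full column rank for every $x\in\mathcal M$; 2. $A$ is differentiable with locally Lipschitz $J_A$, and $A(x)=x$, $J_A(x)J_c(x)=0$ for all $x\in\mathcal M$; 3. $f,c,A$ are twice differentiable on $\mathbb R^n$; 4. for every $x\in\mathcal M$ the level set $\Gamma^\star_x=\{y\in\mathcal M: f(y)\le f(x)\}$ is compact; 5. with $g(x)=f(A(x))$, the Hessian $\nabla^2 g$ is locally Lipschitz on $\mathbb R^n$. For $x\in\mathcal M$ let $T_x=\{d:J_c(x)^\top d=0\}$, let $\operatorname{grad}f(x)$ and $\operatorname{hess}f(x)$ be the Riemannian gradient and Hessian on $\mathcal M$ for the Euclidean metric, and $\lambda_{\min}(\operatorname{hess}f(x))=\min\{d^\top\operatorname{hess}f(x)\,d: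 d\in T_x,\|d\|=1\}$ ($+\infty$ if $T_x=0$). Let $A^\infty(x)=\lim_{k\to\infty}A^k(x)$. For $\beta\ge 0$ put $h(x)=f(A(x))+\frac\beta2\|c(x)\|^2$. **Local constants.** All constants below are taken in $[0,\infty]$, a positive number divided by $0$ being $+\infty$ and an infimum over the empty set being $+\infty$. At a point $x$: let $\sigma_x=\sigma_{\min}(J_c(x))$; $\rho_x$ the largest $r\in(0,1]$ with $\sigma_{\min}(J_c(y))\ge\frac12\sigma_x$ whenever $\|y-x\|\le r$; $\Theta_x=\{y:\|y-x\|\le\rho_x\}$; $L^f_x=\sup_{\Theta_x}\|\nabla f(A(y))\|$, $M^c_x=\sup_{\Theta_x}\|J_c\|$, $M^A_x=\sup_{\Theta_x}\|J_A\|$; and $L^g_x,L^c_x,L^A_x,L^{Ac}_x$ the best Lipschitz constants on $\Theta_x$ of $\nabla g$, $J_c$, $J_A$, and $y\mapsto J_A(y)J_c(A(y))$, respectively. Let $$\varepsilon_x=\min\Big\{\tfrac{\rho_x}2,\tfrac{\sigma_x}{32L^c_x(M^A_x+1)},\tfrac{\sigma_x^2}{8L^{Ac}_xM^c_x}\Big\},\qquad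 \bar\Omega=\bigcup_{x\in\mathcal M}\Big\{y:\|y-x\|\le\tfrac{\sigma_x\varepsilon_x}{4M^c_x(M^A_x+1)+\sigma_x}\Big\},$$ $$\beta_x=\max\Big\{\tfrac{128L^g_x(M^A_x+1)^2}{\sigma_x^2},\tfrac{64L^f_x(M^A_x+1)L^{Ac}_x}{\sigma_x^3},\tfrac{16L^f_xL^A_x(2M^A_x+1)}{\sigma_x^2}\Big\}.$$ **Global constants.** Fix $x_0\in\mathcal M$ and $\zeta>0$. Let $\Gamma=\{y:\operatorname{dist}(y,\Gamma^\star_{x_0})\le\zeta+1\}$, $\mu=\inf_{y\in\Gamma\setminus\bar\Omega}\|c(y)\|^2$, $$\bar\beta_{x_0}=\max\Big\{\tfrac4\mu\sup_{y,z\in\Gamma}(g(y)-g(z)),\ \sup_{w\in\mathcal M\cap\Gamma}\beta_w\Big\},\quad \tilde M=\sup_{y\ne z\in\Gamma}\tfrac{\|\nabla^2g(y)-\nabla^2g(z)\|}{\|y-z\|},$$ $\tilde\sigma=\inf_{x\in\Gamma\cap\bar\Omega}\sigma_x$ and $\tilde M^A=\sup_{x\in\Gamma\cap\bar\Omega}M^A_x$.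 Let the finite numbers $\beta,\nu\ge0$ satisfy $$\beta\ge\max\Big\{\bar\beta_{x_0},\tfrac{96\tilde M(\tilde M^A+1)^2}{\tilde\sigma^2}\Big\},\quad \nu=\max\Big\{\sup_{y\ne z\in\Gamma}\tfrac{\|\nabla^2h(y)-\nabla^2h(z)\|}{\|y-z\|},\ \sup_{y\in\Gamma}\tfrac{2\|\nabla^2h(y)\|}{\zeta},\ \sup_{y\in\Gamma}\tfrac{\|\nabla h(y)\|}{\zeta^2}\Big\}.$$ **Algorithm (cubic regularization with momentum), with parameter $\rho\in[0,1)$.** Set $y_0=x_0$. For $k=0,1,\dots$: take any $d_k\in\arg\min_{d\in\mathbb R^n}\, d^\top\nabla h(x_k)+\frac12d^\top\nabla^2h(x_k)d+\frac\nu6\|d\|^3$; set $y_{k+1}=x_k+d_k$, $\tau_k=\min\{\rho,\|\nabla h(y_{k+1})\|,\|y_{k+1}-x_k\|\}$, $v_{k+1}=y_{k+1}+\tau_k(y_{k+1}-y_k)$; set $x_{k+1}=y_{k+1}$ if $h(y_{k+1})\le h(v_{k+1})$ and $x_{k+1}=v_{k+1}$ otherwise. **Theorem.** There is a constant $C>0$,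 depending only on the data $f,c,A,x_0,\zeta,\beta,\nu$ (and not on $\rho$, on the choice of the minimizers $d_k$, on $\varepsilon$ or on $K$), such that for every sequence $\{x_k\}$ generated by the algorithm, every $\varepsilon\in(0,1)$ and every integer $K\ge C/\varepsilon^{3/2}$ there is an $\tilde x\in\{x_i\}_{0\le i\le K}$ for which $A^\infty(\tilde x)$ exists, lies in $\mathcal M$, and satisfies $$\|\operatorname{grad}f(A^\infty(\tilde x))\|\le\varepsilon\quad\text{and}\quad\lambda_{\min}(\operatorname{hess}f(A^\infty(\tilde x)))\ge-\sqrt\varepsilon .$$ -/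

import Mathlib

open Set Filter Topology
open scoped ENNReal NNReal

noncomputable section

namespace CDF

/-- The Euclidean space `ℝⁿ`. -/
abbrev Eu (n : ℕ) : Type := EuclideanSpace ℝ (Fin n)

variable {n p : ℕ}

/-! ### Derivatives and elementary quantities -/

/-- The Hessian `∇²φ(x)`, as a linear operator on `ℝⁿ`. -/
def hessian (φ : Eu n → ℝ) (x : Eu n) : Eu n →L[ℝ] Eu n :=
  fderiv ℝ (gradient φ) x

/-- The transposed Jacobian of `F : ℝⁿ → ℝᵐ` at `x`; it maps `ℝᵐ` to `ℝⁿ`. -/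
def transJac {m : ℕ} (F : Eu n → Eu m) (x : Eu n) : Eu m →L[ℝ] Eu n :=
  ContinuousLinearMap.adjoint (fderiv ℝ F x)

/-- Smallest singular value of an `n × p` matrix, `1 ≤ p ≤ n`. -/
def sigmaMin (T : Eu p →L[ℝ] Eu n) : ℝ≥0∞ :=
  ⨅ (u : Eu p) (_ : ‖u‖ = 1), ‖T u‖ₑ

/-- `sup_{y ∈ s} ‖F y‖`, with values in `[0, ∞]`. -/
def supNormOn {V : Type*} [NormedAddCommGroup V] (F : Eu n → V) (s : Set (Eu n)) : ℝ≥0∞ :=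
  ⨆ y ∈ s, ‖F y‖ₑ

/-- `sup_{y, z ∈ s, y ≠ z} ‖F y - F z‖ / ‖y - z‖`, with values in `[0, ∞]`. -/
def lipOn {V : Type*} [NormedAddCommGroup V] (F : Eu n → V) (s : Set (Eu n)) : ℝ≥0∞ :=
  ⨆ (y ∈ s) (z ∈ s) (_ : y ≠ z), ‖F y - F z‖ₑ / ‖y - z‖ₑ

/-! ### The feasible manifold, Riemannian gradient and Hessian -/

/-- The feasible region `M = {x : c(x) = 0}`. -/
def feasible (c : Eu n → Eu p) : Set (Eu n) := {x | c x = 0}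

/-- The tangent space `T_x = {d : J_c(x)ᵀ d = 0}`. -/
def tangent (c : Eu n → Eu p) (x : Eu n) : Submodule ℝ (Eu n) :=
  LinearMap.ker (fderiv ℝ c x : Eu n →ₗ[ℝ] Eu p)

/-- The Riemannian gradient of `f` for the metric induced from `ℝⁿ`: the orthogonal projection
of `∇f(x)` onto `T_x`. The formula also extends `grad f` to points off `M`. -/
def riemGrad (f : Eu n → ℝ) (c : Eu n → Eu p) (x : Eu n) : Eu n :=
  (tangent c x).starProjection (gradient f x)

/-- The Riemannian Hessian `hess f(x)[d]`, `d ∈ T_x`: the covariant derivative of `grad f` along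
`d`, that is, the orthogonal projection onto `T_x` of the directional derivative of (an extension
of) the vector field `grad f`. -/
def riemHess (f : Eu n → ℝ) (c : Eu n → Eu p) (x d : Eu n) : Eu n :=
  (tangent c x).starProjection (fderiv ℝ (riemGrad f c) x d)

/-- `λ_min(hess f(x)) = min {dᵀ hess f(x) d : d ∈ T_x, ‖d‖ = 1}`
(`+∞` in the degenerate case `T_x = 0`). -/
def riemHessLambdaMin (f : Eu n → ℝ) (c : Eu n → Eu p) (x : Eu n) : EReal :=
  ⨅ (d : Eu n) (_ : d ∈ tangent c x) (_ : ‖d‖ = 1), ((inner ℝ d (riemHess f c x d) : ℝ) : EReal)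

/-! ### The constraint dissolving function -/

/-- `g(x) = f(A(x))`. -/
def gFun (f : Eu n → ℝ) (A : Eu n → Eu n) (x : Eu n) : ℝ := f (A x)

/-- `h(x) = f(A(x)) + (β/2) ‖c(x)‖²`. -/
def hFun (f : Eu n → ℝ) (c : Eu n → Eu p) (A : Eu n → Eu n) (β : ℝ) (x : Eu n) : ℝ :=
  f (A x) + β / 2 * ‖c x‖ ^ 2

/-! ### Local constants

All constants are computed in `[0, ∞]`, so that a positive number divided by a vanishing constant
is `∞`. -/

/-- The largest `ρ ∈ (0, 1]` such that `σ_min(J_c(y)) ≥ σ_min(J_c(x)) / 2` on the closed ball of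
radius `ρ` around `x`. -/
def rhoAt (c : Eu n → Eu p) (x : Eu n) : ℝ :=
  sSup {r : ℝ | 0 < r ∧ r ≤ 1 ∧
    sigmaMin (transJac c x) / 2 ≤ ⨅ y ∈ Metric.closedBall x r, sigmaMin (transJac c y)}

/-- The ball `Θ_x`. -/
def thetaBall (c : Eu n → Eu p) (x : Eu n) : Set (Eu n) := Metric.closedBall x (rhoAt c x)

/-- `σ_x = σ_min(J_c(x))`. -/
def sigmaAt (c : Eu n → Eu p) (x : Eu n) : ℝ≥0∞ := sigmaMin (transJac c x)

/-- `L_x^f = sup_{Θ_x} ‖∇f(A(y))‖`. -/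
def LfAt (f : Eu n → ℝ) (c : Eu n → Eu p) (A : Eu n → Eu n) (x : Eu n) : ℝ≥0∞ :=
  supNormOn (fun y => gradient f (A y)) (thetaBall c x)

/-- `M_x^c = sup_{Θ_x} ‖J_c(y)‖`. -/
def McAt (c : Eu n → Eu p) (x : Eu n) : ℝ≥0∞ :=
  supNormOn (transJac c) (thetaBall c x)

/-- `M_x^A = sup_{Θ_x} ‖J_A(y)‖`. -/
def MaAt (c : Eu n → Eu p) (A : Eu n → Eu n) (x : Eu n) : ℝ≥0∞ :=
  supNormOn (transJac A) (thetaBall c x)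

/-- Lipschitz constant of `∇g` on `Θ_x`. -/
def LgAt (f : Eu n → ℝ) (c : Eu n → Eu p) (A : Eu n → Eu n) (x : Eu n) : ℝ≥0∞ :=
  lipOn (gradient (gFun f A)) (thetaBall c x)

/-- Lipschitz constant of `J_c` on `Θ_x`. -/
def LcAt (c : Eu n → Eu p) (x : Eu n) : ℝ≥0∞ :=
  lipOn (transJac c) (thetaBall c x)

/-- Lipschitz constant of `J_A` on `Θ_x`. -/
def LaAt (c : Eu n → Eu p) (A : Eu n → Eu n) (x : Eu n) : ℝ≥0∞ :=
  lipOn (transJac A) (thetaBall c x)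

/-- Lipschitz constant of `y ↦ J_A(y) J_c(A(y))` on `Θ_x`. -/
def LacAt (c : Eu n → Eu p) (A : Eu n → Eu n) (x : Eu n) : ℝ≥0∞ :=
  lipOn (fun y => (transJac A y).comp (transJac c (A y))) (thetaBall c x)

/-- `ε_x`. -/
def epsAt (c : Eu n → Eu p) (A : Eu n → Eu n) (x : Eu n) : ℝ≥0∞ :=
  min (ENNReal.ofReal (rhoAt c x / 2))
    (min (sigmaAt c x / (32 * LcAt c x * (MaAt c A x + 1)))
      (sigmaAt c x ^ 2 / (8 * LacAt c A x * McAt c x)))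

/-- The ball of radius `σ_x ε_x / (4 M_x^c (M_x^A + 1) + σ_x)` around `x`. -/
def omegaBarAt (c : Eu n → Eu p) (A : Eu n → Eu n) (x : Eu n) : Set (Eu n) :=
  {y | ‖y - x‖ₑ ≤ sigmaAt c x * epsAt c A x / (4 * McAt c x * (MaAt c A x + 1) + sigmaAt c x)}

/-- The neighbourhood of `M` obtained as the union of these balls over `x ∈ M`. -/
def omegaBar (c : Eu n → Eu p) (A : Eu n → Eu n) : Set (Eu n) :=
  ⋃ x ∈ feasible c, omegaBarAt c A x

/-- The local penalty threshold `β_x`. -/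
def betaAt (f : Eu n → ℝ) (c : Eu n → Eu p) (A : Eu n → Eu n) (x : Eu n) : ℝ≥0∞ :=
  max (128 * LgAt f c A x * (MaAt c A x + 1) ^ 2 / sigmaAt c x ^ 2)
    (max (64 * LfAt f c A x * (MaAt c A x + 1) * LacAt c A x / sigmaAt c x ^ 3)
      (16 * LfAt f c A x * LaAt c A x * (2 * MaAt c A x + 1) / sigmaAt c x ^ 2))

/-! ### Global constants -/

/-- The level set `{y ∈ M : f(y) ≤ f(x)}`. -/
def levelSet (f : Eu n → ℝ) (c : Eu n → Eu p) (x : Eu n) : Set (Eu n) :=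
  {y | y ∈ feasible c ∧ f y ≤ f x}

/-- `Γ_{x,ζ}`: the points at distance at most `ζ + 1` from the level set of `x`. -/
def gammaSet (f : Eu n → ℝ) (c : Eu n → Eu p) (x : Eu n) (ζ : ℝ) : Set (Eu n) :=
  {y | Metric.infDist y (levelSet f c x) ≤ ζ + 1}

/-- `μ_{x,ζ} = inf ‖c(y)‖²` over the points of `Γ_{x,ζ}` outside `omegaBar`. -/
def muConst (f : Eu n → ℝ) (c : Eu n → Eu p) (A : Eu n → Eu n) (x : Eu n) (ζ : ℝ) : ℝ≥0∞ :=
  ⨅ y ∈ gammaSet f c x ζ \ omegaBar c A, ‖c y‖ₑ ^ 2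

/-- `sup_{y, z ∈ Γ_{x,ζ}} (g(y) - g(z))`. -/
def oscConst (f : Eu n → ℝ) (c : Eu n → Eu p) (A : Eu n → Eu n) (x : Eu n) (ζ : ℝ) : ℝ≥0∞ :=
  ⨆ (y ∈ gammaSet f c x ζ) (z ∈ gammaSet f c x ζ), ENNReal.ofReal (gFun f A y - gFun f A z)

/-- The global penalty threshold. -/
def betaBar (f : Eu n → ℝ) (c : Eu n → Eu p) (A : Eu n → Eu n) (x : Eu n) (ζ : ℝ) : ℝ≥0∞ :=
  max (4 * oscConst f c A x ζ / muConst f c A x ζ)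
    (⨆ w ∈ feasible c ∩ gammaSet f c x ζ, betaAt f c A w)

/-- The Lipschitz constant of `∇²g` on `Γ_{x,ζ}`. -/
def hessLipConst (f : Eu n → ℝ) (c : Eu n → Eu p) (A : Eu n → Eu n) (x : Eu n) (ζ : ℝ) : ℝ≥0∞ :=
  lipOn (hessian (gFun f A)) (gammaSet f c x ζ)

/-- `inf σ_y` over `y ∈ Γ_{x,ζ} ∩ omegaBar`. -/
def sigmaTilde (f : Eu n → ℝ) (c : Eu n → Eu p) (A : Eu n → Eu n) (x : Eu n) (ζ : ℝ) : ℝ≥0∞ :=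
  ⨅ y ∈ gammaSet f c x ζ ∩ omegaBar c A, sigmaAt c y

/-- `sup M_y^A` over `y ∈ Γ_{x,ζ} ∩ omegaBar`. -/
def MaTilde (f : Eu n → ℝ) (c : Eu n → Eu p) (A : Eu n → Eu n) (x : Eu n) (ζ : ℝ) : ℝ≥0∞ :=
  ⨆ y ∈ gammaSet f c x ζ ∩ omegaBar c A, MaAt c A y

/-- The lower bound that the algorithm imposes on `β`. -/
def betaThreshold (f : Eu n → ℝ) (c : Eu n → Eu p) (A : Eu n → Eu n) (x : Eu n) (ζ : ℝ) : ℝ≥0∞ :=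
  max (betaBar f c A x ζ)
    (96 * hessLipConst f c A x ζ * (MaTilde f c A x ζ + 1) ^ 2 / sigmaTilde f c A x ζ ^ 2)

/-- The value that the algorithm prescribes for the regularization parameter `ν`. -/
def nuValue (f : Eu n → ℝ) (c : Eu n → Eu p) (A : Eu n → Eu n) (β : ℝ) (x : Eu n) (ζ : ℝ) :
    ℝ≥0∞ :=
  max (lipOn (hessian (hFun f c A β)) (gammaSet f c x ζ))
    (max (⨆ y ∈ gammaSet f c x ζ, 2 * ‖hessian (hFun f c A β) y‖ₑ / ENNReal.ofReal ζ)
      (⨆ y ∈ gammaSet f c x ζ, ‖gradient (hFun f c A β) y‖ₑ / ENNReal.ofReal ζ ^ 2))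

/-! ### The cubic regularization method with momentum -/

/-- The cubic model `dᵀ∇h(x) + (1/2) dᵀ∇²h(x)d + (ν/6)‖d‖³`. -/
def cubicModel (h : Eu n → ℝ) (ν : ℝ) (x d : Eu n) : ℝ :=
  inner ℝ d (gradient h x) + 1 / 2 * inner ℝ d (hessian h x d) + ν / 6 * ‖d‖ ^ 3

/-- The momentum weight `τ_k`, from `x_k` and `y_{k+1}`. -/
def momentumWeight (h : Eu n → ℝ) (ρ : ℝ) (xk ynext : Eu n) : ℝ :=
  min ρ (min ‖gradient h ynext‖ ‖ynext - xk‖)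

/-- The momentum point `v_{k+1}`, from `x_k`, `y_k` and `y_{k+1}`. -/
def momentumPoint (h : Eu n → ℝ) (ρ : ℝ) (xk yk ynext : Eu n) : Eu n :=
  ynext + momentumWeight h ρ xk ynext • (ynext - yk)

/-- `x` and `y` are sequences generated by the cubic regularization method with momentum for
minimizing `h`, started at `x₀`; `d_k = y_{k+1} - x_k` may be any global minimizer of the cubic
model at `x_k`. -/
structure IsCRMRun (h : Eu n → ℝ) (ρ ν : ℝ) (x₀ : Eu n) (x y : ℕ → Eu n) : Prop where
  x_zero : x 0 = x₀
  y_zero : y 0 = x₀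
  cubic_step : ∀ k, IsMinOn (cubicModel h ν (x k)) univ (y (k + 1) - x k)
  select_step : ∀ k, x (k + 1) =
    if h (y (k + 1)) ≤ h (momentumPoint h ρ (x k) (y k) (y (k + 1))) then y (k + 1)
    else momentumPoint h ρ (x k) (y k) (y (k + 1))

end CDF

end

/-! ### Multipliers, nearest feasible points and feasible curves -/

namespace CDF

variable {n p : ℕ}

/-! The penalty function h controls the distance to M on a whole neighbourhood of M. At a feasible z
the differential of A maps into the tangent space and fixes it (`fderiv_comp_eq_zero`,
`fderiv_apply_tangent`), so c ∘ A vanishes to second order on M. On `omegaBar` each application of A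
therefore shrinks ‖c‖ by a factor 4 (`norm_c_A_le`) and raises f ∘ A by at most a small multiple of
β‖c‖² (`g_step`). Hence A^k y converges to a feasible z with ‖y - z‖ = O(‖c y‖) and f z ≤ h y.
Testing ∇h(y) against A y - y gives ‖c y‖ = O(‖∇h(y)‖) (`norm_c_le_gradient`).

Confinement: the μ-term of the threshold forces points of Γ with h ≤ f x₀ into `omegaBar`. Their
limits lie in the level set of x₀, so such a point within ζ + 9/10 of the level set is in fact
within 1/2 of it (`infDist_le_half`). A cubic step cannot cross this gap, because the model stays
nonpositive along the step (`cubic_step`). A momentum move is a jump, so its length must be bounded.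
A point outside `omegaBar` close to a minimizer of f on M, together with the Hessian part of ν,
bounds the oscillation of f ∘ A on Γ by νζ/25 (`osc_small`). Thus the cubed step lengths sum to at
most 12ζ/25, and an induction based on Young's inequality bounds every jump by ζ + 2/5 (`run_step`).

Complexity: let a be the length of a cubic step. The gradient of h after the step is O(a²) and the
Hessian before it is at least -O(a); the momentum weight is small enough to preserve both orders.
The estimates pass to the limit z of A^k(x (k + 1)), where h and f ∘ A have the same gradient and
the same Hessian on tangent vectors, and where the Riemannian Hessian of f is bounded below by that
of f ∘ A up to O(‖∇(f ∘ A)‖) (`exists_accuracy`). Since the sum of a³ is bounded, some step among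
O(ε^(-3/2)) of them has length O(√ε). If β or ν is 0, then x₀ is itself stationary. -/

theorem transJac_inner {m : ℕ} (F : Eu n → Eu m) (x v : Eu n) (u : Eu m) :
    inner ℝ (transJac F x u) v = inner ℝ u (fderiv ℝ F x v) :=
  ContinuousLinearMap.adjoint_inner_left _ _ _

theorem norm_transJac_sub {m : ℕ} (F : Eu n → Eu m) (x y : Eu n) :
    ‖transJac F x - transJac F y‖ = ‖fderiv ℝ F x - fderiv ℝ F y‖ := by
  rw [transJac, transJac, ← map_sub, LinearIsometryEquiv.norm_map]

theorem norm_transJac {m : ℕ} (F : Eu n → Eu m) (x : Eu n) :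
    ‖transJac F x‖ = ‖fderiv ℝ F x‖ := by
  rw [transJac, LinearIsometryEquiv.norm_map]

theorem contDiff_one_of_differentiable_fderiv {V W : Type*} [NormedAddCommGroup V]
    [NormedSpace ℝ V] [NormedAddCommGroup W] [NormedSpace ℝ W] {F : V → W}
    (h1 : Differentiable ℝ F) (h2 : Differentiable ℝ (fderiv ℝ F)) : ContDiff ℝ 1 F :=
  contDiff_one_iff_fderiv.2 ⟨h1, h2.continuous⟩

theorem isClosed_feasible {c : Eu n → Eu p} (hc : Continuous c) : IsClosed (feasible c) :=
  isClosed_singleton.preimage hc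

/-- First-order necessary condition for a constrained local minimum. -/
theorem exists_multiplier {c : Eu n → Eu p} (hc : ContDiff ℝ 1 c) {φ : Eu n → ℝ}
    {φ' : Eu n →L[ℝ] ℝ} {z : Eu n} (hz : z ∈ feasible c)
    (hinj : Function.Injective (transJac c z)) (hφ : HasStrictFDerivAt φ φ' z)
    (hmin : IsLocalMinOn φ (feasible c) z) :
    ∃ u : Eu p, ∀ v, φ' v = inner ℝ (transJac c z u) v := by
  have hs : {x | c x = c z} = feasible c := by
    ext x; simp [feasible, show c z = 0 from hz]
  have hext : IsLocalExtrOn φ {x | c x = c z} z := by rw [hs]; exact Or.inl hmin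
  obtain ⟨Λ, Λ₀, hne, h⟩ := hext.exists_linear_map_of_hasStrictFDerivAt
    (hc.hasStrictFDerivAt one_ne_zero) hφ
  set l : Eu p := (InnerProductSpace.toDual ℝ (Eu p)).symm (LinearMap.toContinuousLinearMap Λ)
  have hl : ∀ w, Λ w = inner ℝ l w := fun w => by
    simp [l, InnerProductSpace.toDual_symm_apply]
  have h' : ∀ v, inner ℝ (transJac c z l) v + Λ₀ * φ' v = 0 := fun v => by
    rw [transJac_inner, ← hl]; exact h v
  have h0 : Λ₀ ≠ 0 := by
    rintro rfl
    have h1 : transJac c z l = 0 := by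
      have := h' (transJac c z l)
      simpa using this
    have h2 : l = 0 := hinj (by rw [h1, map_zero])
    refine hne (Prod.ext ?_ rfl)
    ext w
    simp [hl, h2]
  refine ⟨-(Λ₀⁻¹ • l), fun v => ?_⟩
  have := h' v
  rw [map_neg, map_smul, inner_neg_left, real_inner_smul_left]
  field_simp
  linarith

/-- A feasible point nearest to `w`. -/
def IsNearest (c : Eu n → Eu p) (w z : Eu n) : Prop :=
  z ∈ feasible c ∧ ∀ z' ∈ feasible c, ‖w - z‖ ≤ ‖w - z'‖

theorem exists_isNearest {c : Eu n → Eu p} (hc : Continuous c) (hne : (feasible c).Nonempty)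
    (w : Eu n) : ∃ z, IsNearest c w z := by
  obtain ⟨z, hz, h⟩ := (isClosed_feasible hc).exists_infDist_eq_dist hne w
  refine ⟨z, hz, fun z' hz' => ?_⟩
  rw [← dist_eq_norm, ← dist_eq_norm, ← h]
  exact Metric.infDist_le_dist_of_mem hz'

/-- The multiplier rule applied to ‖y - w‖², whose gradient at z is 2(z - w). -/
theorem IsNearest.exists_normal {c : Eu n → Eu p} (hc : ContDiff ℝ 1 c) {w z : Eu n}
    (h : IsNearest c w z) (hinj : Function.Injective (transJac c z)) :
    ∃ u, w - z = transJac c z u := by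
  have hd : HasStrictFDerivAt (fun y : Eu n => ‖y - w‖ ^ 2)
      (2 • (innerSL ℝ (z - w)).comp (ContinuousLinearMap.id ℝ (Eu n))) z := by
    exact (hasStrictFDerivAt_norm_sq (z - w)).comp z
      ((hasStrictFDerivAt_id (𝕜 := ℝ) z).sub_const w)
  have hmin : IsLocalMinOn (fun y : Eu n => ‖y - w‖ ^ 2) (feasible c) z := by
    refine IsMinOn.localize fun y hy => ?_
    have := h.2 y hy
    simp only [mem_ofPred_eq]
    rw [norm_sub_rev z, norm_sub_rev y]
    gcongr
  obtain ⟨u, hu⟩ := exists_multiplier hc h.1 hinj hd hmin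
  refine ⟨-((1 / 2 : ℝ) • u), ext_inner_right ℝ fun v => ?_⟩
  have := hu v
  simp only [ContinuousLinearMap.comp_id, nsmul_eq_mul, smul_apply,
    innerSL_apply_apply, inner_sub_left] at this
  rw [map_neg, map_smul, inner_neg_left, real_inner_smul_left, inner_sub_left, ← this]
  simp

/-- First-order Taylor estimate on a convex set with Lipschitz derivative. -/
theorem norm_taylor_le {V W : Type*} [NormedAddCommGroup V] [NormedSpace ℝ V]
    [NormedAddCommGroup W] [NormedSpace ℝ W] {F : V → W} (hF : Differentiable ℝ F) {s : Set V}
    (hs : Convex ℝ s) {L : ℝ} (hL : 0 ≤ L)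
    (hLip : ∀ y ∈ s, ∀ z ∈ s, ‖fderiv ℝ F y - fderiv ℝ F z‖ ≤ L * ‖y - z‖) {z w : V}
    (hz : z ∈ s) (hw : w ∈ s) : ‖F w - F z - fderiv ℝ F z (w - z)‖ ≤ L * ‖w - z‖ * ‖w - z‖ := by
  have hsub : segment ℝ z w ⊆ s := hs.segment_subset hz hw
  refine Convex.norm_image_sub_le_of_norm_fderiv_le' (𝕜 := ℝ) (s := segment ℝ z w)
    (fun x _ => hF x) (fun x hx => ?_) (convex_segment z w) (left_mem_segment ℝ z w)
    (right_mem_segment ℝ z w)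
  refine (hLip x (hsub hx) z hz).trans ?_
  gcongr
  obtain ⟨t, ht, rfl⟩ := (segment_eq_image' ℝ z w).subset hx
  rw [add_sub_cancel_left, norm_smul, Real.norm_of_nonneg ht.1]
  exact mul_le_of_le_one_left (norm_nonneg _) ht.2

/-- Near a feasible point, a nearest feasible point is controlled by the constraint violation. -/
theorem IsNearest.error_bound {c : Eu n → Eu p} (hc : ContDiff ℝ 1 c)
    {x : Eu n} (hx : x ∈ feasible c) {σ L R e : ℝ} (hσ0 : 0 < σ) (hL : 0 ≤ L)
    (hσ : ∀ u, σ * ‖u‖ ≤ ‖transJac c x u‖)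
    (hLip : ∀ y ∈ Metric.closedBall x R, ∀ z ∈ Metric.closedBall x R,
      ‖fderiv ℝ c y - fderiv ℝ c z‖ ≤ L * ‖y - z‖)
    (he : 2 * e ≤ R) (hLe : 32 * (L * e) ≤ σ) {w z : Eu n} (hw : ‖w - x‖ ≤ e)
    (hz : IsNearest c w z) :
    ‖w - z‖ ≤ ‖w - x‖ ∧ ‖z - x‖ ≤ 2 * ‖w - x‖ ∧ (∀ u, σ / 2 * ‖u‖ ≤ ‖transJac c z u‖) ∧
      (∃ u, w - z = transJac c z u) ∧ σ / 2 * ‖w - z‖ ≤ ‖c w‖ := by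
  have h1 : ‖w - z‖ ≤ ‖w - x‖ := hz.2 x hx
  have h2 : ‖z - x‖ ≤ 2 * ‖w - x‖ := by
    have : z - x = (w - x) - (w - z) := by abel
    rw [this]
    linarith [norm_sub_le (w - x) (w - z)]
  have hn := norm_nonneg (w - x)
  have hxB : x ∈ Metric.closedBall x R := Metric.mem_closedBall_self (by linarith)
  have hzB : z ∈ Metric.closedBall x R := by rw [mem_closedBall_iff_norm]; linarith
  have hwB : w ∈ Metric.closedBall x R := by rw [mem_closedBall_iff_norm]; linarith
  -- The Jacobian moves by at most 2Le ≤ σ/16 between x and z.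
  have hσz : ∀ u, 15 / 16 * σ * ‖u‖ ≤ ‖transJac c z u‖ := fun u => by
    have h3 : ‖transJac c x u - transJac c z u‖ ≤ σ / 16 * ‖u‖ := by
      rw [← sub_apply]
      refine (ContinuousLinearMap.le_opNorm _ _).trans ?_
      gcongr
      rw [norm_transJac_sub]
      refine (hLip x hxB z hzB).trans ?_
      rw [norm_sub_rev]
      have : L * ‖z - x‖ ≤ L * (2 * e) := by gcongr; linarith
      linarith
    have h4 := norm_sub_norm_le (transJac c x u) (transJac c z u)
    linarith [hσ u]
  have hσz' : ∀ u, σ / 2 * ‖u‖ ≤ ‖transJac c z u‖ := fun u =>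
    le_trans (by gcongr; linarith) (hσz u)
  have hinj : Function.Injective (transJac c z) := by
    rw [injective_iff_map_eq_zero]
    intro u hu
    have := hσz u
    rw [hu, norm_zero] at this
    have h5 : ‖u‖ ≤ 0 := by
      by_contra hcon
      push Not at hcon
      have : 0 < 15 / 16 * σ * ‖u‖ := by positivity
      linarith
    exact norm_le_zero_iff.1 h5
  obtain ⟨u, hu⟩ := hz.exists_normal hc hinj
  refine ⟨h1, h2, hσz', ⟨u, hu⟩, ?_⟩
  have hT := norm_taylor_le (hc.differentiable one_ne_zero) (convex_closedBall x R) hL hLip hzB hwB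
  rw [show c z = 0 from hz.1, sub_zero] at hT
  have h6 : L * ‖w - z‖ * ‖w - z‖ ≤ σ / 32 * ‖w - z‖ := by
    gcongr
    have : L * ‖w - z‖ ≤ L * e := by gcongr; linarith
    linarith
  -- Because w - z is the normal vector J_c(z)u, its square norm is ⟨u, Dc(z)(w - z)⟩, so Dc(z) is
  -- bounded below on it by 15σ/16. The Taylor remainder costs another σ/32, which leaves more than
  -- σ/2.
  have h7 : ‖w - z‖ ^ 2 ≤ ‖u‖ * ‖fderiv ℝ c z (w - z)‖ := by
    rw [← real_inner_self_eq_norm_sq]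
    nth_rewrite 1 [hu]
    rw [transJac_inner]
    exact real_inner_le_norm _ _
  have h8 : 15 / 16 * σ * ‖u‖ ≤ ‖w - z‖ := by rw [hu]; exact hσz u
  have h9 : 15 / 16 * σ * ‖w - z‖ ≤ ‖fderiv ℝ c z (w - z)‖ := by
    rcases (norm_nonneg (w - z)).eq_or_lt with h0 | h0
    · rw [← h0]; simp
    · have : 15 / 16 * σ * ‖w - z‖ * ‖w - z‖ ≤ ‖fderiv ℝ c z (w - z)‖ * ‖w - z‖ := by
        calc 15 / 16 * σ * ‖w - z‖ * ‖w - z‖ = 15 / 16 * σ * ‖w - z‖ ^ 2 := by ring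
          _ ≤ 15 / 16 * σ * (‖u‖ * ‖fderiv ℝ c z (w - z)‖) := by gcongr
          _ = (15 / 16 * σ * ‖u‖) * ‖fderiv ℝ c z (w - z)‖ := by ring
          _ ≤ ‖w - z‖ * ‖fderiv ℝ c z (w - z)‖ := by gcongr
          _ = _ := by ring
      exact le_of_mul_le_mul_right this h0
  have h10 := norm_sub_norm_le (fderiv ℝ c z (w - z)) (c w)
  rw [norm_sub_rev] at h10
  have h11 : 0 ≤ σ * ‖w - z‖ := by positivity
  linarith

/-- On a compact set, a locally Lipschitz map is Lipschitz with a real constant. -/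
theorem exists_lipschitz_const {V : Type*} [NormedAddCommGroup V] {F : Eu n → V}
    (hF : LocallyLipschitz F) {s : Set (Eu n)} (hs : IsCompact s) :
    ∃ L : ℝ, 0 ≤ L ∧ ∀ y ∈ s, ∀ z ∈ s, ‖F y - F z‖ ≤ L * ‖y - z‖ := by
  obtain ⟨K, hK⟩ := hF.locallyLipschitzOn.exists_lipschitzOnWith_of_compact hs
  exact ⟨K, K.2, fun y hy z hz => hK.norm_sub_le hy hz⟩

theorem exists_sigma_of_injective {T : Eu p →L[ℝ] Eu n} (h : Function.Injective T) :
    ∃ σ : ℝ, 0 < σ ∧ ∀ u, σ * ‖u‖ ≤ ‖T u‖ := by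
  obtain ⟨K, hK, hT⟩ := (T : Eu p →ₗ[ℝ] Eu n).exists_antilipschitzWith (LinearMap.ker_eq_bot.2 h)
  refine ⟨(K : ℝ)⁻¹, by positivity, fun u => ?_⟩
  have h1 : dist u 0 ≤ K * dist (T u) (T 0) := hT.le_mul_dist u 0
  rw [map_zero, dist_zero_right, dist_zero_right] at h1
  rw [inv_mul_le_iff₀ (by positivity)]
  exact h1

/-- Every tangent vector is the velocity of a curve in the feasible set. -/
theorem exists_feasible_curve {c : Eu n → Eu p} (hc : ContDiff ℝ 1 c)
    (hcLip : LocallyLipschitz (transJac c)) {z : Eu n} (hz : z ∈ feasible c)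
    (hinj : Function.Injective (transJac c z)) {d : Eu n} (hd : fderiv ℝ c z d = 0) :
    ∃ w : ℝ → Eu n, (∀ t, w t ∈ feasible c) ∧ w 0 = z ∧ HasDerivAt w d 0 := by
  obtain ⟨σ, hσ0, hσ⟩ := exists_sigma_of_injective hinj
  obtain ⟨L, hL, hLip⟩ := exists_lipschitz_const hcLip (isCompact_closedBall z 1)
  simp only [norm_transJac_sub] at hLip
  -- The curve consists of nearest feasible points to the tangent line.
  choose w hw using fun t : ℝ => exists_isNearest hc.continuous ⟨z, hz⟩ (z + t • d)
  have hw0 : w 0 = z := by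
    have := (hw 0).2 z hz
    simp only [zero_smul, add_zero, sub_self, norm_zero, norm_le_zero_iff] at this
    exact (sub_eq_zero.1 this).symm
  refine ⟨w, fun t => (hw t).1, hw0, ?_⟩
  set e : ℝ := min (1 / 2) (σ / (32 * (L + 1))) with he
  have he0 : 0 < e := by positivity
  have he1 : 32 * (L * e) ≤ σ := by
    have : e ≤ σ / (32 * (L + 1)) := min_le_right _ _
    rw [le_div_iff₀ (by positivity)] at this
    nlinarith
  have hline : HasDerivAt (fun t : ℝ => z + t • d) d 0 := by
    simpa using ((hasDerivAt_id (0 : ℝ)).smul_const d).const_add z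
  have hcd : HasDerivAt (fun t : ℝ => c (z + t • d)) 0 0 := by
    have h1 : HasFDerivAt c (fderiv ℝ c z) (z + (0 : ℝ) • d) := by
      simpa using (hc.differentiable one_ne_zero z).hasFDerivAt
    have := h1.comp_hasDerivAt (0 : ℝ) hline
    rwa [hd] at this
  have hev : ∀ᶠ t : ℝ in 𝓝 0, ‖z + t • d - z‖ ≤ e := by
    have : Tendsto (fun t : ℝ => ‖z + t • d - z‖) (𝓝 0) (𝓝 0) := by
      have h2 : Continuous fun t : ℝ => ‖z + t • d - z‖ := by fun_prop
      simpa using h2.tendsto 0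
    exact (this.eventually (gt_mem_nhds he0)).mono fun _ h => h.le
  -- The error bound makes the deviation from the line O(c(z + td)), and this is o(t) because d is
  -- tangent.
  have hbig : (fun t : ℝ => (z + t • d) - w t) =O[𝓝 0] fun t : ℝ => c (z + t • d) := by
    refine Asymptotics.IsBigO.of_bound (2 / σ) (hev.mono fun t ht => ?_)
    have := (IsNearest.error_bound hc hz hσ0 hL hσ hLip (R := 1)
      (by linarith [min_le_left (1 / 2 : ℝ) (σ / (32 * (L + 1)))]) he1 ht (hw t)).2.2.2.2
    rw [div_mul_eq_mul_div, le_div_iff₀ hσ0]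
    linarith
  rw [hasDerivAt_iff_isLittleO] at hcd ⊢
  simp only [sub_zero, smul_zero, zero_smul, add_zero, show c z = 0 from hz] at hcd
  have := hbig.trans_isLittleO hcd
  simp only [hw0, sub_zero]
  refine this.neg_left.congr_left fun t => by abel

/-! ### The differential of A on the feasible set -/

section Operator

variable {c : Eu n → Eu p} {A : Eu n → Eu n}

/-- The transpose of J_A J_c = 0: the range of the differential of A is tangent to M. -/
theorem fderiv_comp_eq_zero {z : Eu n}
    (h : (transJac A z).comp (transJac c z) = 0) (v : Eu n) :
    fderiv ℝ c z (fderiv ℝ A z v) = 0 := by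
  refine ext_inner_left ℝ fun u => ?_
  rw [← transJac_inner, ← transJac_inner, inner_zero_right, ← ContinuousLinearMap.comp_apply, h]
  simp

/-- Differentiate A(w(t)) = w(t) along a feasible curve with velocity d. -/
theorem fderiv_apply_tangent (hc : ContDiff ℝ 1 c) (hcLip : LocallyLipschitz (transJac c))
    (hA : Differentiable ℝ A) (hAfix : ∀ x ∈ feasible c, A x = x) {z : Eu n}
    (hz : z ∈ feasible c) (hinj : Function.Injective (transJac c z)) {d : Eu n}
    (hd : fderiv ℝ c z d = 0) : fderiv ℝ A z d = d := by
  obtain ⟨w, hw, hw0, hwd⟩ := exists_feasible_curve hc hcLip hz hinj hd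
  have h1 : HasFDerivAt A (fderiv ℝ A z) (w 0) := by rw [hw0]; exact (hA z).hasFDerivAt
  have h2 := h1.comp_hasDerivAt (0 : ℝ) hwd
  have h3 : A ∘ w = w := funext fun t => hAfix _ (hw t)
  rw [h3] at h2
  exact h2.unique hwd

end Operator

/-! ### Standing assumptions and real-valued local constants -/

/-- The standing assumptions on the objective, the constraints and the dissolving operator. -/
structure Admissible (f : Eu n → ℝ) (c : Eu n → Eu p) (A : Eu n → Eu n) : Prop where
  p_pos : 0 < p
  f_diff : Differentiable ℝ f
  f_diff2 : Differentiable ℝ (fderiv ℝ f)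
  c_diff : Differentiable ℝ c
  c_diff2 : Differentiable ℝ (fderiv ℝ c)
  A_diff : Differentiable ℝ A
  A_diff2 : Differentiable ℝ (fderiv ℝ A)
  c_lip : LocallyLipschitz (transJac c)
  licq : ∀ x ∈ feasible c, Function.Injective (transJac c x)
  A_lip : LocallyLipschitz (transJac A)
  A_fix : ∀ x ∈ feasible c, A x = x
  A_jac : ∀ x ∈ feasible c, (transJac A x).comp (transJac c x) = 0
  g_lip : LocallyLipschitz (hessian (gFun f A))

/-- Real constants bounding all relevant quantities on a ball around a feasible point, with a
radius `e` and a penalty parameter `β` compatible with them. -/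
structure LocalBounds (f : Eu n → ℝ) (c : Eu n → Eu p) (A : Eu n → Eu n) (x : Eu n) (β : ℝ) where
  (σ Mc MA Lc LA LAc Lf Lg R e : ℝ)
  σ_pos : 0 < σ
  MA_nonneg : 0 ≤ MA
  Lc_nonneg : 0 ≤ Lc
  LA_nonneg : 0 ≤ LA
  LAc_nonneg : 0 ≤ LAc
  Lf_nonneg : 0 ≤ Lf
  Lg_nonneg : 0 ≤ Lg
  e_nonneg : 0 ≤ e
  R_le : R ≤ 1
  e_R : 2 * e ≤ R
  σ_le : ∀ u, σ * ‖u‖ ≤ ‖transJac c x u‖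
  Mc_bd : ∀ y ∈ Metric.closedBall x R, ‖fderiv ℝ c y‖ ≤ Mc
  MA_bd : ∀ y ∈ Metric.closedBall x R, ‖fderiv ℝ A y‖ ≤ MA
  Lf_bd : ∀ y ∈ Metric.closedBall x R, ‖gradient f (A y)‖ ≤ Lf
  Lc_lip : ∀ y ∈ Metric.closedBall x R, ∀ z ∈ Metric.closedBall x R,
    ‖fderiv ℝ c y - fderiv ℝ c z‖ ≤ Lc * ‖y - z‖
  LA_lip : ∀ y ∈ Metric.closedBall x R, ∀ z ∈ Metric.closedBall x R,
    ‖fderiv ℝ A y - fderiv ℝ A z‖ ≤ LA * ‖y - z‖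
  LAc_lip : ∀ y ∈ Metric.closedBall x R, ∀ z ∈ Metric.closedBall x R,
    ‖(transJac A y).comp (transJac c (A y)) - (transJac A z).comp (transJac c (A z))‖
      ≤ LAc * ‖y - z‖
  Lg_lip : ∀ y ∈ Metric.closedBall x R, ∀ z ∈ Metric.closedBall x R,
    ‖gradient (gFun f A) y - gradient (gFun f A) z‖ ≤ Lg * ‖y - z‖
  e_Lc : 32 * (Lc * (MA + 1) * e) ≤ σ
  e_LAc : 8 * (LAc * Mc * e) ≤ σ ^ 2
  β_Lg : 128 * (Lg * (MA + 1) ^ 2) ≤ β * σ ^ 2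
  β_LA : 16 * (Lf * LA * (2 * MA + 1)) ≤ β * σ ^ 2

section Smoothness

variable {f : Eu n → ℝ} {c : Eu n → Eu p} {A : Eu n → Eu n}

namespace Admissible

variable (S : Admissible f c A)
include S

theorem c_contDiff : ContDiff ℝ 1 c := contDiff_one_of_differentiable_fderiv S.c_diff S.c_diff2

theorem A_contDiff : ContDiff ℝ 1 A := contDiff_one_of_differentiable_fderiv S.A_diff S.A_diff2

theorem f_contDiff : ContDiff ℝ 1 f := contDiff_one_of_differentiable_fderiv S.f_diff S.f_diff2

theorem g_diff : Differentiable ℝ (gFun f A) := S.f_diff.comp S.A_diff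

theorem fderiv_g (w : Eu n) :
    fderiv ℝ (gFun f A) w = (fderiv ℝ f (A w)).comp (fderiv ℝ A w) :=
  fderiv_comp w (S.f_diff _) (S.A_diff _)

end Admissible

theorem gradient_inner {φ : Eu n → ℝ} (x v : Eu n) :
    inner ℝ (gradient φ x) v = fderiv ℝ φ x v := by
  rw [gradient, InnerProductSpace.toDual_symm_apply]

theorem norm_gradient_sub (φ ψ : Eu n → ℝ) (x y : Eu n) :
    ‖gradient φ x - gradient ψ y‖ = ‖fderiv ℝ φ x - fderiv ℝ ψ y‖ := by
  rw [gradient, gradient, ← map_sub, LinearIsometryEquiv.norm_map]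

theorem transJac_comp {B : Eu n → Eu p} (w : Eu n) (hB : DifferentiableAt ℝ B (A w))
    (hA : DifferentiableAt ℝ A w) :
    transJac (B ∘ A) w = (transJac A w).comp (transJac B (A w)) := by
  rw [transJac, fderiv_comp w hB hA, ContinuousLinearMap.adjoint_comp]
  rfl

theorem norm_le_of_sq_le {a b : ℝ} (hb : 0 ≤ b) (h : a ^ 2 ≤ b * a) : a ≤ b := by
  by_contra hcon
  push Not at hcon
  nlinarith

end Smoothness

/-! ### Iterating A near a feasible point -/

section Local

variable {f : Eu n → ℝ} {c : Eu n → Eu p} {A : Eu n → Eu n} {x : Eu n} {β : ℝ}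

namespace LocalBounds

variable (D : LocalBounds f c A x β)
include D

theorem R_nonneg : 0 ≤ D.R := by linarith [D.e_nonneg, D.e_R]

theorem mem_ball {w : Eu n} (hw : ‖w - x‖ ≤ 2 * D.e) : w ∈ Metric.closedBall x D.R := by
  rw [mem_closedBall_iff_norm]
  linarith [D.e_R]

theorem one_le : 0 < D.MA + 1 := by linarith [D.MA_nonneg]

theorem e_Lc' : 32 * (D.Lc * D.e) ≤ D.σ := by
  have := mul_nonneg (mul_nonneg D.Lc_nonneg D.MA_nonneg) D.e_nonneg
  have := D.e_Lc
  nlinarith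

variable (S : Admissible f c A) (hx : x ∈ feasible c)
include S

theorem σ_le_Mc : D.σ ≤ D.Mc := by
  have : Nonempty (Fin p) := ⟨⟨0, S.p_pos⟩⟩
  obtain ⟨u, hu⟩ := exists_norm_eq (Eu p) (zero_le_one' ℝ)
  have h1 := D.σ_le u
  have h2 := (transJac c x).le_opNorm u
  rw [norm_transJac] at h2
  have h3 := D.Mc_bd x (Metric.mem_closedBall_self D.R_nonneg)
  rw [hu] at h1 h2
  linarith

include hx

theorem norm_c_le {w : Eu n} (hw : ‖w - x‖ ≤ D.e) : ‖c w‖ ≤ D.Mc * ‖w - x‖ := by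
  have := (convex_closedBall x D.R).norm_image_sub_le_of_norm_fderiv_le (𝕜 := ℝ)
    (fun y _ => S.c_diff y) D.Mc_bd (Metric.mem_closedBall_self D.R_nonneg)
    (D.mem_ball (w := w) (by linarith [D.e_nonneg]))
  rwa [show c x = 0 from hx, sub_zero] at this

theorem nearest {w z : Eu n} (hw : ‖w - x‖ ≤ D.e) (hz : IsNearest c w z) :
    ‖w - z‖ ≤ ‖w - x‖ ∧ ‖z - x‖ ≤ 2 * ‖w - x‖ ∧ (∀ u, D.σ / 2 * ‖u‖ ≤ ‖transJac c z u‖) ∧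
      (∃ u, w - z = transJac c z u) ∧ D.σ / 2 * ‖w - z‖ ≤ ‖c w‖ :=
  hz.error_bound S.c_contDiff hx D.σ_pos D.Lc_nonneg D.σ_le D.Lc_lip D.e_R D.e_Lc' hw

/-- The map c ∘ A and its differential both vanish at the nearest feasible point z, so Taylor's
estimate is quadratic in ‖w - z‖. The radius e makes it at most σ/8 · ‖w - z‖, and the error bound
converts this to ‖c w‖/4. -/
theorem norm_c_A_le {w : Eu n} (hw : ‖w - x‖ ≤ D.e) : ‖c (A w)‖ ≤ 1 / 4 * ‖c w‖ := by
  obtain ⟨z, hz⟩ := exists_isNearest S.c_diff.continuous ⟨x, hx⟩ w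
  obtain ⟨h1, h2, -, -, h5⟩ := D.nearest S hx hw hz
  have hwB := D.mem_ball (w := w) (by linarith [D.e_nonneg])
  have hzB := D.mem_ball (w := z) (by linarith)
  have hT := norm_taylor_le (F := c ∘ A) (S.c_diff.comp S.A_diff) (convex_closedBall x D.R)
    D.LAc_nonneg (fun y hy y' hy' => by
      rw [← norm_transJac_sub, transJac_comp _ (S.c_diff _) (S.A_diff _),
        transJac_comp _ (S.c_diff _) (S.A_diff _)]
      exact D.LAc_lip y hy y' hy') hzB hwB
  have h0 : fderiv ℝ (c ∘ A) z (w - z) = 0 := by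
    rw [fderiv_comp z (S.c_diff _) (S.A_diff _), ContinuousLinearMap.comp_apply, S.A_fix z hz.1]
    exact fderiv_comp_eq_zero (S.A_jac z hz.1) _
  rw [h0, sub_zero, Function.comp_apply, Function.comp_apply, S.A_fix z hz.1,
    show c z = 0 from hz.1, sub_zero] at hT
  have h6 : 8 * (D.LAc * D.e) ≤ D.σ := by
    have h7 : 8 * (D.LAc * D.e) * D.σ ≤ D.σ * D.σ := by
      have := D.e_LAc
      have h8 : D.LAc * D.e * D.σ ≤ D.LAc * D.e * D.Mc :=
        mul_le_mul_of_nonneg_left (D.σ_le_Mc S) (mul_nonneg D.LAc_nonneg D.e_nonneg)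
      linarith
    exact le_of_mul_le_mul_right h7 D.σ_pos
  have h9 : D.LAc * ‖w - z‖ ≤ D.LAc * D.e := mul_le_mul_of_nonneg_left (h1.trans hw) D.LAc_nonneg
  have h10 : D.LAc * ‖w - z‖ * ‖w - z‖ ≤ D.σ / 8 * ‖w - z‖ := by gcongr; linarith
  linarith

/-- The distance from `A w` to `w`, through a nearest feasible point. -/
theorem norm_A_sub_le_dist {w z : Eu n} (hw : ‖w - x‖ ≤ D.e) (hz : IsNearest c w z) :
    ‖A w - w‖ ≤ (D.MA + 1) * ‖w - z‖ := by
  obtain ⟨h1, h2, -⟩ := D.nearest S hx hw hz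
  have := (convex_closedBall x D.R).norm_image_sub_le_of_norm_fderiv_le (𝕜 := ℝ)
    (fun y _ => S.A_diff y) D.MA_bd (D.mem_ball (w := z) (by linarith))
    (D.mem_ball (w := w) (by linarith [D.e_nonneg]))
  rw [S.A_fix z hz.1] at this
  have h3 : A w - w = (A w - z) - (w - z) := by abel
  rw [h3]
  linarith [norm_sub_le (A w - z) (w - z)]

theorem norm_A_sub_le {w : Eu n} (hw : ‖w - x‖ ≤ D.e) :
    ‖A w - w‖ ≤ 2 * (D.MA + 1) / D.σ * ‖c w‖ := by
  obtain ⟨z, hz⟩ := exists_isNearest S.c_diff.continuous ⟨x, hx⟩ w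
  refine (D.norm_A_sub_le_dist S hx hw hz).trans ?_
  have h5 := (D.nearest S hx hw hz).2.2.2.2
  have := D.one_le
  have := D.σ_pos
  rw [div_mul_eq_mul_div, le_div_iff₀ D.σ_pos]
  nlinarith [mul_le_mul_of_nonneg_left h5 D.one_le.le]

/-- At z the differential of A is a projection, so it annihilates DA(z)v - v with v = w - z, which
is the first-order part of A w - w. What remains is a Taylor remainder and the variation of DA
between z and w, both quadratic. -/
theorem norm_fderiv_A_sub_le {w z : Eu n} (hw : ‖w - x‖ ≤ D.e) (hz : IsNearest c w z) :
    ‖fderiv ℝ A w (A w - w)‖ ≤ D.LA * (2 * D.MA + 1) * ‖w - z‖ ^ 2 := by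
  obtain ⟨h1, h2, -⟩ := D.nearest S hx hw hz
  have hwB := D.mem_ball (w := w) (by linarith [D.e_nonneg])
  have hzB := D.mem_ball (w := z) (by linarith)
  have hT := norm_taylor_le S.A_diff (convex_closedBall x D.R) D.LA_nonneg D.LA_lip hzB hwB
  rw [S.A_fix z hz.1] at hT
  set v := w - z
  set r := A w - z - fderiv ℝ A z v
  have hid : fderiv ℝ A z (fderiv ℝ A z v - v) = 0 := by
    rw [map_sub, fderiv_apply_tangent S.c_contDiff S.c_lip S.A_diff S.A_fix hz.1 (S.licq z hz.1)
      (fderiv_comp_eq_zero (S.A_jac z hz.1) v), sub_self]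
  have hdec : fderiv ℝ A w (A w - w)
      = fderiv ℝ A w r + (fderiv ℝ A w - fderiv ℝ A z) (fderiv ℝ A z v - v) := by
    rw [sub_apply, hid, sub_zero, ← map_add]
    congr 1
    simp only [r, v]
    abel
  rw [hdec]
  have b1 : ‖fderiv ℝ A w r‖ ≤ D.MA * (D.LA * ‖v‖ * ‖v‖) :=
    (ContinuousLinearMap.le_opNorm _ _).trans
      (mul_le_mul (D.MA_bd w hwB) hT (norm_nonneg _) D.MA_nonneg)
  have b2 : ‖fderiv ℝ A z v - v‖ ≤ D.MA * ‖v‖ + ‖v‖ :=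
    (norm_sub_le _ _).trans (by
      gcongr
      exact (ContinuousLinearMap.le_opNorm _ _).trans (by gcongr; exact D.MA_bd z hzB))
  have b3 : ‖(fderiv ℝ A w - fderiv ℝ A z) (fderiv ℝ A z v - v)‖
      ≤ (D.LA * ‖v‖) * (D.MA * ‖v‖ + ‖v‖) :=
    (ContinuousLinearMap.le_opNorm _ _).trans
      (mul_le_mul (D.LA_lip w hwB z hzB) b2 (norm_nonneg _)
        (mul_nonneg D.LA_nonneg (norm_nonneg _)))
  calc _ ≤ _ := norm_add_le _ _
    _ ≤ D.MA * (D.LA * ‖v‖ * ‖v‖) + (D.LA * ‖v‖) * (D.MA * ‖v‖ + ‖v‖) := add_le_add b1 b3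
    _ = _ := by ring

/-- The chain rule reduces this to the quadratic bound on DA(w)(A w - w); the last term of β_x is
tailored to give the factor β/4. -/
theorem abs_fderiv_g_le {w : Eu n} (hw : ‖w - x‖ ≤ D.e) :
    |fderiv ℝ (gFun f A) w (A w - w)| ≤ β / 4 * ‖c w‖ ^ 2 := by
  obtain ⟨z, hz⟩ := exists_isNearest S.c_diff.continuous ⟨x, hx⟩ w
  obtain ⟨h1, h2, -, -, h5⟩ := D.nearest S hx hw hz
  rw [S.fderiv_g, ContinuousLinearMap.comp_apply, ← gradient_inner]
  have b0 := D.norm_fderiv_A_sub_le S hx hw hz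
  have b1 := D.Lf_bd w (D.mem_ball (by linarith [D.e_nonneg]))
  have b2 := D.β_LA
  have hσ := D.σ_pos
  have hM := D.MA_nonneg
  have hL := D.LA_nonneg
  have hF := D.Lf_nonneg
  have b3 : ‖w - z‖ ^ 2 ≤ 4 / D.σ ^ 2 * ‖c w‖ ^ 2 := by
    have : (D.σ / 2 * ‖w - z‖) ^ 2 ≤ ‖c w‖ ^ 2 := by gcongr
    rw [div_mul_eq_mul_div, le_div_iff₀ (by positivity)]
    nlinarith
  calc _ ≤ ‖gradient f (A w)‖ * ‖fderiv ℝ A w (A w - w)‖ := abs_real_inner_le_norm _ _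
    _ ≤ D.Lf * (D.LA * (2 * D.MA + 1) * (4 / D.σ ^ 2 * ‖c w‖ ^ 2)) := by
        gcongr
        exact b0.trans (by gcongr)
    _ = (D.Lf * D.LA * (2 * D.MA + 1)) * (4 / D.σ ^ 2 * ‖c w‖ ^ 2) := by ring
    _ ≤ (β * D.σ ^ 2 / 16) * (4 / D.σ ^ 2 * ‖c w‖ ^ 2) := by gcongr; linarith
    _ = _ := by field_simp; ring

/-- The first-order term contributes β/4 and the Taylor remainder β/32, by the first term of β_x. -/
theorem g_step {w : Eu n} (hw : ‖w - x‖ ≤ D.e) (hAw : ‖A w - x‖ ≤ D.e) :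
    gFun f A (A w) - gFun f A w ≤ 9 / 32 * β * ‖c w‖ ^ 2 := by
  have hT := norm_taylor_le S.g_diff (convex_closedBall x D.R) D.Lg_nonneg
    (fun y hy z hz => by rw [← norm_gradient_sub]; exact D.Lg_lip y hy z hz)
    (D.mem_ball (w := w) (by linarith [D.e_nonneg]))
    (D.mem_ball (w := A w) (by linarith [D.e_nonneg]))
  have h1 := (abs_le.1 (D.abs_fderiv_g_le S hx hw)).2
  have h2 := (abs_le.1 hT).2
  have h3 := D.norm_A_sub_le S hx hw
  have hσ := D.σ_pos
  have h4 : D.Lg * ‖A w - w‖ * ‖A w - w‖ ≤ β / 32 * ‖c w‖ ^ 2 := by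
    calc D.Lg * ‖A w - w‖ * ‖A w - w‖
        ≤ D.Lg * (2 * (D.MA + 1) / D.σ * ‖c w‖) * (2 * (D.MA + 1) / D.σ * ‖c w‖) := by
          have := D.Lg_nonneg
          have := D.one_le
          gcongr
      _ = (D.Lg * (D.MA + 1) ^ 2) * (4 / D.σ ^ 2 * ‖c w‖ ^ 2) := by field_simp; ring
      _ ≤ (β * D.σ ^ 2 / 128) * (4 / D.σ ^ 2 * ‖c w‖ ^ 2) := by
          gcongr; linarith [D.β_Lg]
      _ = _ := by field_simp; ring
  linarith

theorem iterate_bounds {y : Eu n} (hy : ‖y - x‖ * (4 * D.Mc * (D.MA + 1) + D.σ) ≤ D.σ * D.e)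
    (k : ℕ) : ‖A^[k] y - x‖ ≤ D.e ∧ ‖c (A^[k] y)‖ ≤ (1 / 4) ^ k * ‖c y‖ := by
  have hσ := D.σ_pos
  have hM := D.one_le
  have hMc : 0 < D.Mc := hσ.trans_le (D.σ_le_Mc S)
  have hn := norm_nonneg (y - x)
  have hy0 : ‖y - x‖ ≤ D.e := by
    have h1 : 0 ≤ ‖y - x‖ * (4 * D.Mc * (D.MA + 1)) := by positivity
    have h2 : ‖y - x‖ * D.σ ≤ D.e * D.σ := by linarith
    exact le_of_mul_le_mul_right h2 hσ
  have hcy := D.norm_c_le S hx hy0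
  -- `q` bounds the first displacement. Since ‖c‖ decays with ratio 1/4, the total displacement is
  -- at most 4/3 · q, and the radius of the ball in `omegaBarAt` leaves room for it inside the ball
  -- of radius e.
  set q := 2 * (D.MA + 1) / D.σ * ‖c y‖ with hq
  have hq0 : 0 ≤ q := by positivity
  have hqe : ‖y - x‖ + 4 / 3 * q ≤ D.e := by
    have h3 : q * D.σ ≤ 2 * (D.MA + 1) * (D.Mc * ‖y - x‖) := by
      rw [hq]; field_simp; gcongr
    have h4 : (‖y - x‖ + 4 / 3 * q) * D.σ ≤ D.e * D.σ := by
      have h1 : 0 ≤ ‖y - x‖ * (D.Mc * (D.MA + 1)) := by positivity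
      linarith
    exact le_of_mul_le_mul_right h4 hσ
  have key : ∀ k, ‖A^[k] y - y‖ ≤ 4 / 3 * q * (1 - (1 / 4) ^ k) ∧
      ‖c (A^[k] y)‖ ≤ (1 / 4) ^ k * ‖c y‖ := by
    intro k
    induction k with
    | zero => simp
    | succ k ih =>
      obtain ⟨i1, i2⟩ := ih
      have hp : (0 : ℝ) < (1 / 4) ^ k := by positivity
      have hk : ‖A^[k] y - x‖ ≤ D.e := by
        have : A^[k] y - x = (A^[k] y - y) + (y - x) := by abel
        rw [this]
        have := norm_add_le (A^[k] y - y) (y - x)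
        nlinarith
      rw [Function.iterate_succ_apply']
      have h5 := D.norm_c_A_le S hx hk
      have h6 := D.norm_A_sub_le S hx hk
      constructor
      · have h7 : ‖A (A^[k] y) - A^[k] y‖ ≤ q * (1 / 4) ^ k := by
          refine h6.trans ?_
          rw [hq, mul_assoc]
          gcongr
          linarith
        have : A (A^[k] y) - y = (A (A^[k] y) - A^[k] y) + (A^[k] y - y) := by abel
        rw [this, pow_succ]
        have := norm_add_le (A (A^[k] y) - A^[k] y) (A^[k] y - y)
        linarith
      · rw [pow_succ]
        linarith
  refine ⟨?_, (key k).2⟩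
  have : A^[k] y - x = (A^[k] y - y) + (y - x) := by abel
  rw [this]
  have := norm_add_le (A^[k] y - y) (y - x)
  have hp : (0 : ℝ) < (1 / 4) ^ k := by positivity
  have := (key k).1
  nlinarith

theorem norm_sub_le_e {y : Eu n}
    (hy : ‖y - x‖ * (4 * D.Mc * (D.MA + 1) + D.σ) ≤ D.σ * D.e) : ‖y - x‖ ≤ D.e :=
  (D.iterate_bounds S hx hy 0).1

/-- The iterates of the dissolving operator converge to a feasible point. -/
theorem exists_limit {y : Eu n} (hy : ‖y - x‖ * (4 * D.Mc * (D.MA + 1) + D.σ) ≤ D.σ * D.e) :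
    ∃ z, Tendsto (fun k => A^[k] y) atTop (𝓝 z) ∧ z ∈ feasible c ∧
      ‖y - z‖ ≤ 8 / 3 * (D.MA + 1) / D.σ * ‖c y‖ ∧ ‖y - z‖ ≤ D.e := by
  have hσ := D.σ_pos
  have hM := D.one_le
  have hd : ∀ k, dist (A^[k] y) (A^[k + 1] y) ≤ 2 * (D.MA + 1) / D.σ * ‖c y‖ * (1 / 4) ^ k := by
    intro k
    obtain ⟨h1, h2⟩ := D.iterate_bounds S hx hy k
    rw [dist_comm, dist_eq_norm, Function.iterate_succ_apply']
    refine (D.norm_A_sub_le S hx h1).trans ?_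
    rw [mul_assoc _ ‖c y‖]
    gcongr
    linarith
  have hcau := cauchySeq_of_le_geometric (1 / 4 : ℝ) _ (by norm_num) hd
  obtain ⟨z, hz⟩ := cauchySeq_tendsto_of_complete hcau
  have hyz : ‖y - z‖ ≤ 8 / 3 * (D.MA + 1) / D.σ * ‖c y‖ := by
    have := dist_le_of_le_geometric_of_tendsto₀ (1 / 4 : ℝ) _ (by norm_num) hd hz
    simp only [Function.iterate_zero, id_eq, dist_eq_norm] at this
    refine this.trans (le_of_eq ?_)
    field_simp
    ring
  refine ⟨z, hz, ?_, hyz, hyz.trans ?_⟩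
  · have h1 : Tendsto (fun k => c (A^[k] y)) atTop (𝓝 (c z)) :=
      (S.c_diff.continuous.tendsto z).comp hz
    have h2 : Tendsto (fun k => c (A^[k] y)) atTop (𝓝 0) := by
      refine squeeze_zero_norm (fun k => (D.iterate_bounds S hx hy k).2) ?_
      have := (tendsto_pow_atTop_nhds_zero_of_lt_one (r := (1 / 4 : ℝ)) (by norm_num)
        (by norm_num)).mul_const ‖c y‖
      simpa using this
    exact tendsto_nhds_unique h1 h2
  · have h1 := D.norm_c_le S hx (D.norm_sub_le_e S hx hy)
    have h2 : 0 ≤ ‖y - x‖ * D.σ := by positivity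
    have h3 := mul_nonneg D.e_nonneg hσ.le
    rw [div_mul_eq_mul_div, div_le_iff₀ hσ]
    calc 8 / 3 * (D.MA + 1) * ‖c y‖ ≤ 8 / 3 * (D.MA + 1) * (D.Mc * ‖y - x‖) := by gcongr
      _ ≤ D.e * D.σ := by linarith

/-- Passing to the limit of the dissolving operator does not increase the penalty function. -/
theorem f_limit_le {y z : Eu n}
    (hy : ‖y - x‖ * (4 * D.Mc * (D.MA + 1) + D.σ) ≤ D.σ * D.e) (hβ : 0 ≤ β)
    (hz : Tendsto (fun k => A^[k] y) atTop (𝓝 z)) (hzM : z ∈ feasible c) :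
    f z ≤ hFun f c A β y := by
  -- Summing 9/32 · (1/16)^j gives 9/32 · 16/15 = 3/10, which is below the penalty coefficient 1/2.
  have key : ∀ k, gFun f A (A^[k] y)
      ≤ gFun f A y + 3 / 10 * β * ‖c y‖ ^ 2 * (1 - (1 / 16) ^ k) := by
    intro k
    induction k with
    | zero => simp
    | succ k ih =>
      obtain ⟨h1, h2⟩ := D.iterate_bounds S hx hy k
      have h3 := (D.iterate_bounds S hx hy (k + 1)).1
      rw [Function.iterate_succ_apply'] at h3 ⊢
      have h4 := D.g_step S hx h1 h3
      have h5 : ‖c (A^[k] y)‖ ^ 2 ≤ (1 / 16) ^ k * ‖c y‖ ^ 2 := by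
        calc ‖c (A^[k] y)‖ ^ 2 ≤ ((1 / 4) ^ k * ‖c y‖) ^ 2 := by gcongr
          _ = ((1 / 4) ^ 2) ^ k * ‖c y‖ ^ 2 := by rw [mul_pow, ← pow_mul, ← pow_mul, mul_comm k]
          _ = _ := by norm_num
      have h6 := mul_le_mul_of_nonneg_left h5 hβ
      rw [pow_succ (1 / 16 : ℝ) k]
      linarith
  have hcont : Continuous (gFun f A) := S.g_diff.continuous
  have hlim : Tendsto (fun k => gFun f A (A^[k] y)) atTop (𝓝 (gFun f A z)) :=
    (hcont.tendsto z).comp hz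
  have hgz : gFun f A z = f z := by rw [gFun, S.A_fix z hzM]
  rw [← hgz]
  have hb : 0 ≤ β * ‖c y‖ ^ 2 := by positivity
  refine le_of_tendsto hlim (Eventually.of_forall fun k => (key k).trans ?_)
  have hp : (0 : ℝ) < (1 / 16) ^ k := by positivity
  rw [hFun, show f (A y) = gFun f A y from rfl]
  nlinarith

end LocalBounds

end Local

/-! ### Derivatives of the penalty function and its gradient bound -/

theorem differentiableAt_of_inner {V : Type*} [NormedAddCommGroup V] [NormedSpace ℝ V]
    {F : V → Eu n} {x : V} (h : ∀ v, DifferentiableAt ℝ (fun y => inner ℝ (F y) v) x) :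
    DifferentiableAt ℝ F x := by
  rw [differentiableAt_euclidean]
  intro i
  refine (h (EuclideanSpace.single i 1)).congr_of_eventuallyEq (Eventually.of_forall fun y => ?_)
  simp [EuclideanSpace.inner_single_right]

theorem differentiable_gradient {φ : Eu n → ℝ} (h : Differentiable ℝ (fderiv ℝ φ)) :
    Differentiable ℝ (gradient φ) := fun x => by
  refine differentiableAt_of_inner fun v => ?_
  simp only [gradient_inner]
  exact (h x).clm_apply (differentiableAt_const v)

theorem hasFDerivAt_gradient {φ : Eu n → ℝ} (h : Differentiable ℝ (fderiv ℝ φ)) (x : Eu n) :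
    HasFDerivAt (gradient φ) (hessian φ x) x :=
  (differentiable_gradient h x).hasFDerivAt

section Penalty

variable {f : Eu n → ℝ} {c : Eu n → Eu p} {A : Eu n → Eu n}

namespace Admissible

variable (S : Admissible f c A) (β : ℝ)
include S

theorem hasFDerivAt_h (w : Eu n) : HasFDerivAt (hFun f c A β)
    (fderiv ℝ (gFun f A) w + β • (innerSL ℝ (c w)).comp (fderiv ℝ c w)) w := by
  have h1 := (S.g_diff w).hasFDerivAt
  have h2 := ((S.c_diff w).hasFDerivAt.norm_sq).const_mul (β / 2)
  refine (h1.add h2).congr_fderiv ?_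
  ext v
  simp
  ring

theorem h_diff : Differentiable ℝ (hFun f c A β) := fun w =>
  (S.hasFDerivAt_h β w).differentiableAt

theorem fderiv_h_apply (w v : Eu n) : fderiv ℝ (hFun f c A β) w v
    = fderiv ℝ (gFun f A) w v + β * inner ℝ (c w) (fderiv ℝ c w v) := by
  rw [(S.hasFDerivAt_h β w).fderiv]
  simp

theorem g_diff2 : Differentiable ℝ (fderiv ℝ (gFun f A)) := by
  have : fderiv ℝ (gFun f A) = fun w => (fderiv ℝ f (A w)).comp (fderiv ℝ A w) :=
    funext S.fderiv_g
  rw [this]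
  exact (S.f_diff2.comp S.A_diff).clm_comp S.A_diff2

theorem h_diff2 : Differentiable ℝ (fderiv ℝ (hFun f c A β)) := by
  have : fderiv ℝ (hFun f c A β) = fun w =>
      fderiv ℝ (gFun f A) w + β • (innerSL ℝ (c w)).comp (fderiv ℝ c w) :=
    funext fun w => (S.hasFDerivAt_h β w).fderiv
  rw [this]
  have h1 : Differentiable ℝ fun w => innerSL ℝ (c w) :=
    (innerSL ℝ (E := Eu p)).differentiable.comp S.c_diff
  exact S.g_diff2.add ((h1.clm_comp S.c_diff2).const_smul β)

theorem gradient_h_of_feasible {z : Eu n} (hz : z ∈ feasible c) :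
    gradient (hFun f c A β) z = gradient (gFun f A) z := by
  refine ext_inner_right ℝ fun v => ?_
  rw [gradient_inner, gradient_inner, S.fderiv_h_apply, show c z = 0 from hz]
  simp

theorem h_of_feasible {z : Eu n} (hz : z ∈ feasible c) : hFun f c A β z = f z := by
  rw [hFun, S.A_fix z hz, show c z = 0 from hz]
  simp

theorem g_of_feasible {z : Eu n} (hz : z ∈ feasible c) : gFun f A z = f z := by
  rw [gFun, S.A_fix z hz]

/-- A constrained minimizer of `f` is a critical point of `f ∘ A`. -/
theorem gradient_g_of_isLocalMinOn {z : Eu n} (hz : z ∈ feasible c)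
    (hmin : IsLocalMinOn f (feasible c) z) : gradient (gFun f A) z = 0 := by
  obtain ⟨u, hu⟩ := exists_multiplier S.c_contDiff hz (S.licq z hz)
    (S.f_contDiff.hasStrictFDerivAt one_ne_zero) hmin
  refine ext_inner_right ℝ fun v => ?_
  -- Here ∇f(z) = J_c(z)u is normal, and J_A(z) annihilates normal vectors.
  rw [gradient_inner, S.fderiv_g, ContinuousLinearMap.comp_apply, S.A_fix z hz, hu,
    transJac_inner, fderiv_comp_eq_zero (S.A_jac z hz) v]
  simp

end Admissible

variable {x : Eu n} {β : ℝ}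

/-- The constraint violation is controlled by the gradient of the penalty function. -/
theorem LocalBounds.norm_c_le_gradient (D : LocalBounds f c A x β) (S : Admissible f c A)
    (hx : x ∈ feasible c) (hβ : 0 < β) {y : Eu n}
    (hy : ‖y - x‖ * (4 * D.Mc * (D.MA + 1) + D.σ) ≤ D.σ * D.e) :
    ‖c y‖ ≤ 8 * (D.MA + 1) / (β * D.σ) * ‖gradient (hFun f c A β) y‖ := by
  have hσ := D.σ_pos
  have hM := D.one_le
  have hLc := D.Lc_nonneg
  have hσM := D.σ_le_Mc S
  have hn := norm_nonneg (y - x)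
  obtain ⟨hye, hAye⟩ : ‖y - x‖ ≤ D.e ∧ ‖A y - x‖ ≤ D.e :=
    ⟨(D.iterate_bounds S hx hy 0).1, (D.iterate_bounds S hx hy 1).1⟩
  obtain ⟨z, hz⟩ := exists_isNearest S.c_diff.continuous ⟨x, hx⟩ y
  obtain ⟨h1, -, -, -, h5⟩ := D.nearest S hx hye hz
  have hd := D.norm_A_sub_le_dist S hx hye hz
  have hT := norm_taylor_le S.c_diff (convex_closedBall x D.R) D.Lc_nonneg D.Lc_lip
    (D.mem_ball (w := y) (by linarith [D.e_nonneg]))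
    (D.mem_ball (w := A y) (by linarith [D.e_nonneg]))
  -- The test direction. The first-order change of c along it is close to -c(y), so the penalty
  -- decreases at rate about β‖c‖², while f ∘ A changes by at most β/4 · ‖c‖².
  set a := A y - y
  have h6 : 4 * (D.MA + 1) * ‖y - x‖ ≤ D.e := by
    have h7 : 4 * (D.MA + 1) * ‖y - x‖ * D.σ ≤ D.e * D.σ := by
      have h8 : 4 * (D.MA + 1) * ‖y - x‖ * D.σ ≤ 4 * (D.MA + 1) * ‖y - x‖ * D.Mc := by gcongr
      have h9 : 0 ≤ ‖y - x‖ * D.σ := by positivity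
      linarith
    exact le_of_mul_le_mul_right h7 hσ
  have h7 : D.Lc * ‖a‖ * ‖a‖ ≤ 1 / 64 * ‖c y‖ := by
    have h8 : ‖a‖ ≤ D.e / 4 := by
      have : (D.MA + 1) * ‖y - z‖ ≤ (D.MA + 1) * ‖y - x‖ := by gcongr
      linarith
    calc D.Lc * ‖a‖ * ‖a‖ ≤ D.Lc * (D.e / 4) * ((D.MA + 1) * ‖y - z‖) := by
          have := D.e_nonneg
          gcongr
      _ = (D.Lc * (D.MA + 1) * D.e) * ‖y - z‖ / 4 := by ring
      _ ≤ (D.σ / 32) * ‖y - z‖ / 4 := by gcongr; linarith [D.e_Lc]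
      _ ≤ _ := by linarith
  have h8 := D.norm_c_A_le S hx hye
  have h9 : inner ℝ (c y) (fderiv ℝ c y a) ≤ (-1 + 1 / 4 + 1 / 64) * ‖c y‖ ^ 2 := by
    -- The three terms are bounded by 1/4, -1 and 1/64 times ‖c y‖²: contraction by A, the exact
    -- term, and the Taylor remainder of c.
    have hdec : fderiv ℝ c y a = c (A y) - c y - (c (A y) - c y - fderiv ℝ c y a) := by abel
    rw [hdec, inner_sub_right, inner_sub_right, real_inner_self_eq_norm_sq]
    have i1 := real_inner_le_norm (c y) (c (A y))
    have i2 := (abs_le.1 (abs_real_inner_le_norm (c y) (c (A y) - c y - fderiv ℝ c y a))).1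
    have i3 := mul_le_mul_of_nonneg_left h8 (norm_nonneg (c y))
    have i4 := mul_le_mul_of_nonneg_left (hT.trans h7) (norm_nonneg (c y))
    linarith
  have h10 := (abs_le.1 (D.abs_fderiv_g_le S hx hye)).2
  have h11 : inner ℝ (gradient (hFun f c A β) y) a ≤ -(β / 4 * ‖c y‖ ^ 2) := by
    rw [gradient_inner, S.fderiv_h_apply]
    have := mul_le_mul_of_nonneg_left h9 hβ.le
    have h12 : 0 ≤ β * ‖c y‖ ^ 2 := by positivity
    linarith
  have h12 := (abs_le.1 (abs_real_inner_le_norm (gradient (hFun f c A β) y) a)).1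
  have h13 := D.norm_A_sub_le S hx hye
  refine norm_le_of_sq_le (by positivity) ?_
  have h14 : β / 4 * ‖c y‖ ^ 2
      ≤ ‖gradient (hFun f c A β) y‖ * (2 * (D.MA + 1) / D.σ * ‖c y‖) := by
    have := mul_le_mul_of_nonneg_left h13 (norm_nonneg (gradient (hFun f c A β) y))
    linarith
  calc ‖c y‖ ^ 2 = 4 / β * (β / 4 * ‖c y‖ ^ 2) := by field_simp
    _ ≤ 4 / β * (‖gradient (hFun f c A β) y‖ * (2 * (D.MA + 1) / D.σ * ‖c y‖)) := by gcongr
    _ = _ := by field_simp; ring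

end Penalty

/-! ### Taylor estimates along a segment and the cubic model -/

section Cubic

variable {h : Eu n → ℝ} {s : Set (Eu n)} {ν : ℝ}

theorem gradient_lipschitz (h2 : Differentiable ℝ (fderiv ℝ h)) (hs : Convex ℝ s) {M : ℝ}
    (hM : ∀ y ∈ s, ‖hessian h y‖ ≤ M) {x y : Eu n} (hx : x ∈ s) (hy : y ∈ s) :
    ‖gradient h y - gradient h x‖ ≤ M * ‖y - x‖ :=
  hs.norm_image_sub_le_of_norm_hasFDerivWithin_le (𝕜 := ℝ)
    (fun z _ => (hasFDerivAt_gradient h2 z).hasFDerivWithinAt) hM hx hy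

/-- Second-order Taylor estimate at a point with vanishing gradient. -/
theorem sub_le_of_gradient_eq_zero (h1 : Differentiable ℝ h) (h2 : Differentiable ℝ (fderiv ℝ h))
    (hs : Convex ℝ s) {M : ℝ} (hM : ∀ y ∈ s, ‖hessian h y‖ ≤ M) {x y : Eu n} (hx : x ∈ s)
    (hy : y ∈ s) (hgx : gradient h x = 0) : h y - h x ≤ M / 2 * ‖y - x‖ ^ 2 := by
  set d := y - x
  have hline : ∀ t : ℝ, HasDerivAt (fun t : ℝ => x + t • d) d t := fun t => by
    simpa using ((hasDerivAt_id t).smul_const d).const_add x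
  have hmem : ∀ t ∈ Icc (0 : ℝ) 1, x + t • d ∈ s := fun t ht =>
    hs.add_smul_sub_mem hx hy ht
  set φ : ℝ → ℝ := fun t => h (x + t • d) - M / 2 * ‖d‖ ^ 2 * t ^ 2
  have hφ : ∀ t, HasDerivAt φ (inner ℝ (gradient h (x + t • d)) d - M * ‖d‖ ^ 2 * t) t := by
    intro t
    rw [gradient_inner]
    have e1 := (h1 (x + t • d)).hasFDerivAt.comp_hasDerivAt t (hline t)
    have e2 := ((hasDerivAt_pow 2 t).const_mul (M / 2 * ‖d‖ ^ 2))
    exact (e1.sub e2).congr_deriv (by norm_num; ring)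
  have hanti : AntitoneOn φ (Icc 0 1) := by
    refine antitoneOn_of_deriv_nonpos (convex_Icc 0 1)
      (fun t _ => (hφ t).continuousAt.continuousWithinAt)
      (fun t _ => (hφ t).differentiableAt.differentiableWithinAt) fun t ht => ?_
    rw [interior_Icc] at ht
    rw [(hφ t).deriv]
    have e1 := gradient_lipschitz h2 hs hM hx (hmem t ⟨ht.1.le, ht.2.le⟩)
    rw [hgx, sub_zero, add_sub_cancel_left, norm_smul, Real.norm_of_nonneg ht.1.le] at e1
    have e2 := real_inner_le_norm (gradient h (x + t • d)) d
    have e3 := mul_le_mul_of_nonneg_right e1 (norm_nonneg d)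
    linarith
  have := hanti (left_mem_Icc.2 zero_le_one) (right_mem_Icc.2 zero_le_one) zero_le_one
  simp only [φ, d, one_smul, zero_smul, add_zero, add_sub_cancel] at this
  linarith

/-- The cubic model majorizes `h` along a segment on which the Hessian is `ν`-Lipschitz. -/
theorem le_add_cubicModel (h1 : Differentiable ℝ h) (h2 : Differentiable ℝ (fderiv ℝ h))
    {x d : Eu n}
    (hLip : ∀ t ∈ Icc (0 : ℝ) 1, ‖hessian h (x + t • d) - hessian h x‖ ≤ ν * (t * ‖d‖)) :
    h (x + d) ≤ h x + cubicModel h ν x d ∧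
      ‖gradient h (x + d) - gradient h x - hessian h x d‖ ≤ ν / 2 * ‖d‖ ^ 2 := by
  have hline : ∀ t : ℝ, HasDerivAt (fun t : ℝ => x + t • d) d t := fun t => by
    simpa using ((hasDerivAt_id t).smul_const d).const_add x
  set G : ℝ → Eu n := fun t => gradient h (x + t • d) - gradient h x - t • hessian h x d
  have hG : ∀ t, HasDerivAt G (hessian h (x + t • d) d - hessian h x d) t := by
    intro t
    have e1 := (hasFDerivAt_gradient h2 (x + t • d)).comp_hasDerivAt t (hline t)
    have e2 := (hasDerivAt_id t).smul_const (hessian h x d)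
    have e3 := (e1.sub_const (gradient h x)).sub e2
    rw [one_smul] at e3
    exact e3
  have hGb : ∀ t ∈ Icc (0 : ℝ) 1, ‖G t‖ ≤ ν / 2 * ‖d‖ ^ 2 * t ^ 2 := by
    refine image_norm_le_of_norm_deriv_right_le_deriv_boundary
      (f' := fun t => hessian h (x + t • d) d - hessian h x d)
      (B' := fun t => ν / 2 * ‖d‖ ^ 2 * (2 * t))
      (fun t _ => (hG t).continuousAt.continuousWithinAt)
      (fun t _ => (hG t).hasDerivWithinAt) (by simp [G])
      (fun t => ?_) fun t ht => ?_
    · simpa using (hasDerivAt_pow 2 t).const_mul (ν / 2 * ‖d‖ ^ 2)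
    · have e1 := hLip t ⟨ht.1, ht.2.le⟩
      have e2 := (hessian h (x + t • d) - hessian h x).le_opNorm d
      rw [sub_apply] at e2
      have e3 := mul_le_mul_of_nonneg_right e1 (norm_nonneg d)
      linarith
  refine ⟨?_, by simpa [G] using hGb 1 (right_mem_Icc.2 zero_le_one)⟩
  -- The derivative of this gap is ⟨G t, d⟩ minus the bound just proved for it, so the gap is
  -- antitone; comparing t = 1 with t = 0 gives the claim.
  set φ : ℝ → ℝ := fun t => h (x + t • d) - t * inner ℝ d (gradient h x)
    - t ^ 2 / 2 * inner ℝ d (hessian h x d) - ν / 6 * ‖d‖ ^ 3 * t ^ 3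
  have hφ : ∀ t, HasDerivAt φ (inner ℝ (G t) d - ν / 2 * ‖d‖ ^ 3 * t ^ 2) t := by
    intro t
    have e1 := (h1 (x + t • d)).hasFDerivAt.comp_hasDerivAt t (hline t)
    have e2 := (hasDerivAt_id t).mul_const (inner ℝ d (gradient h x))
    have e3 := ((hasDerivAt_pow 2 t).div_const 2).mul_const (inner ℝ d (hessian h x d))
    have e4 := (hasDerivAt_pow 3 t).const_mul (ν / 6 * ‖d‖ ^ 3)
    refine (((e1.sub e2).sub e3).sub e4).congr_deriv ?_
    simp only [G, inner_sub_left, real_inner_smul_left, gradient_inner]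
    rw [real_inner_comm (gradient h x) d, gradient_inner, real_inner_comm (hessian h x d) d]
    push_cast
    ring
  have hanti : AntitoneOn φ (Icc 0 1) := by
    refine antitoneOn_of_deriv_nonpos (convex_Icc 0 1)
      (fun t _ => (hφ t).continuousAt.continuousWithinAt)
      (fun t _ => (hφ t).differentiableAt.differentiableWithinAt) fun t ht => ?_
    rw [interior_Icc] at ht
    rw [(hφ t).deriv]
    have e1 := hGb t ⟨ht.1.le, ht.2.le⟩
    have e2 := real_inner_le_norm (G t) d
    have e3 := mul_le_mul_of_nonneg_right e1 (norm_nonneg d)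
    nlinarith
  have := hanti (left_mem_Icc.2 zero_le_one) (right_mem_Icc.2 zero_le_one) zero_le_one
  simp only [φ, one_smul, zero_smul, add_zero] at this
  rw [cubicModel]
  norm_num at this ⊢
  linarith

variable {x d : Eu n}

theorem cubicModel_smul {t : ℝ} (ht : 0 ≤ t) :
    cubicModel h ν x (t • d) = t * inner ℝ d (gradient h x)
      + t ^ 2 / 2 * inner ℝ d (hessian h x d) + t ^ 3 * (ν / 6 * ‖d‖ ^ 3) := by
  rw [cubicModel, norm_smul, Real.norm_of_nonneg ht, map_smul, real_inner_smul_left,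
    real_inner_smul_left, real_inner_smul_right]
  ring

/-- Compare d with -d: only the linear term of the model is odd. -/
theorem inner_gradient_nonpos_of_isMinOn (hd : IsMinOn (cubicModel h ν x) univ d) :
    inner ℝ d (gradient h x) ≤ 0 := by
  have := hd (mem_univ (-d))
  simp only [mem_ofPred_eq, cubicModel, norm_neg, map_neg, inner_neg_left, inner_neg_right] at this
  linarith

/-- The derivative of the model along the ray t • d vanishes at t = 1. -/
theorem radial_stationary_of_isMinOn (hd : IsMinOn (cubicModel h ν x) univ d) :
    inner ℝ d (gradient h x) + inner ℝ d (hessian h x d) + ν / 2 * ‖d‖ ^ 3 = 0 := by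
  set φ : ℝ → ℝ := fun t => t * inner ℝ d (gradient h x)
      + t ^ 2 / 2 * inner ℝ d (hessian h x d) + t ^ 3 * (ν / 6 * ‖d‖ ^ 3)
  have hmin : IsLocalMin φ 1 := by
    filter_upwards [lt_mem_nhds (zero_lt_one' ℝ)] with t ht
    have := hd (mem_univ (t • d))
    have e1 := cubicModel_smul (h := h) (ν := ν) (x := x) (d := d) (zero_le_one' ℝ)
    rw [one_smul] at e1
    simp only [mem_ofPred_eq] at this
    rw [e1, cubicModel_smul ht.le] at this
    exact this
  have e2 := (hasDerivAt_id (1 : ℝ)).mul_const (inner ℝ d (gradient h x))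
  have e3 := ((hasDerivAt_pow 2 (1 : ℝ)).div_const 2).mul_const (inner ℝ d (hessian h x d))
  have e4 := (hasDerivAt_pow 3 (1 : ℝ)).mul_const (ν / 6 * ‖d‖ ^ 3)
  have := hmin.hasDerivAt_eq_zero ((e2.add e3).add e4)
  push_cast at this
  linarith

/-- The model is nonpositive along the step. -/
theorem cubicModel_smul_nonpos_of_isMinOn (hν : 0 ≤ ν) (hd : IsMinOn (cubicModel h ν x) univ d)
    {t : ℝ} (ht : t ∈ Icc (0 : ℝ) 1) : cubicModel h ν x (t • d) ≤ 0 := by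
  have e1 := inner_gradient_nonpos_of_isMinOn hd
  have e2 := radial_stationary_of_isMinOn hd
  rw [cubicModel_smul ht.1]
  have h3 : 0 ≤ ν * ‖d‖ ^ 3 := by positivity
  have e3 : inner ℝ d (hessian h x d)
      = -inner ℝ d (gradient h x) - ν / 2 * ‖d‖ ^ 3 := by linarith
  rw [e3]
  have hid : t * inner ℝ d (gradient h x)
      + t ^ 2 / 2 * (-inner ℝ d (gradient h x) - ν / 2 * ‖d‖ ^ 3) + t ^ 3 * (ν / 6 * ‖d‖ ^ 3)
      -- Once radial stationarity has eliminated the Hessian term, both coefficients are nonnegative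
      -- on [0, 1].
      = (t - t ^ 2 / 2) * inner ℝ d (gradient h x) - t ^ 2 * (1 / 4 - t / 6) * (ν * ‖d‖ ^ 3) := by
    ring
  rw [hid]
  have h4 : 0 ≤ t - t ^ 2 / 2 := by nlinarith [ht.1, ht.2]
  have h5 : 0 ≤ t ^ 2 * (1 / 4 - t / 6) := mul_nonneg (sq_nonneg _) (by linarith [ht.2])
  have h6 := mul_nonneg h5 h3
  have h7 := mul_nonpos_of_nonneg_of_nonpos h4 e1
  linarith

/-- Eliminating the Hessian term leaves half of the nonpositive linear term minus ν/12 · ‖d‖³. -/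
theorem cubicModel_le_of_isMinOn (hd : IsMinOn (cubicModel h ν x) univ d) :
    cubicModel h ν x d ≤ -(ν / 12 * ‖d‖ ^ 3) := by
  have e1 := inner_gradient_nonpos_of_isMinOn hd
  have e2 := radial_stationary_of_isMinOn hd
  rw [cubicModel]
  linarith

theorem le_of_forall_pos_add_mul {a b K : ℝ} (h : ∀ t > 0, t ≤ 1 → a ≤ b + K * t) : a ≤ b := by
  have hc : Tendsto (fun t : ℝ => b + K * t) (𝓝[>] 0) (𝓝 b) := by
    have : Continuous fun t : ℝ => b + K * t := by fun_prop
    exact (by simpa using this.tendsto 0 : Tendsto _ _ _).mono_left nhdsWithin_le_nhds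
  refine ge_of_tendsto hc ?_
  filter_upwards [Ioc_mem_nhdsGT (zero_lt_one' ℝ)] with t ht
  exact h t ht.1 ht.2

theorem cubicModel_add_smul (hsym : ∀ u v, inner ℝ u (hessian h x v) = inner ℝ (hessian h x u) v)
    (u : Eu n) (t : ℝ) : cubicModel h ν x (d + t • u) = cubicModel h ν x d
      + t * inner ℝ (gradient h x + hessian h x d) u + t ^ 2 / 2 * inner ℝ u (hessian h x u)
      + ν / 6 * (‖d + t • u‖ ^ 3 - ‖d‖ ^ 3) := by
  simp only [cubicModel, map_add, map_smul, inner_add_left, inner_add_right, real_inner_smul_left,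
    real_inner_smul_right]
  rw [hsym d u, real_inner_comm (gradient h x) u, real_inner_comm (hessian h x d) u]
  ring

theorem hessian_symmetric (h1 : Differentiable ℝ h) (h2 : Differentiable ℝ (fderiv ℝ h))
    (x u v : Eu n) : inner ℝ u (hessian h x v) = inner ℝ (hessian h x u) v := by
  have key : ∀ u v, inner ℝ (hessian h x u) v = fderiv ℝ (fderiv ℝ h) x u v := fun u v => by
    have e1 := ((hasFDerivAt_gradient h2 x).inner ℝ (hasFDerivAt_const v x)).fderiv
    have e2 : (fun y => inner ℝ (gradient h y) v) = fun y => fderiv ℝ h y v :=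
      funext fun y => gradient_inner y v
    have e3 := ((h2 x).hasFDerivAt.clm_apply (hasFDerivAt_const v x)).fderiv
    rw [e2, e3] at e1
    have := DFunLike.congr_fun e1 u
    simpa using this.symm
  rw [real_inner_comm, key, key]
  exact second_derivative_symmetric (fun y => (h1 y).hasFDerivAt) (h2 x).hasFDerivAt v u

theorem norm_add_smul_pow_three_le (d : Eu n) {u : Eu n} (hu : ‖u‖ = 1) {t : ℝ} (ht : 0 ≤ t) :
    ‖d + t • u‖ ^ 3 ≤ (‖d‖ + t) ^ 3 := by
  gcongr
  refine (norm_add_le _ _).trans ?_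
  rw [norm_smul, hu, Real.norm_of_nonneg ht, mul_one]

/-- First-order condition for the cubic subproblem. -/
theorem norm_gradient_add_hessian_le_of_isMinOn (h1 : Differentiable ℝ h)
    (h2 : Differentiable ℝ (fderiv ℝ h)) (hν : 0 ≤ ν)
    (hd : IsMinOn (cubicModel h ν x) univ d) :
    ‖gradient h x + hessian h x d‖ ≤ ν / 2 * ‖d‖ ^ 2 := by
  set r := gradient h x + hessian h x d
  -- Compare d with d + t • u, divide by t and let t tend to 0; this needs no derivative of the
  -- cubed norm.
  have key : ∀ u : Eu n, ‖u‖ = 1 → -inner ℝ r u ≤ ν / 2 * ‖d‖ ^ 2 := fun u hu => by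
    refine le_of_forall_pos_add_mul
      (K := inner ℝ u (hessian h x u) / 2 + ν / 6 * (3 * ‖d‖ + 1)) fun t ht ht1 => ?_
    have e1 := hd (mem_univ (d + t • u))
    simp only [mem_ofPred_eq] at e1
    rw [cubicModel_add_smul (hessian_symmetric h1 h2 x)] at e1
    have e2 : ν / 6 * (‖d + t • u‖ ^ 3 - ‖d‖ ^ 3) ≤ ν / 6 * ((‖d‖ + t) ^ 3 - ‖d‖ ^ 3) := by
      gcongr
      exact (norm_add_le _ _).trans_eq (by rw [norm_smul, hu, Real.norm_of_nonneg ht.le, mul_one])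
    have e3 : ν / 6 * t ^ 3 ≤ ν / 6 * t ^ 2 := by gcongr ?_ * ?_; nlinarith
    have e4 : t * (-inner ℝ r u) ≤ t * (ν / 2 * ‖d‖ ^ 2
        + (inner ℝ u (hessian h x u) / 2 + ν / 6 * (3 * ‖d‖ + 1)) * t) := by nlinarith
    exact le_of_mul_le_mul_left e4 ht
  rcases eq_or_ne r 0 with h0 | h0
  · rw [h0, norm_zero]; positivity
  · have e1 := key (-(‖r‖⁻¹ • r)) (by rw [norm_neg, norm_smul, norm_inv, norm_norm,
      inv_mul_cancel₀ (norm_ne_zero_iff.2 h0)])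
    rw [inner_neg_right, neg_neg, real_inner_smul_right, real_inner_self_eq_norm_sq, sq,
      inv_mul_cancel_left₀ (norm_ne_zero_iff.2 h0)] at e1
    exact e1

/-- Second-order condition for the cubic subproblem. -/
theorem hessian_ge_of_isMinOn (h1 : Differentiable ℝ h)
    (h2 : Differentiable ℝ (fderiv ℝ h)) (hν : 0 ≤ ν)
    (hd : IsMinOn (cubicModel h ν x) univ d) {u : Eu n} (hu : ‖u‖ = 1) :
    -(8 / 3 * ν * ‖d‖) ≤ inner ℝ u (hessian h x u) := by
  refine le_of_forall_pos_add_mul (K := 8 / 3 * ν) fun t ht _ => ?_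
  -- Adding the comparisons with d + r • u and d - r • u cancels the linear term. Both norms are at
  -- most 2r, so the cubic terms contribute 2 · ν/6 · 8r³, whence 8/3. The shift t keeps r positive
  -- when d = 0.
  set r := ‖d‖ + t
  have hr : 0 < r := by positivity
  have e1 := hd (mem_univ (d + r • u))
  have e2 := hd (mem_univ (d + r • -u))
  simp only [mem_ofPred_eq] at e1 e2
  rw [cubicModel_add_smul (hessian_symmetric h1 h2 x)] at e1 e2
  rw [inner_neg_right, map_neg, inner_neg_left, inner_neg_right] at e2
  have e3 := norm_add_smul_pow_three_le d hu hr.le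
  have e4 := norm_add_smul_pow_three_le d (u := -u) (by rw [norm_neg, hu]) hr.le
  have e5 : (‖d‖ + r) ^ 3 ≤ (2 * r) ^ 3 := by gcongr; linarith
  have e6 : 0 ≤ ‖d‖ ^ 3 := by positivity
  have e7 : ν / 6 * (‖d + r • u‖ ^ 3 - ‖d‖ ^ 3) ≤ ν / 6 * (2 * r) ^ 3 := by gcongr; linarith
  have e8 : ν / 6 * (‖d + r • -u‖ ^ 3 - ‖d‖ ^ 3) ≤ ν / 6 * (2 * r) ^ 3 := by gcongr; linarith
  have e9 : r ^ 2 * (-(8 / 3 * ν * ‖d‖)) ≤ r ^ 2 * (inner ℝ u (hessian h x u)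
      + 8 / 3 * ν * t) := by
    have : r ^ 2 * (8 / 3 * ν * r) = 2 * (ν / 6 * (2 * r) ^ 3) := by ring
    have h3 : 8 / 3 * ν * r = 8 / 3 * ν * ‖d‖ + 8 / 3 * ν * t := by ring
    rw [h3] at this
    linarith
  exact le_of_mul_le_mul_left e9 (by positivity)

end Cubic

/-! ### Riemannian gradient and Hessian in terms of f ∘ A -/

section Riemannian

variable {f : Eu n → ℝ} {c : Eu n → Eu p} {A : Eu n → Eu n}

theorem mem_tangent {w d : Eu n} : d ∈ tangent c w ↔ fderiv ℝ c w d = 0 := Iff.rfl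

theorem _root_.HasFDerivAt.comp_curve {V W : Type*} [NormedAddCommGroup V] [NormedSpace ℝ V]
    [NormedAddCommGroup W] [NormedSpace ℝ W] {F : V → W} {F' : V →L[ℝ] W} {z d : V} {w : ℝ → V}
    (hF : HasFDerivAt F F' z) (hw0 : w 0 = z) (hw : HasDerivAt w d 0) :
    HasDerivAt (fun t => F (w t)) (F' d) 0 := by
  subst hw0
  exact hF.comp_hasDerivAt (0 : ℝ) hw

/-- The Gram operator `J_c(w)ᵀ J_c(w)`. -/
noncomputable def gram (c : Eu n → Eu p) (w : Eu n) : Eu p →L[ℝ] Eu p :=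
  (fderiv ℝ c w).comp (transJac c w)

theorem isUnit_gram {w : Eu n} (h : Function.Injective (transJac c w)) : IsUnit (gram c w) := by
  have hinj : Function.Injective (gram c w) := by
    rw [injective_iff_map_eq_zero]
    intro u hu
    refine h ?_
    rw [map_zero, ← inner_self_eq_zero (𝕜 := ℝ), transJac_inner,
      show fderiv ℝ c w (transJac c w u) = 0 from hu, inner_zero_right]
  rw [ContinuousLinearMap.isUnit_iff_bijective]
  exact ⟨hinj, (LinearMap.injective_iff_surjective (f := (gram c w : Eu p →ₗ[ℝ] Eu p))).1 hinj⟩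

/-- The orthogonal projection onto the tangent space in terms of the Jacobian. -/
theorem starProjection_tangent {w : Eu n} (h : IsUnit (gram c w)) (v : Eu n) :
    (tangent c w).starProjection v
      = v - transJac c w (Ring.inverse (gram c w) (fderiv ℝ c w v)) := by
  refine Submodule.eq_starProjection_of_mem_of_inner_eq_zero ?_ fun d hd => ?_
  · rw [mem_tangent, map_sub]
    have := DFunLike.congr_fun (Ring.mul_inverse_cancel (gram c w) h) (fderiv ℝ c w v)
    exact sub_eq_zero.2 this.symm
  · rw [sub_sub_cancel, transJac_inner, mem_tangent.1 hd, inner_zero_right]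

theorem differentiable_transJac (h : Differentiable ℝ (fderiv ℝ c)) :
    Differentiable ℝ (transJac c) := by
  have hl : IsBoundedLinearMap ℝ
      (fun T : Eu n →L[ℝ] Eu p => ContinuousLinearMap.adjoint T) :=
    IsLinearMap.with_bound ⟨fun S T => map_add _ S T, fun a T => by simp⟩ 1 fun T => by
      rw [LinearIsometryEquiv.norm_map, one_mul]
  exact hl.differentiable.comp h

/-- The extended Riemannian gradient is differentiable where the Jacobian has full rank. -/
theorem differentiableAt_riemGrad (S : Admissible f c A) {z : Eu n}
    (hinj : Function.Injective (transJac c z)) : DifferentiableAt ℝ (riemGrad f c) z := by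
  have hJ := differentiable_transJac S.c_diff2
  have hG : Differentiable ℝ (gram c) := S.c_diff2.clm_comp hJ
  have hu := isUnit_gram hinj
  have hf := differentiable_gradient S.f_diff2
  have hev : ∀ᶠ w in 𝓝 z, IsUnit (gram c w) :=
    hG.continuous.continuousAt.eventually (Units.isOpen.mem_nhds hu)
  have hinv : DifferentiableAt ℝ (fun w => Ring.inverse (gram c w)) z :=
    (differentiableAt_inverse (𝕜 := ℝ) hu).comp z (hG z)
  have hform : DifferentiableAt ℝ (fun w => gradient f w
      - transJac c w (Ring.inverse (gram c w) (fderiv ℝ c w (gradient f w)))) z :=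
    (hf z).sub ((hJ z).clm_apply (hinv.clm_apply ((S.c_diff2 z).clm_apply (hf z))))
  refine hform.congr_of_eventuallyEq (hev.mono fun w hw => ?_)
  rw [riemGrad, starProjection_tangent hw]

/-- On the feasible set, `grad f` is also the projection of `∇(f ∘ A)`. -/
theorem inner_riemGrad (S : Admissible f c A) {w : Eu n} (hw : w ∈ feasible c) (d : Eu n) :
    inner ℝ d (riemGrad f c w)
      = inner ℝ ((tangent c w).starProjection d) (gradient (gFun f A) w) := by
  rw [riemGrad, ← Submodule.inner_starProjection_left_eq_right]
  set e := (tangent c w).starProjection d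
  have he : e ∈ tangent c w := Submodule.starProjection_apply_mem _ _
  rw [real_inner_comm, gradient_inner, real_inner_comm, gradient_inner, S.fderiv_g,
    ContinuousLinearMap.comp_apply, S.A_fix w hw,
    fderiv_apply_tangent S.c_contDiff S.c_lip S.A_diff S.A_fix hw (S.licq w hw)
      (mem_tangent.1 he)]

theorem norm_riemGrad_le (S : Admissible f c A) {z : Eu n} (hz : z ∈ feasible c) :
    ‖riemGrad f c z‖ ≤ ‖gradient (gFun f A) z‖ := by
  refine norm_le_of_sq_le (norm_nonneg _) ?_
  rw [← real_inner_self_eq_norm_sq, inner_riemGrad S hz]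
  refine (real_inner_le_norm _ _).trans ?_
  rw [mul_comm]
  gcongr
  exact Submodule.norm_starProjection_apply_le _ _

/-- The normal component of a vector is controlled by its image under the Jacobian. -/
theorem norm_sub_starProjection_le {w : Eu n} {σ : ℝ} (hσ0 : 0 < σ)
    (hσ : ∀ u, σ * ‖u‖ ≤ ‖transJac c w u‖) (d : Eu n) :
    ‖d - (tangent c w).starProjection d‖ ≤ ‖fderiv ℝ c w d‖ / σ := by
  have hinj : Function.Injective (transJac c w) := by
    rw [injective_iff_map_eq_zero]
    intro u hu
    have := hσ u
    rw [hu, norm_zero] at this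
    exact norm_le_zero_iff.1 (nonpos_of_mul_nonpos_right this hσ0)
  have hu := isUnit_gram hinj
  rw [starProjection_tangent hu, sub_sub_cancel]
  set u := Ring.inverse (gram c w) (fderiv ℝ c w d)
  have h1 : fderiv ℝ c w (transJac c w u) = fderiv ℝ c w d :=
    DFunLike.congr_fun (Ring.mul_inverse_cancel (gram c w) hu) (fderiv ℝ c w d)
  refine norm_le_of_sq_le (by positivity) ?_
  rw [← real_inner_self_eq_norm_sq, transJac_inner, h1]
  refine (real_inner_le_norm _ _).trans ?_
  have h2 := mul_le_mul_of_nonneg_right (hσ u) (norm_nonneg (fderiv ℝ c w d))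
  rw [div_mul_eq_mul_div, le_div_iff₀ hσ0]
  linarith

/-- Comparison of the Riemannian Hessian of `f` with the Euclidean Hessian of `f ∘ A`. -/
theorem inner_riemHess_ge (S : Admissible f c A) {z : Eu n} (hz : z ∈ feasible c) {σ L : ℝ}
    (hσ0 : 0 < σ) (hσ : ∀ u, σ * ‖u‖ ≤ ‖transJac c z u‖)
    (hLip : ∀ᶠ w in 𝓝 z, ‖fderiv ℝ c w - fderiv ℝ c z‖ ≤ L * ‖w - z‖) {d : Eu n}
    (hd : d ∈ tangent c z) (hd1 : ‖d‖ = 1) :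
    inner ℝ d (hessian (gFun f A) z d) - 2 * L / σ * ‖gradient (gFun f A) z‖
      ≤ inner ℝ d (riemHess f c z d) := by
  obtain ⟨w, hw, hw0, hwd⟩ := exists_feasible_curve S.c_contDiff S.c_lip hz (S.licq z hz)
    (mem_tangent.1 hd)
  set g := gFun f A
  have hPd : (tangent c z).starProjection d = d := Submodule.starProjection_eq_self_iff.2 hd
  have hR : inner ℝ d (riemHess f c z d) = inner ℝ d (fderiv ℝ (riemGrad f c) z d) := by
    rw [riemHess, ← Submodule.inner_starProjection_left_eq_right, hPd]
  rw [hR]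
  have e1 : HasDerivAt (fun t => gradient g (w t)) (hessian g z d) 0 :=
    (hasFDerivAt_gradient S.g_diff2 z).comp_curve hw0 hwd
  have e2 : HasDerivAt (fun t => riemGrad f c (w t)) (fderiv ℝ (riemGrad f c) z d) 0 :=
    (differentiableAt_riemGrad S (S.licq z hz)).hasFDerivAt.comp_curve hw0 hwd
  -- The normal part of d paired with ∇g, followed along a feasible curve. It vanishes at t = 0 and
  -- is bounded by a multiple of ‖w t - z‖, which bounds its derivative at 0 without differentiating
  -- the projection.
  set ω : ℝ → ℝ := fun t => inner ℝ d (gradient g (w t)) - inner ℝ d (riemGrad f c (w t))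
  have eω : HasDerivAt ω (inner ℝ d (hessian g z d)
      - inner ℝ d (fderiv ℝ (riemGrad f c) z d)) 0 := by
    have i1 := (hasDerivAt_const (0 : ℝ) d).inner ℝ e1
    have i2 := (hasDerivAt_const (0 : ℝ) d).inner ℝ e2
    refine (i1.sub i2).congr_deriv ?_
    simp
  have hω0 : ω 0 = 0 := by
    simp only [ω]
    rw [inner_riemGrad S (hw 0), hw0, hPd, sub_self]
  have hwt : Tendsto w (𝓝 0) (𝓝 z) := by simpa [hw0] using hwd.continuousAt.tendsto
  have hsmall : ∀ᶠ v in 𝓝 z, L * ‖v - z‖ ≤ σ / 2 := by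
    have : Tendsto (fun v => L * ‖v - z‖) (𝓝 z) (𝓝 0) := by
      have h2 : Continuous fun v => L * ‖v - z‖ := by fun_prop
      simpa using h2.tendsto z
    exact (this.eventually (gt_mem_nhds (half_pos hσ0))).mono fun _ h => h.le
  have hbound : ∀ᶠ t in 𝓝 (0 : ℝ),
      |ω t| ≤ 2 * L / σ * ‖w t - z‖ * ‖gradient g (w t)‖ := by
    filter_upwards [hwt.eventually hLip, hwt.eventually hsmall] with t h1 h2
    have h3 : ω t = inner ℝ (d - (tangent c (w t)).starProjection d) (gradient g (w t)) := by
      simp only [ω]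
      rw [inner_riemGrad S (hw t), ← inner_sub_left]
    have h4 : ∀ u, σ / 2 * ‖u‖ ≤ ‖transJac c (w t) u‖ := fun u => by
      have i1 := (transJac c (w t) - transJac c z).le_opNorm u
      rw [norm_transJac_sub, sub_apply] at i1
      have i2 := mul_le_mul_of_nonneg_right (h1.trans h2) (norm_nonneg u)
      have i3 := norm_sub_norm_le (transJac c z u) (transJac c (w t) u)
      rw [norm_sub_rev] at i3
      linarith [hσ u]
    have h5 := norm_sub_starProjection_le (half_pos hσ0) h4 d
    have h6 : ‖fderiv ℝ c (w t) d‖ ≤ L * ‖w t - z‖ := by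
      have i1 := (fderiv ℝ c (w t) - fderiv ℝ c z).le_opNorm d
      rw [sub_apply, mem_tangent.1 hd, sub_zero, hd1, mul_one] at i1
      exact i1.trans h1
    rw [h3]
    refine (abs_real_inner_le_norm _ _).trans ?_
    gcongr
    refine h5.trans ?_
    rw [div_le_iff₀ (half_pos hσ0)]
    refine h6.trans (le_of_eq ?_)
    field_simp
  have l1 : Tendsto (fun t : ℝ => |slope ω 0 t|) (𝓝[≠] 0) (𝓝 |inner ℝ d (hessian g z d)
      - inner ℝ d (fderiv ℝ (riemGrad f c) z d)|) := eω.tendsto_slope.abs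
  have l2 : Tendsto (fun t : ℝ => 2 * L / σ * ‖slope w 0 t‖ * ‖gradient g (w t)‖) (𝓝[≠] 0)
      (𝓝 (2 * L / σ * ‖d‖ * ‖gradient g z‖)) := by
    have h1 : Tendsto (fun t => gradient g (w t)) (𝓝[≠] 0) (𝓝 (gradient g z)) := by
      have := e1.continuousAt.tendsto
      rw [hw0] at this
      exact this.mono_left nhdsWithin_le_nhds
    exact ((hwd.tendsto_slope.norm).const_mul _).mul h1.norm
  have l3 : |inner ℝ d (hessian g z d) - inner ℝ d (fderiv ℝ (riemGrad f c) z d)|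
      ≤ 2 * L / σ * ‖d‖ * ‖gradient g z‖ := by
    refine le_of_tendsto_of_tendsto l1 l2 ?_
    filter_upwards [nhdsWithin_le_nhds hbound, self_mem_nhdsWithin] with t ht hne
    rw [slope_def_module, slope_def_module, hω0, hw0, sub_zero, sub_zero, norm_smul, smul_eq_mul,
      abs_mul, Real.norm_eq_abs]
    have : 0 ≤ |t⁻¹| := abs_nonneg _
    have := mul_le_mul_of_nonneg_left ht this
    linarith
  rw [hd1, mul_one] at l3
  linarith [(abs_le.1 l3).2]

/-- On tangent directions the penalty term does not contribute to the Hessian. -/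
theorem hessian_h_tangent (S : Admissible f c A) (β : ℝ) {z d : Eu n} (hz : z ∈ feasible c)
    (hd : d ∈ tangent c z) : hessian (hFun f c A β) z d = hessian (gFun f A) z d := by
  obtain ⟨w, hw, hw0, hwd⟩ := exists_feasible_curve S.c_contDiff S.c_lip hz (S.licq z hz)
    (mem_tangent.1 hd)
  -- The gradients of g and h coincide on M, so their derivatives along a feasible curve do too.
  have e1 : HasDerivAt (fun t => gradient (gFun f A) (w t)) (hessian (gFun f A) z d) 0 :=
    (hasFDerivAt_gradient S.g_diff2 z).comp_curve hw0 hwd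
  have e2 : HasDerivAt (fun t => gradient (hFun f c A β) (w t)) (hessian (hFun f c A β) z d) 0 :=
    (hasFDerivAt_gradient (S.h_diff2 β) z).comp_curve hw0 hwd
  simp only [S.gradient_h_of_feasible β (hw _)] at e2
  exact e2.unique e1

end Riemannian

/-! ### From extended-valued constants to real ones -/

section Extended

variable {V : Type*} [NormedAddCommGroup V] {F : Eu n → V} {s : Set (Eu n)}

theorem norm_le_of_supNormOn_le {K : ℝ≥0∞} (hK : K ≠ ∞) (h : supNormOn F s ≤ K) {y : Eu n}
    (hy : y ∈ s) : ‖F y‖ ≤ K.toReal := by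
  rw [← toReal_enorm]
  exact ENNReal.toReal_mono hK ((le_iSup₂ (f := fun y (_ : y ∈ s) => ‖F y‖ₑ) y hy).trans h)

theorem supNormOn_le_ofReal {K : ℝ} (h : ∀ y ∈ s, ‖F y‖ ≤ K) :
    supNormOn F s ≤ ENNReal.ofReal K :=
  iSup₂_le fun y hy => by
    rw [← ofReal_norm]
    exact ENNReal.ofReal_le_ofReal (h y hy)

theorem supNormOn_ne_top (hF : Continuous F) (hs : IsCompact s) : supNormOn F s ≠ ∞ := by
  obtain ⟨C, hC⟩ := hs.exists_bound_of_continuousOn hF.continuousOn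
  exact ne_top_of_le_ne_top ENNReal.ofReal_ne_top (supNormOn_le_ofReal hC)

theorem norm_sub_le_of_lipOn_le {K : ℝ≥0∞} (hK : K ≠ ∞) (h : lipOn F s ≤ K) {y z : Eu n}
    (hy : y ∈ s) (hz : z ∈ s) : ‖F y - F z‖ ≤ K.toReal * ‖y - z‖ := by
  rcases eq_or_ne y z with rfl | hne
  · simp
  · have h1 : ‖F y - F z‖ₑ / ‖y - z‖ₑ ≤ K := by
      refine le_trans ?_ h
      refine le_trans ?_ (le_iSup₂ (f := fun y (_ : y ∈ s) =>
        ⨆ (z ∈ s) (_ : y ≠ z), ‖F y - F z‖ₑ / ‖y - z‖ₑ) y hy)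
      refine le_trans ?_ (le_iSup₂ (f := fun z (_ : z ∈ s) =>
        ⨆ (_ : y ≠ z), ‖F y - F z‖ₑ / ‖y - z‖ₑ) z hz)
      exact le_iSup (f := fun _ : y ≠ z => ‖F y - F z‖ₑ / ‖y - z‖ₑ) hne
    rw [ENNReal.div_le_iff (by simpa [sub_eq_zero] using hne) enorm_ne_top] at h1
    have h2 := ENNReal.toReal_mono (ENNReal.mul_ne_top hK enorm_ne_top) h1
    rwa [ENNReal.toReal_mul, toReal_enorm, toReal_enorm] at h2

theorem lipOn_ne_top (hF : LocallyLipschitz F) (hs : IsCompact s) : lipOn F s ≠ ∞ := by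
  obtain ⟨L, hL, hLip⟩ := exists_lipschitz_const hF hs
  refine ne_top_of_le_ne_top (ENNReal.ofReal_ne_top (r := L)) ?_
  refine iSup₂_le fun y hy => iSup₂_le fun z hz => iSup_le fun _ => ?_
  refine ENNReal.div_le_of_le_mul ?_
  rw [← ofReal_norm, ← ofReal_norm, ← ENNReal.ofReal_mul hL]
  exact ENNReal.ofReal_le_ofReal (hLip y hy z hz)

theorem ofReal_le_sigmaMin {T : Eu p →L[ℝ] Eu n} {a : ℝ} (h : ∀ u, a * ‖u‖ ≤ ‖T u‖) :
    ENNReal.ofReal a ≤ sigmaMin T :=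
  le_iInf₂ fun u hu => by
    have := h u
    rw [hu, mul_one] at this
    rw [← ofReal_norm]
    exact ENNReal.ofReal_le_ofReal this

theorem sigmaMin_toReal_mul_le (T : Eu p →L[ℝ] Eu n) (u : Eu p) :
    (sigmaMin T).toReal * ‖u‖ ≤ ‖T u‖ := by
  rcases eq_or_ne u 0 with rfl | hu
  · simp
  · have hn : ‖u‖ ≠ 0 := norm_ne_zero_iff.2 hu
    have h1 : sigmaMin T ≤ ‖T (‖u‖⁻¹ • u)‖ₑ :=
      iInf₂_le (f := fun (u : Eu p) (_ : ‖u‖ = 1) => ‖T u‖ₑ) (‖u‖⁻¹ • u)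
        (by rw [norm_smul, norm_inv, norm_norm, inv_mul_cancel₀ hn])
    have h2 := ENNReal.toReal_mono enorm_ne_top h1
    rw [toReal_enorm, map_smul, norm_smul, norm_inv, norm_norm] at h2
    calc (sigmaMin T).toReal * ‖u‖ ≤ ‖u‖⁻¹ * ‖T u‖ * ‖u‖ := by gcongr
      _ = ‖T u‖ := by field_simp

theorem sigmaMin_ne_top (hp : 0 < p) (T : Eu p →L[ℝ] Eu n) : sigmaMin T ≠ ∞ := by
  have : Nonempty (Fin p) := ⟨⟨0, hp⟩⟩
  obtain ⟨u, hu⟩ := exists_norm_eq (Eu p) (zero_le_one' ℝ)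
  exact ne_top_of_le_ne_top enorm_ne_top
    (iInf₂_le (f := fun (u : Eu p) (_ : ‖u‖ = 1) => ‖T u‖ₑ) u hu)

theorem sigmaMin_pos {T : Eu p →L[ℝ] Eu n} (hT : Function.Injective T) : 0 < sigmaMin T := by
  obtain ⟨σ, h0, h⟩ := exists_sigma_of_injective hT
  exact (ENNReal.ofReal_pos.2 h0).trans_le (ofReal_le_sigmaMin h)

theorem rhoAt_nonneg (c : Eu n → Eu p) (x : Eu n) : 0 ≤ rhoAt c x :=
  Real.sSup_nonneg fun _ hr => hr.1.le

theorem rhoAt_le_one (c : Eu n → Eu p) (x : Eu n) : rhoAt c x ≤ 1 :=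
  Real.sSup_le (fun _ hr => hr.2.1) zero_le_one

end Extended

section LocalConstants

variable {f : Eu n → ℝ} {c : Eu n → Eu p} {A : Eu n → Eu n}

theorem Admissible.gradient_g_locallyLipschitz (S : Admissible f c A) :
    LocallyLipschitz (gradient (gFun f A)) :=
  (contDiff_one_iff_fderiv.2 ⟨differentiable_gradient S.g_diff2, S.g_lip.continuous⟩ :
    ContDiff ℝ 1 (gradient (gFun f A))).locallyLipschitz

theorem locallyLipschitz_clm_comp : LocallyLipschitz
    fun q : (Eu n →L[ℝ] Eu n) × (Eu p →L[ℝ] Eu n) => q.1.comp q.2 := by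
  have : ContDiff ℝ 1 fun q : (Eu n →L[ℝ] Eu n) × (Eu p →L[ℝ] Eu n) => q.1.comp q.2 :=
    contDiff_fst.clm_comp contDiff_snd
  exact this.locallyLipschitz

theorem Admissible.transJac_comp_locallyLipschitz (S : Admissible f c A) :
    LocallyLipschitz fun y => transJac c (A y) :=
  S.c_lip.comp S.A_contDiff.locallyLipschitz

theorem Admissible.transJac_prod_locallyLipschitz (S : Admissible f c A) :
    LocallyLipschitz fun y => (transJac A y, transJac c (A y)) :=
  S.A_lip.prodMk S.transJac_comp_locallyLipschitz

theorem Admissible.jac_comp_locallyLipschitz (S : Admissible f c A) :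
    LocallyLipschitz fun y => (transJac A y).comp (transJac c (A y)) := by
  have := LocallyLipschitz.comp (locallyLipschitz_clm_comp (n := n) (p := p))
    S.transJac_prod_locallyLipschitz
  exact this

/-- Near every feasible point whose penalty threshold is at most `β`, the extended-valued local
constants yield real ones. -/
theorem Admissible.exists_localBounds (S : Admissible f c A) {x : Eu n} (hx : x ∈ feasible c)
    {β : ℝ≥0} (hβ : betaAt f c A x ≤ β) :
    ∃ D : LocalBounds f c A x β, D.σ = (sigmaAt c x).toReal ∧ D.MA = (MaAt c A x).toReal ∧
      ∀ y ∈ omegaBarAt c A x, ‖y - x‖ * (4 * D.Mc * (D.MA + 1) + D.σ) ≤ D.σ * D.e := by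
  have hΘ : IsCompact (thetaBall c x) := isCompact_closedBall _ _
  have hσT : sigmaAt c x ≠ ∞ := sigmaMin_ne_top S.p_pos _
  have hσ0 : sigmaAt c x ≠ 0 := (sigmaMin_pos (S.licq x hx)).ne'
  have hMc : McAt c x ≠ ∞ := supNormOn_ne_top S.c_lip.continuous hΘ
  have hMA : MaAt c A x ≠ ∞ := supNormOn_ne_top S.A_lip.continuous hΘ
  have hLc : LcAt c x ≠ ∞ := lipOn_ne_top S.c_lip hΘ
  have hLA : LaAt c A x ≠ ∞ := lipOn_ne_top S.A_lip hΘ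
  have hLAc : LacAt c A x ≠ ∞ := lipOn_ne_top S.jac_comp_locallyLipschitz hΘ
  have hLg : LgAt f c A x ≠ ∞ := lipOn_ne_top S.gradient_g_locallyLipschitz hΘ
  have hLf : LfAt f c A x ≠ ∞ := supNormOn_ne_top
    ((differentiable_gradient S.f_diff2).continuous.comp S.A_diff.continuous) hΘ
  -- The quotients in ε_x may be infinite; the entry ρ_x/2 keeps the minimum finite.
  have hε : epsAt c A x ≠ ∞ := ne_top_of_le_ne_top ENNReal.ofReal_ne_top (min_le_left _ _)
  have hMA1 : (MaAt c A x + 1).toReal = (MaAt c A x).toReal + 1 := by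
    rw [ENNReal.toReal_add hMA ENNReal.one_ne_top, ENNReal.toReal_one]
  have hσ2 : (β : ℝ≥0∞) * sigmaAt c x ^ 2 ≠ ∞ :=
    ENNReal.mul_ne_top ENNReal.coe_ne_top (ENNReal.pow_ne_top hσT)
  have e1 : epsAt c A x ≤ ENNReal.ofReal (rhoAt c x / 2) := min_le_left _ _
  have e2 : epsAt c A x * (32 * LcAt c x * (MaAt c A x + 1)) ≤ sigmaAt c x :=
    ENNReal.mul_le_of_le_div ((min_le_right _ _).trans (min_le_left _ _))
  have e3 : epsAt c A x * (8 * LacAt c A x * McAt c x) ≤ sigmaAt c x ^ 2 :=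
    ENNReal.mul_le_of_le_div ((min_le_right _ _).trans (min_le_right _ _))
  have b1 : 128 * LgAt f c A x * (MaAt c A x + 1) ^ 2 ≤ β * sigmaAt c x ^ 2 :=
    (ENNReal.div_le_iff (pow_ne_zero 2 hσ0) (ENNReal.pow_ne_top hσT)).1
      ((le_max_left _ _).trans hβ)
  have b2 : 16 * LfAt f c A x * LaAt c A x * (2 * MaAt c A x + 1) ≤ β * sigmaAt c x ^ 2 :=
    (ENNReal.div_le_iff (pow_ne_zero 2 hσ0) (ENNReal.pow_ne_top hσT)).1
      (((le_max_right _ _).trans (le_max_right _ _)).trans hβ)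
  have e1' := ENNReal.toReal_mono ENNReal.ofReal_ne_top e1
  rw [ENNReal.toReal_ofReal (by linarith [rhoAt_nonneg c x])] at e1'
  have e2' := ENNReal.toReal_mono hσT e2
  have e3' := ENNReal.toReal_mono (ENNReal.pow_ne_top hσT) e3
  have b1' := ENNReal.toReal_mono hσ2 b1
  have b2' := ENNReal.toReal_mono hσ2 b2
  have hMA2 : (2 * MaAt c A x + 1).toReal = 2 * (MaAt c A x).toReal + 1 := by
    rw [ENNReal.toReal_add (ENNReal.mul_ne_top (by simp) hMA) ENNReal.one_ne_top,
      ENNReal.toReal_one, ENNReal.toReal_mul, ENNReal.toReal_ofNat]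
  simp only [ENNReal.toReal_mul, ENNReal.toReal_pow, ENNReal.toReal_ofNat, hMA1, hMA2,
    ENNReal.coe_toReal] at e2' e3' b1' b2'
  refine ⟨{
    σ := (sigmaAt c x).toReal, Mc := (McAt c x).toReal, MA := (MaAt c A x).toReal
    Lc := (LcAt c x).toReal, LA := (LaAt c A x).toReal, LAc := (LacAt c A x).toReal
    Lf := (LfAt f c A x).toReal, Lg := (LgAt f c A x).toReal, R := rhoAt c x
    e := (epsAt c A x).toReal
    σ_pos := ENNReal.toReal_pos hσ0 hσT
    MA_nonneg := ENNReal.toReal_nonneg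
    Lc_nonneg := ENNReal.toReal_nonneg
    LA_nonneg := ENNReal.toReal_nonneg
    LAc_nonneg := ENNReal.toReal_nonneg
    Lf_nonneg := ENNReal.toReal_nonneg
    Lg_nonneg := ENNReal.toReal_nonneg
    e_nonneg := ENNReal.toReal_nonneg
    R_le := rhoAt_le_one c x
    e_R := by linarith
    σ_le := sigmaMin_toReal_mul_le _
    Mc_bd := fun y hy => by
      rw [← norm_transJac]; exact norm_le_of_supNormOn_le hMc le_rfl hy
    MA_bd := fun y hy => by
      rw [← norm_transJac]; exact norm_le_of_supNormOn_le hMA le_rfl hy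
    Lf_bd := fun y hy => norm_le_of_supNormOn_le hLf le_rfl hy
    Lc_lip := fun y hy z hz => by
      rw [← norm_transJac_sub]; exact norm_sub_le_of_lipOn_le hLc le_rfl hy hz
    LA_lip := fun y hy z hz => by
      rw [← norm_transJac_sub]; exact norm_sub_le_of_lipOn_le hLA le_rfl hy hz
    LAc_lip := fun y hy z hz => norm_sub_le_of_lipOn_le hLAc le_rfl hy hz
    Lg_lip := fun y hy z hz => norm_sub_le_of_lipOn_le hLg le_rfl hy hz
    e_Lc := by linarith
    e_LAc := by linarith
    β_Lg := by linarith
    β_LA := by linarith }, rfl, rfl, fun y hy => ?_⟩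
  have h1 := ENNReal.mul_le_of_le_div hy
  have h2 := ENNReal.toReal_mono (ENNReal.mul_ne_top hσT hε) h1
  rw [ENNReal.toReal_mul, ENNReal.toReal_mul, ENNReal.toReal_add (ENNReal.mul_ne_top
    (ENNReal.mul_ne_top (by simp) hMc) (ENNReal.add_ne_top.2 ⟨hMA, ENNReal.one_ne_top⟩)) hσT,
    ENNReal.toReal_mul, hMA1, ENNReal.toReal_mul, ENNReal.toReal_ofNat, toReal_enorm] at h2
  exact h2

theorem mem_omegaBarAt_self (c : Eu n → Eu p) (A : Eu n → Eu n) (x : Eu n) :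
    x ∈ omegaBarAt c A x := by
  simp [omegaBarAt]

end LocalConstants

/-! ### Points near M outside `omegaBar` -/

section Covering

variable {f : Eu n → ℝ} {c : Eu n → Eu p} {A : Eu n → Eu n}

theorem Admissible.betaAt_ne_top (S : Admissible f c A) {x : Eu n} (hx : x ∈ feasible c) :
    betaAt f c A x ≠ ∞ := by
  have hΘ : IsCompact (thetaBall c x) := isCompact_closedBall _ _
  have hσ0 : sigmaAt c x ≠ 0 := (sigmaMin_pos (S.licq x hx)).ne'
  have hMA : MaAt c A x ≠ ∞ := supNormOn_ne_top S.A_lip.continuous hΘ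
  have hLA : LaAt c A x ≠ ∞ := lipOn_ne_top S.A_lip hΘ
  have hLAc : LacAt c A x ≠ ∞ := lipOn_ne_top S.jac_comp_locallyLipschitz hΘ
  have hLg : LgAt f c A x ≠ ∞ := lipOn_ne_top S.gradient_g_locallyLipschitz hΘ
  have hLf : LfAt f c A x ≠ ∞ := supNormOn_ne_top
    ((differentiable_gradient S.f_diff2).continuous.comp S.A_diff.continuous) hΘ
  have hMA1 : MaAt c A x + 1 ≠ ∞ := ENNReal.add_ne_top.2 ⟨hMA, ENNReal.one_ne_top⟩
  have hMA2 : 2 * MaAt c A x + 1 ≠ ∞ :=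
    ENNReal.add_ne_top.2 ⟨ENNReal.mul_ne_top (by simp) hMA, ENNReal.one_ne_top⟩
  refine (max_lt ?_ (max_lt ?_ ?_)).ne
  · exact (ENNReal.div_ne_top (ENNReal.mul_ne_top (ENNReal.mul_ne_top (by simp) hLg)
      (ENNReal.pow_ne_top hMA1)) (pow_ne_zero 2 hσ0)).lt_top
  · exact (ENNReal.div_ne_top (ENNReal.mul_ne_top (ENNReal.mul_ne_top (ENNReal.mul_ne_top
      (by simp) hLf) hMA1) hLAc) (pow_ne_zero 3 hσ0)).lt_top
  · exact (ENNReal.div_ne_top (ENNReal.mul_ne_top (ENNReal.mul_ne_top (ENNReal.mul_ne_top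
      (by simp) hLf) hLA) hMA2) (pow_ne_zero 2 hσ0)).lt_top

/-- From M^c ≥ σ and M^A ≥ 0, the denominator of the radius is at least 5σ. -/
theorem LocalBounds.norm_sub_le_div {x : Eu n} {β : ℝ} (D : LocalBounds f c A x β)
    (S : Admissible f c A) {y : Eu n}
    (hy : ‖y - x‖ * (4 * D.Mc * (D.MA + 1) + D.σ) ≤ D.σ * D.e) : 5 * ‖y - x‖ ≤ D.e := by
  have hσ := D.σ_pos
  have h1 := D.σ_le_Mc S
  have hM := D.MA_nonneg
  have hn := norm_nonneg (y - x)
  have h2 : ‖y - x‖ * (5 * D.σ) ≤ ‖y - x‖ * (4 * D.Mc * (D.MA + 1) + D.σ) := by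
    gcongr
    nlinarith
  have h3 : 5 * ‖y - x‖ * D.σ ≤ D.e * D.σ := by linarith
  exact le_of_mul_le_mul_right h3 hσ

theorem Admissible.norm_sub_le_of_mem_omegaBarAt (S : Admissible f c A) {x y : Eu n}
    (hx : x ∈ feasible c) (hy : y ∈ omegaBarAt c A x) : ‖y - x‖ ≤ 1 / 10 := by
  -- `omegaBarAt` does not involve β, so the finite number β_x itself can serve as penalty
  -- parameter. Then e ≤ 1/2 gives the radius 1/10.
  obtain ⟨D, -, -, hD⟩ := S.exists_localBounds hx (β := (betaAt f c A x).toNNReal)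
    (by rw [ENNReal.coe_toNNReal (S.betaAt_ne_top hx)])
  have := D.norm_sub_le_div S (hD y hy)
  linarith [D.e_R, D.R_le]

/-- Short normal displacements from a feasible point realize the distance to the feasible set. -/
theorem norm_le_of_normal (hc : Differentiable ℝ c) {z : Eu n} (hz : z ∈ feasible c)
    {σ L R : ℝ} (hσ0 : 0 < σ) (hL : 0 ≤ L) (hσ : ∀ u, σ * ‖u‖ ≤ ‖transJac c z u‖)
    (hLip : ∀ y ∈ Metric.closedBall z R, ∀ y' ∈ Metric.closedBall z R,
      ‖fderiv ℝ c y - fderiv ℝ c y'‖ ≤ L * ‖y - y'‖) {q : Eu n} {u : Eu p}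
    (hq : q = transJac c z u) (hqR : 2 * ‖q‖ ≤ R) (hqL : L * ‖q‖ ≤ σ / 2) {w : Eu n}
    (hw : w ∈ feasible c) : ‖q‖ ≤ ‖z + q - w‖ := by
  by_contra hcon
  push Not at hcon
  have hwz : ‖w - z‖ ≤ 2 * ‖q‖ := by
    have : w - z = q - (z + q - w) := by abel
    rw [this]
    linarith [norm_sub_le q (z + q - w)]
  have hT := norm_taylor_le hc (convex_closedBall z R) hL hLip
    (Metric.mem_closedBall_self (by linarith [norm_nonneg q]))
    (show w ∈ Metric.closedBall z R by rw [mem_closedBall_iff_norm]; linarith)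
  rw [show c w = 0 from hw, show c z = 0 from hz, sub_zero, zero_sub, norm_neg] at hT
  -- A feasible w leaves z almost tangentially: Dc(z)(w - z) is O(‖w - z‖²), so the normal vector q
  -- has inner product at most ½‖w - z‖² with w - z. Expanding the square then shows that w is no
  -- closer to z + q than z is.
  have h1 : σ * inner ℝ q (w - z) ≤ σ * (1 / 2 * ‖w - z‖ ^ 2) := by
    have i1 : inner ℝ q (w - z) ≤ ‖u‖ * ‖fderiv ℝ c z (w - z)‖ := by
      rw [hq, transJac_inner]; exact real_inner_le_norm _ _
    have i2 := hσ u
    rw [← hq] at i2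
    calc σ * inner ℝ q (w - z) ≤ σ * (‖u‖ * ‖fderiv ℝ c z (w - z)‖) := by gcongr
      _ = (σ * ‖u‖) * ‖fderiv ℝ c z (w - z)‖ := by ring
      _ ≤ ‖q‖ * (L * ‖w - z‖ * ‖w - z‖) := by gcongr
      _ = (L * ‖q‖) * ‖w - z‖ ^ 2 := by ring
      _ ≤ σ / 2 * ‖w - z‖ ^ 2 := by gcongr
      _ = _ := by ring
  have h2 := le_of_mul_le_mul_left h1 hσ0
  have h3 : ‖z + q - w‖ ^ 2 = ‖q‖ ^ 2 - 2 * inner ℝ q (w - z) + ‖w - z‖ ^ 2 := by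
    have : z + q - w = q - (w - z) := by abel
    rw [this, norm_sub_sq_real]
  have h4 : ‖z + q - w‖ ^ 2 < ‖q‖ ^ 2 := by gcongr
  linarith

theorem le_infDist_of_forall {s : Set (Eu n)} (hs : s.Nonempty) {y : Eu n} {r : ℝ}
    (h : ∀ w ∈ s, r ≤ ‖y - w‖) : r ≤ Metric.infDist y s :=
  (Metric.le_infDist hs).2 fun w hw => by rw [dist_eq_norm]; exact h w hw

/-- The distance to the feasible set has no local maximum on `omegaBar`; it increases with unit
slope along some direction. -/
theorem Admissible.exists_increase (S : Admissible f c A) {x y : Eu n} (hx : x ∈ feasible c)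
    (hy : y ∈ omegaBarAt c A x) : ∃ v : Eu n, 0 < ‖v‖ ∧ ‖v‖ ≤ 1 / 10 ∧
      Metric.infDist y (feasible c) + ‖v‖ ≤ Metric.infDist (y + v) (feasible c) := by
  have hne : (feasible c).Nonempty := ⟨x, hx⟩
  -- A feasible y moves in any normal direction; otherwise y moves further away from its nearest
  -- feasible point z, along y - z.
  by_cases hyM : y ∈ feasible c
  · obtain ⟨σ, hσ0, hσ⟩ := exists_sigma_of_injective (S.licq y hyM)
    obtain ⟨L, hL, hLip⟩ := exists_lipschitz_const S.c_lip (isCompact_closedBall y 1)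
    simp only [norm_transJac_sub] at hLip
    have : Nonempty (Fin p) := ⟨⟨0, S.p_pos⟩⟩
    obtain ⟨u, hu⟩ := exists_norm_eq (Eu p) (zero_le_one' ℝ)
    have hJ : 0 < ‖transJac c y u‖ := by
      have := hσ u
      rw [hu] at this
      linarith
    set t : ℝ := min (1 / 10) (σ / (2 * (L + 1)))
    have ht0 : 0 < t := by positivity
    have ht1 : L * t ≤ σ / 2 := by
      have : t ≤ σ / (2 * (L + 1)) := min_le_right _ _
      rw [le_div_iff₀ (by positivity)] at this
      nlinarith
    have ht2 : t ≤ 1 / 10 := min_le_left _ _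
    set v := transJac c y ((t / ‖transJac c y u‖) • u) with hv
    have hvn : ‖v‖ = t := by
      rw [hv, map_smul, norm_smul, Real.norm_of_nonneg (by positivity)]
      field_simp
    refine ⟨v, by rw [hvn]; exact ht0, by rw [hvn]; exact ht2, ?_⟩
    rw [Metric.infDist_zero_of_mem hyM, zero_add]
    exact le_infDist_of_forall hne fun w hw =>
      norm_le_of_normal S.c_diff hyM hσ0 hL hσ hLip hv (by rw [hvn]; linarith)
        (by rw [hvn]; exact ht1) hw
  · obtain ⟨D, -, -, hD⟩ := S.exists_localBounds hx (β := (betaAt f c A x).toNNReal)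
      (by rw [ENNReal.coe_toNNReal (S.betaAt_ne_top hx)])
    have h5 := D.norm_sub_le_div S (hD y hy)
    have he := D.e_nonneg
    have hr0 : 0 < ‖y - x‖ := norm_pos_iff.2 (sub_ne_zero.2 fun h => hyM (h ▸ hx))
    obtain ⟨z, hz⟩ := exists_isNearest S.c_diff.continuous hne y
    obtain ⟨h1, h2, h3, ⟨u, hu⟩, -⟩ := D.nearest S hx (by linarith) hz
    have hδ : 0 < ‖y - z‖ := norm_pos_iff.2 (sub_ne_zero.2 fun h => hyM (h ▸ hz.1))
    -- The length ‖y - x‖ keeps the whole normal displacement below 2‖y - x‖ ≤ 2e/5, within reach of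
    -- `norm_le_of_normal`.
    set v := (‖y - x‖ / ‖y - z‖) • (y - z) with hv
    have hvn : ‖v‖ = ‖y - x‖ := by
      rw [hv, norm_smul, Real.norm_of_nonneg (by positivity)]
      field_simp
    have hq : y - z + v = transJac c z ((1 + ‖y - x‖ / ‖y - z‖) • u) := by
      rw [map_smul, ← hu, add_smul, one_smul]
    have hqn : ‖y - z + v‖ = ‖y - z‖ + ‖v‖ := by
      have : y - z + v = (1 + ‖y - x‖ / ‖y - z‖) • (y - z) := by rw [add_smul, one_smul]
      rw [hvn, this, norm_smul, Real.norm_of_nonneg (by positivity)]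
      field_simp
    refine ⟨v, by rw [hvn]; exact hr0, by rw [hvn]; linarith [D.e_R, D.R_le], ?_⟩
    have hd : Metric.infDist y (feasible c) ≤ ‖y - z‖ := by
      rw [← dist_eq_norm]; exact Metric.infDist_le_dist_of_mem hz.1
    refine (add_le_add_left hd ‖v‖).trans ?_
    rw [← hqn]
    have hsub : Metric.closedBall z D.e ⊆ Metric.closedBall x D.R := by
      refine Metric.closedBall_subset_closedBall' ?_
      rw [dist_eq_norm]
      linarith [D.e_R]
    refine le_infDist_of_forall hne fun w hw => ?_
    have hyv : y + v = z + (y - z + v) := by abel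
    rw [hyv]
    refine norm_le_of_normal S.c_diff hz.1 (half_pos D.σ_pos) D.Lc_nonneg h3
      (fun a ha b hb => D.Lc_lip a (hsub ha) b (hsub hb)) hq (by rw [hqn, hvn]; linarith) ?_ hw
    have h6 := D.e_Lc'
    have h7 : D.Lc * ‖y - z + v‖ ≤ D.Lc * D.e := by
      have := D.Lc_nonneg
      gcongr
      rw [hqn, hvn]; linarith
    linarith [D.σ_pos]

/-- Near every feasible point there are points outside of `omegaBar`. -/
theorem Admissible.exists_notMem_omegaBar (S : Admissible f c A) {x : Eu n}
    (hx : x ∈ feasible c) : ∃ y, ‖y - x‖ ≤ 2 / 5 ∧ y ∉ omegaBar c A := by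
  by_contra hcon
  push Not at hcon
  -- If the ball lay in `omegaBar`, a maximizer y of φ would have distance at most 1/10 to M, hence
  -- ‖y - x‖ ≤ 1/5 because φ y ≥ φ x = 0. A step v with ‖v‖ ≤ 1/10 stays in the ball and raises φ by
  -- at least ‖v‖/2, a contradiction.
  set φ : Eu n → ℝ := fun y => Metric.infDist y (feasible c) - 1 / 2 * ‖y - x‖
  have hφ : Continuous φ := (Metric.continuous_infDist_pt _).sub (by fun_prop)
  have hxB : x ∈ Metric.closedBall x (2 / 5) := Metric.mem_closedBall_self (by norm_num)
  obtain ⟨y, hyB, hmax⟩ := (isCompact_closedBall x (2 / 5 : ℝ)).exists_isMaxOn ⟨x, hxB⟩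
    hφ.continuousOn
  have h0 : 0 ≤ φ y := by
    have := hmax hxB
    simpa [φ, Metric.infDist_zero_of_mem hx] using this
  have hyO := hcon y (by rwa [mem_closedBall_iff_norm] at hyB)
  obtain ⟨x', hx', hy'⟩ := mem_iUnion₂.1 hyO
  have h1 : Metric.infDist y (feasible c) ≤ 1 / 10 := by
    refine (Metric.infDist_le_dist_of_mem hx').trans ?_
    rw [dist_eq_norm]
    exact S.norm_sub_le_of_mem_omegaBarAt hx' hy'
  obtain ⟨v, hv0, hv1, hv⟩ := S.exists_increase hx' hy'
  have h2 : ‖y + v - x‖ ≤ ‖y - x‖ + ‖v‖ := by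
    have : y + v - x = (y - x) + v := by abel
    rw [this]
    exact norm_add_le _ _
  have h3 : y + v ∈ Metric.closedBall x (2 / 5) := by
    rw [mem_closedBall_iff_norm]
    simp only [φ] at h0
    linarith
  have h4 : φ (y + v) ≤ φ y := hmax h3
  simp only [φ] at h4
  linarith

end Covering

/-! ### Global constants and the level set -/

/-- What the choice of the parameters `β` and `ν` provides, in terms of real numbers. -/
structure GlobalBounds (f : Eu n → ℝ) (c : Eu n → Eu p) (A : Eu n → Eu n) (x₀ : Eu n) (ζ : ℝ)
    (β ν : ℝ≥0) : Prop where
  adm : Admissible f c A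
  feas : x₀ ∈ feasible c
  compact : IsCompact (levelSet f c x₀)
  ζ_pos : 0 < ζ
  beta_le : ∀ w ∈ feasible c, w ∈ gammaSet f c x₀ ζ → betaAt f c A w ≤ β
  osc_le : ∀ y ∈ gammaSet f c x₀ ζ, y ∉ omegaBar c A → ∀ w ∈ gammaSet f c x₀ ζ,
    ∀ w' ∈ gammaSet f c x₀ ζ, 4 * (gFun f A w - gFun f A w') ≤ β * ‖c y‖ ^ 2
  hess_lip : ∀ y ∈ gammaSet f c x₀ ζ, ∀ z ∈ gammaSet f c x₀ ζ,
    ‖hessian (hFun f c A β) y - hessian (hFun f c A β) z‖ ≤ ν * ‖y - z‖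
  hess_le : ∀ y ∈ gammaSet f c x₀ ζ, ‖hessian (hFun f c A β) y‖ ≤ ν * ζ / 2

section Construction

variable {f : Eu n → ℝ} {c : Eu n → Eu p} {A : Eu n → Eu n} {x₀ : Eu n} {ζ : ℝ} {β ν : ℝ≥0}

theorem osc_le_of_betaBar_le (hβ : betaBar f c A x₀ ζ ≤ β) (hβ0 : β ≠ 0) {y w w' : Eu n}
    (hy : y ∈ gammaSet f c x₀ ζ) (hyO : y ∉ omegaBar c A) (hw : w ∈ gammaSet f c x₀ ζ)
    (hw' : w' ∈ gammaSet f c x₀ ζ) :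
    4 * (gFun f A w - gFun f A w') ≤ β * ‖c y‖ ^ 2 := by
  -- The conditions β < ∞ and β ≠ 0 cover the values μ = 0 and μ = ∞.
  have h1 : 4 * oscConst f c A x₀ ζ ≤ β * muConst f c A x₀ ζ :=
    (ENNReal.div_le_iff_le_mul (Or.inr ENNReal.coe_ne_top)
      (Or.inr (by simpa using hβ0))).1 ((le_max_left _ _).trans hβ)
  have h2 : muConst f c A x₀ ζ ≤ ‖c y‖ₑ ^ 2 :=
    iInf₂_le (f := fun y (_ : y ∈ gammaSet f c x₀ ζ \ omegaBar c A) => ‖c y‖ₑ ^ 2) y ⟨hy, hyO⟩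
  have h3 : ENNReal.ofReal (gFun f A w - gFun f A w') ≤ oscConst f c A x₀ ζ :=
    le_iSup₂_of_le (f := fun y (_ : y ∈ gammaSet f c x₀ ζ) =>
      ⨆ z ∈ gammaSet f c x₀ ζ, ENNReal.ofReal (gFun f A y - gFun f A z)) w hw
      (le_iSup₂ (f := fun z (_ : z ∈ gammaSet f c x₀ ζ) =>
        ENNReal.ofReal (gFun f A w - gFun f A z)) w' hw')
  have h4 : 4 * ENNReal.ofReal (gFun f A w - gFun f A w') ≤ β * ‖c y‖ₑ ^ 2 :=
    (mul_le_mul_right h3 4).trans (h1.trans (mul_le_mul_right h2 _))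
  have h5 := ENNReal.toReal_mono
    (ENNReal.mul_ne_top ENNReal.coe_ne_top (ENNReal.pow_ne_top enorm_ne_top)) h4
  rw [ENNReal.toReal_mul, ENNReal.toReal_mul, ENNReal.toReal_pow, toReal_enorm,
    ENNReal.toReal_ofNat, ENNReal.coe_toReal] at h5
  have h6 : gFun f A w - gFun f A w' ≤ (ENNReal.ofReal (gFun f A w - gFun f A w')).toReal :=
    ENNReal.toReal_ofReal' ▸ le_max_left _ _
  linarith

theorem norm_hessian_le_of_nuValue_le (hζ : 0 < ζ) (hν : nuValue f c A β x₀ ζ ≤ ν) {y : Eu n}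
    (hy : y ∈ gammaSet f c x₀ ζ) : ‖hessian (hFun f c A β) y‖ ≤ ν * ζ / 2 := by
  have h1 : 2 * ‖hessian (hFun f c A β) y‖ₑ / ENNReal.ofReal ζ ≤ ν :=
    (le_iSup₂ (f := fun y (_ : y ∈ gammaSet f c x₀ ζ) =>
      2 * ‖hessian (hFun f c A β) y‖ₑ / ENNReal.ofReal ζ) y hy).trans
      ((le_max_left _ _).trans ((le_max_right _ _).trans hν))
  rw [ENNReal.div_le_iff (by simpa using hζ) ENNReal.ofReal_ne_top] at h1
  have h2 := ENNReal.toReal_mono (ENNReal.mul_ne_top ENNReal.coe_ne_top ENNReal.ofReal_ne_top) h1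
  rw [ENNReal.toReal_mul, ENNReal.toReal_mul, toReal_enorm, ENNReal.toReal_ofReal hζ.le,
    ENNReal.toReal_ofNat, ENNReal.coe_toReal] at h2
  linarith

theorem norm_gradient_le_of_nuValue_le (hζ : 0 < ζ) (hν : nuValue f c A β x₀ ζ ≤ ν) {y : Eu n}
    (hy : y ∈ gammaSet f c x₀ ζ) : ‖gradient (hFun f c A β) y‖ ≤ ν * ζ ^ 2 := by
  have h1 : ‖gradient (hFun f c A β) y‖ₑ / ENNReal.ofReal ζ ^ 2 ≤ ν :=
    (le_iSup₂ (f := fun y (_ : y ∈ gammaSet f c x₀ ζ) =>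
      ‖gradient (hFun f c A β) y‖ₑ / ENNReal.ofReal ζ ^ 2) y hy).trans
      ((le_max_right _ _).trans ((le_max_right _ _).trans hν))
  rw [ENNReal.div_le_iff (by simpa using hζ) (ENNReal.pow_ne_top ENNReal.ofReal_ne_top)] at h1
  have h2 := ENNReal.toReal_mono (ENNReal.mul_ne_top ENNReal.coe_ne_top
    (ENNReal.pow_ne_top ENNReal.ofReal_ne_top)) h1
  rwa [ENNReal.toReal_mul, ENNReal.toReal_pow, toReal_enorm, ENNReal.toReal_ofReal hζ.le,
    ENNReal.coe_toReal] at h2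

theorem Admissible.globalBounds (S : Admissible f c A) (hx₀ : x₀ ∈ feasible c)
    (hG : IsCompact (levelSet f c x₀)) (hζ : 0 < ζ) (hβ : betaThreshold f c A x₀ ζ ≤ β)
    (hβ0 : β ≠ 0) (hν : nuValue f c A β x₀ ζ ≤ ν) : GlobalBounds f c A x₀ ζ β ν where
  adm := S
  feas := hx₀
  compact := hG
  ζ_pos := hζ
  beta_le := fun w hw hwΓ => (le_iSup₂ (f := fun w (_ : w ∈ feasible c ∩ gammaSet f c x₀ ζ) =>
    betaAt f c A w) w ⟨hw, hwΓ⟩).trans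
      ((le_max_right _ _).trans ((le_max_left _ _).trans hβ))
  osc_le := fun _ hy hyO _ hw _ hw' =>
    osc_le_of_betaBar_le ((le_max_left _ _).trans hβ) hβ0 hy hyO hw hw'
  hess_lip := fun _ hy _ hz => norm_sub_le_of_lipOn_le ENNReal.coe_ne_top
    ((le_max_left _ _).trans hν) hy hz
  hess_le := fun _ hy => norm_hessian_le_of_nuValue_le hζ hν hy

end Construction

section LevelSet

variable {f : Eu n → ℝ} {c : Eu n → Eu p} {x₀ : Eu n} {ζ : ℝ}

theorem mem_levelSet_self (hx₀ : x₀ ∈ feasible c) : x₀ ∈ levelSet f c x₀ := ⟨hx₀, le_rfl⟩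

theorem mem_gammaSet {y : Eu n} :
    y ∈ gammaSet f c x₀ ζ ↔ Metric.infDist y (levelSet f c x₀) ≤ ζ + 1 := Iff.rfl

theorem infDist_le_add_norm (s : Set (Eu n)) (y w : Eu n) :
    Metric.infDist y s ≤ Metric.infDist w s + ‖y - w‖ := by
  rw [← dist_eq_norm]; exact Metric.infDist_le_infDist_add_dist

theorem infDist_le_norm_sub {s : Set (Eu n)} {y w : Eu n} (hw : w ∈ s) :
    Metric.infDist y s ≤ ‖y - w‖ := by
  rw [← dist_eq_norm]; exact Metric.infDist_le_dist_of_mem hw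

theorem isCompact_gammaSet (hx₀ : x₀ ∈ feasible c) (hG : IsCompact (levelSet f c x₀)) :
    IsCompact (gammaSet f c x₀ ζ) := by
  refine Metric.isCompact_of_isClosed_isBounded
    (isClosed_le (Metric.continuous_infDist_pt _) continuous_const) ?_
  refine (Metric.isBounded_iff_subset_closedBall x₀).2
    ⟨ζ + 1 + Metric.diam (levelSet f c x₀), fun y hy => ?_⟩
  exact (Metric.dist_le_infDist_add_diam hG.isBounded (mem_levelSet_self hx₀)).trans
    (add_le_add_left hy _)

theorem closedBall_subset_gammaSet {y : Eu n} {r : ℝ}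
    (h : Metric.infDist y (levelSet f c x₀) + r ≤ ζ + 1) :
    Metric.closedBall y r ⊆ gammaSet f c x₀ ζ := fun w hw => by
  rw [mem_closedBall_iff_norm] at hw
  rw [mem_gammaSet]
  linarith [infDist_le_add_norm (levelSet f c x₀) w y]

/-- `f` attains its minimum over the feasible set on the level set. -/
theorem exists_feasible_minimizer (hf : Continuous f) (hx₀ : x₀ ∈ feasible c)
    (hG : IsCompact (levelSet f c x₀)) :
    ∃ z ∈ levelSet f c x₀, ∀ w ∈ feasible c, f z ≤ f w := by
  obtain ⟨z, hz, hmin⟩ := hG.exists_isMinOn ⟨x₀, mem_levelSet_self hx₀⟩ hf.continuousOn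
  refine ⟨z, hz, fun w hw => ?_⟩
  rcases le_total (f w) (f x₀) with h | h
  · exact hmin ⟨hw, h⟩
  · exact hz.2.trans h

/-- A uniform lower bound for the singular values of the Jacobian on a compact set. -/
theorem exists_uniform_sigma {s : Set (Eu n)} (hp : 0 < p) (hc : Continuous (transJac c))
    (hs : IsCompact s) (hne : s.Nonempty) (hinj : ∀ x ∈ s, Function.Injective (transJac c x)) :
    ∃ σ : ℝ, 0 < σ ∧ ∀ x ∈ s, ∀ u, σ * ‖u‖ ≤ ‖transJac c x u‖ := by
  have : Nonempty (Fin p) := ⟨⟨0, hp⟩⟩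
  obtain ⟨u₀, hu₀⟩ := exists_norm_eq (Eu p) (zero_le_one' ℝ)
  obtain ⟨x₁, hx₁⟩ := hne
  have hcont : Continuous fun q : Eu n × Eu p => ‖transJac c q.1 q.2‖ :=
    ((hc.comp continuous_fst).clm_apply continuous_snd).norm
  obtain ⟨⟨x, u⟩, ⟨hx, hu⟩, hmin⟩ := (hs.prod (isCompact_sphere (0 : Eu p) 1)).exists_isMinOn
    ⟨(x₁, u₀), hx₁, by simpa using hu₀⟩ hcont.continuousOn
  have hu1 : ‖u‖ = 1 := by simpa using hu
  refine ⟨‖transJac c x u‖, norm_pos_iff.2 fun h => ?_, fun y hy v => ?_⟩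
  · have : u = 0 := hinj x hx (by rw [h, map_zero])
    rw [this, norm_zero] at hu1
    exact zero_ne_one hu1
  · rcases eq_or_ne v 0 with rfl | hv
    · simp
    · have hn : ‖v‖ ≠ 0 := norm_ne_zero_iff.2 hv
      have h1 : ‖transJac c x u‖ ≤ ‖transJac c y (‖v‖⁻¹ • v)‖ := by
        refine hmin (a := (y, ‖v‖⁻¹ • v)) ⟨hy, ?_⟩
        rw [mem_sphere_zero_iff_norm, norm_smul, norm_inv, norm_norm, inv_mul_cancel₀ hn]
      rw [map_smul, norm_smul, norm_inv, norm_norm] at h1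
      calc ‖transJac c x u‖ * ‖v‖ ≤ ‖v‖⁻¹ * ‖transJac c y v‖ * ‖v‖ := by gcongr
        _ = ‖transJac c y v‖ := by field_simp

end LevelSet

/-! ### Confinement near the level set -/

namespace GlobalBounds

variable {f : Eu n → ℝ} {c : Eu n → Eu p} {A : Eu n → Eu n} {x₀ : Eu n} {ζ : ℝ} {β ν : ℝ≥0}
  (G : GlobalBounds f c A x₀ ζ β ν)
include G

theorem ball_subset {y : Eu n} {r : ℝ} (hy : y ∈ levelSet f c x₀) (hr : r ≤ 1) :
    Metric.closedBall y r ⊆ gammaSet f c x₀ ζ := by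
  refine closedBall_subset_gammaSet ?_
  rw [Metric.infDist_zero_of_mem hy]
  linarith [G.ζ_pos]

/-- Points of low penalty value lie in the neighbourhood where the local analysis applies. -/
theorem mem_omegaBar (hβ : 0 < β) {y : Eu n} (hy : y ∈ gammaSet f c x₀ ζ)
    (hhy : hFun f c A β y ≤ f x₀) : y ∈ omegaBar c A := by
  by_contra hO
  -- Outside `omegaBar` the oscillation bound consumes at most half of the penalty, so h(y) ≥ f x₀ +
  -- β/4 · ‖c y‖², and c y ≠ 0 there.
  have h1 := G.osc_le y hy hO x₀ (G.ball_subset (mem_levelSet_self G.feas) zero_le_one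
    (Metric.mem_closedBall_self le_rfl)) y hy
  rw [G.adm.g_of_feasible G.feas] at h1
  have h2 : 0 < ‖c y‖ := norm_pos_iff.2 fun h =>
    hO (mem_iUnion₂.2 ⟨y, h, mem_omegaBarAt_self c A y⟩)
  have h3 : 0 < (β : ℝ) * ‖c y‖ ^ 2 := by positivity
  rw [hFun, show f (A y) = gFun f A y from rfl] at hhy
  linarith

/-- The limit of the dissolving operator from a point of low penalty value. -/
theorem exists_limit (hβ : 0 < β) : ∃ κ : ℝ, 0 ≤ κ ∧ ∀ y,
    Metric.infDist y (levelSet f c x₀) ≤ ζ + 9 / 10 → hFun f c A β y ≤ f x₀ →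
    ∃ z ∈ levelSet f c x₀, Tendsto (fun k : ℕ => A^[k] y) atTop (𝓝 z) ∧ ‖y - z‖ ≤ 1 / 2 ∧
      ‖y - z‖ ≤ κ * ‖gradient (hFun f c A β) y‖ := by
  have S := G.adm
  have hΓ : IsCompact (gammaSet f c x₀ ζ) := isCompact_gammaSet G.feas G.compact
  have hx₀Γ : x₀ ∈ gammaSet f c x₀ ζ := G.ball_subset (mem_levelSet_self G.feas) zero_le_one
    (Metric.mem_closedBall_self le_rfl)
  obtain ⟨σ, hσ0, hσ⟩ := exists_uniform_sigma (s := feasible c ∩ gammaSet f c x₀ ζ) S.p_pos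
    S.c_lip.continuous (hΓ.inter_left (isClosed_feasible S.c_diff.continuous))
    ⟨x₀, G.feas, hx₀Γ⟩ fun x hx => S.licq x hx.1
  -- Θ_x has radius at most 1, so the 1-thickening of Γ contains Θ_x for every x in Γ.
  obtain ⟨M, hM⟩ := (hΓ.cthickening (r := 1)).exists_bound_of_continuousOn
    S.A_lip.continuous.continuousOn
  have hM0 : 0 ≤ M := (norm_nonneg _).trans (hM x₀ (Metric.self_subset_cthickening _ hx₀Γ))
  have hβ' : (0 : ℝ) < β := hβ
  refine ⟨64 / 3 * (M + 1) ^ 2 / (β * σ ^ 2), by positivity, fun y hy hhy => ?_⟩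
  have hyΓ : y ∈ gammaSet f c x₀ ζ := by rw [mem_gammaSet]; linarith
  obtain ⟨x, hx, hyx⟩ := mem_iUnion₂.1 (G.mem_omegaBar hβ hyΓ hhy)
  -- The centre x is within 1/10 of y. The margin 9/10 in place of 1 keeps it in Γ, where β_x ≤ β.
  have hxΓ : x ∈ gammaSet f c x₀ ζ := by
    have := S.norm_sub_le_of_mem_omegaBarAt hx hyx
    rw [norm_sub_rev] at this
    rw [mem_gammaSet]
    linarith [infDist_le_add_norm (levelSet f c x₀) x y]
  obtain ⟨D, hDσ, hDM, hD⟩ := S.exists_localBounds hx (G.beta_le x hx hxΓ)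
  obtain ⟨z, hz, hzM, hz1, hz2⟩ := D.exists_limit S hx (hD y hyx)
  have hfz := D.f_limit_le S hx (hD y hyx) β.2 hz hzM
  refine ⟨z, ⟨hzM, hfz.trans hhy⟩, hz, by linarith [D.e_R, D.R_le], ?_⟩
  have hc := D.norm_c_le_gradient S hx hβ' (hD y hyx)
  have hσD : σ ≤ D.σ := by
    rw [hDσ, ← ENNReal.toReal_ofReal hσ0.le]
    exact ENNReal.toReal_mono (sigmaMin_ne_top S.p_pos _)
      (ofReal_le_sigmaMin (hσ x ⟨hx, hxΓ⟩))
  have hMD : D.MA ≤ M := by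
    rw [hDM, ← ENNReal.toReal_ofReal hM0]
    refine ENNReal.toReal_mono ENNReal.ofReal_ne_top (supNormOn_le_ofReal fun w hw => hM w ?_)
    refine Metric.mem_cthickening_of_dist_le w x 1 _ hxΓ ?_
    exact (Metric.mem_closedBall.1 hw).trans (rhoAt_le_one c x)
  have hM1 := D.one_le
  calc ‖y - z‖ ≤ 8 / 3 * (D.MA + 1) / D.σ * ‖c y‖ := hz1
    _ ≤ 8 / 3 * (M + 1) / σ * (8 * (M + 1) / (β * σ) * ‖gradient (hFun f c A β) y‖) := by
        gcongr
        refine hc.trans ?_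
        gcongr
    _ = _ := by field_simp; ring

/-- The gap that confines the iterates: points with h ≤ f x₀ never have distance in (1/2, ζ + 9/10]
to the level set. -/
theorem infDist_le_half (hβ : 0 < β) {y : Eu n}
    (hy : Metric.infDist y (levelSet f c x₀) ≤ ζ + 9 / 10) (hhy : hFun f c A β y ≤ f x₀) :
    Metric.infDist y (levelSet f c x₀) ≤ 1 / 2 := by
  obtain ⟨κ, -, h⟩ := G.exists_limit hβ
  obtain ⟨z, hz, -, h1, -⟩ := h y hy hhy
  exact (infDist_le_norm_sub hz).trans h1

/-- The oscillation of `f ∘ A` over `Γ` is small compared with `ν ζ`. -/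
theorem osc_small {w w' : Eu n} (hw : w ∈ gammaSet f c x₀ ζ) (hw' : w' ∈ gammaSet f c x₀ ζ) :
    gFun f A w - gFun f A w' ≤ ν * ζ / 25 := by
  have S := G.adm
  obtain ⟨x, hx, hmin⟩ := exists_feasible_minimizer S.f_diff.continuous G.feas G.compact
  have hgx : gradient (hFun f c A β) x = 0 := by
    rw [S.gradient_h_of_feasible _ hx.1]
    exact S.gradient_g_of_isLocalMinOn hx.1 (IsMinOn.localize fun w hw => hmin w hw)
  -- At y the penalty dominates: β/4 · ‖c y‖² ≤ h(y) - h(x). As x is a critical point of h, this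
  -- difference is at most νζ/4 · (2/5)² = νζ/25, and β/4 · ‖c y‖² also bounds the oscillation.
  obtain ⟨y, hy, hyO⟩ := S.exists_notMem_omegaBar hx.1
  have hB := G.ball_subset (r := 2 / 5) hx (by norm_num)
  have hxB : x ∈ Metric.closedBall x (2 / 5 : ℝ) := Metric.mem_closedBall_self (by norm_num)
  have hyB : y ∈ Metric.closedBall x (2 / 5 : ℝ) := by rwa [mem_closedBall_iff_norm]
  have h1 := G.osc_le y (hB hyB) hyO w hw w' hw'
  have h2 := G.osc_le y (hB hyB) hyO x (hB hxB) y (hB hyB)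
  have h3 := sub_le_of_gradient_eq_zero (S.h_diff β) (S.h_diff2 β) (convex_closedBall x (2 / 5))
    (fun z hz => G.hess_le z (hB hz)) hxB hyB hgx
  rw [S.h_of_feasible _ hx.1, ← S.g_of_feasible hx.1, hFun,
    show f (A y) = gFun f A y from rfl] at h3
  have h4 : ‖y - x‖ ^ 2 ≤ (2 / 5) ^ 2 := by gcongr
  have h5 : (ν : ℝ) * ζ / 2 / 2 * ‖y - x‖ ^ 2 ≤ ν * ζ / 2 / 2 * (2 / 5) ^ 2 := by
    have := G.ζ_pos
    gcongr
  linarith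

/-- Sublevel points along a cubic step stay close to the level set, and the step decreases the
penalty function. -/
theorem cubic_step (hβ : 0 < β) {x d : Eu n} (hx : Metric.infDist x (levelSet f c x₀) ≤ 1 / 2)
    (hhx : hFun f c A β x ≤ f x₀)
    (hd : IsMinOn (cubicModel (hFun f c A β) ν x) univ d) :
    Metric.infDist (x + d) (levelSet f c x₀) ≤ 1 / 2 ∧
      hFun f c A β (x + d) ≤ hFun f c A β x - ν / 12 * ‖d‖ ^ 3 ∧
      ‖gradient (hFun f c A β) (x + d)‖ ≤ ν * ‖d‖ ^ 2 := by
  have S := G.adm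
  have hζ := G.ζ_pos
  have hν : (0 : ℝ) ≤ ν := ν.2
  set h := hFun f c A β
  set φ : ℝ → ℝ := fun t => Metric.infDist (x + t • d) (levelSet f c x₀)
  have hφ : Continuous φ := (Metric.continuous_infDist_pt _).comp (by fun_prop)
  have hxΓ : x ∈ gammaSet f c x₀ ζ := by rw [mem_gammaSet]; linarith
  have taylor : ∀ t ∈ Icc (0 : ℝ) 1, (∀ s ∈ Icc 0 t, φ s ≤ ζ + 9 / 10) →
      h (x + t • d) ≤ h x + cubicModel h ν x (t • d) ∧
      ‖gradient h (x + t • d) - gradient h x - hessian h x (t • d)‖ ≤ ν / 2 * ‖t • d‖ ^ 2 := by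
    intro t ht hs
    refine le_add_cubicModel (S.h_diff β) (S.h_diff2 β) fun r hr => ?_
    have h1 : x + r • t • d ∈ gammaSet f c x₀ ζ := by
      rw [mem_gammaSet, smul_smul]
      have := hs (r * t) ⟨mul_nonneg hr.1 ht.1, mul_le_of_le_one_left ht.1 hr.2⟩
      simp only [φ] at this
      linarith
    have h2 := G.hess_lip _ h1 x hxΓ
    rwa [add_sub_cancel_left, norm_smul, Real.norm_of_nonneg hr.1] at h2
  have stay : ∀ t ∈ Icc (0 : ℝ) 1, φ t ≤ 1 / 2 := by
    by_contra hcon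
    push Not at hcon
    obtain ⟨t₁, ht₁, h1⟩ := hcon
    -- A level strictly inside the gap. Up to the first time t at which φ reaches m, the segment
    -- lies in Γ and Taylor's estimate applies, so h(x + t • d) ≤ h(x); the gap lemma then gives φ t
    -- ≤ 1/2 < m.
    set m := min (φ t₁) (9 / 10)
    have hm : 1 / 2 < m := lt_min h1 (by norm_num)
    have hm' : m ≤ 9 / 10 := min_le_right _ _
    set T : Set ℝ := Icc 0 t₁ ∩ {t | m ≤ φ t}
    have hTc : IsCompact T := isCompact_Icc.inter_right (isClosed_le continuous_const hφ)
    obtain ⟨t, ⟨⟨ht0, ht1⟩, htm⟩, htmin⟩ := hTc.exists_isLeast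
      ⟨t₁, ⟨⟨ht₁.1, le_rfl⟩, show m ≤ φ t₁ from min_le_left _ _⟩⟩
    have hlt : ∀ s ∈ Ico 0 t, φ s < m := fun s hs => by
      by_contra hsm
      push Not at hsm
      exact absurd (htmin ⟨⟨hs.1, hs.2.le.trans ht1⟩, hsm⟩) (not_le.2 hs.2)
    have ht0' : 0 < t := by
      rcases ht0.eq_or_lt with h0 | h0
      · rw [← h0] at htm
        simp only [mem_ofPred_eq, φ, zero_smul, add_zero] at htm
        linarith
      · exact h0
    have hφt : φ t ≤ m := by
      have h2 : Tendsto φ (𝓝[<] t) (𝓝 (φ t)) := (hφ.tendsto t).mono_left nhdsWithin_le_nhds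
      refine le_of_tendsto h2 ?_
      filter_upwards [Ioo_mem_nhdsLT ht0'] with s hs
      exact (hlt s ⟨hs.1.le, hs.2⟩).le
    have hle : ∀ s ∈ Icc 0 t, φ s ≤ ζ + 9 / 10 := fun s hs => by
      rcases hs.2.eq_or_lt with h2 | h2
      · rw [h2]; linarith
      · linarith [hlt s ⟨hs.1, h2⟩]
    have htI : t ∈ Icc (0 : ℝ) 1 := ⟨ht0, ht1.trans ht₁.2⟩
    have h2 := (taylor t htI hle).1
    have h3 := cubicModel_smul_nonpos_of_isMinOn hν hd htI
    have h4 : φ t ≤ 1 / 2 := G.infDist_le_half hβ (hle t ⟨ht0, le_rfl⟩) (by linarith)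
    have htm' : m ≤ φ t := htm
    linarith
  have h1I : (1 : ℝ) ∈ Icc (0 : ℝ) 1 := ⟨zero_le_one, le_rfl⟩
  obtain ⟨h1, h2⟩ := taylor 1 h1I fun s hs => by linarith [stay s hs]
  rw [one_smul] at h1 h2
  refine ⟨by simpa [φ] using stay 1 h1I, ?_, ?_⟩
  · linarith [cubicModel_le_of_isMinOn hd]
  · have h3 := norm_gradient_add_hessian_le_of_isMinOn (S.h_diff β) (S.h_diff2 β) hν hd
    have h4 : gradient h (x + d) = (gradient h (x + d) - gradient h x - hessian h x d)
        + (gradient h x + hessian h x d) := by abel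
    rw [h4]
    linarith [norm_add_le (gradient h (x + d) - gradient h x - hessian h x d)
      (gradient h x + hessian h x d)]

end GlobalBounds

/-! ### Curvature on the level set, and vanishing thresholds -/

section Stationarity

variable {f : Eu n → ℝ} {c : Eu n → Eu p} {A : Eu n → Eu n} {x₀ : Eu n} {ζ : ℝ} {β ν : ℝ≥0}

/-- Lower bound for the least eigenvalue of the Riemannian Hessian, uniformly on a level set. -/
theorem Admissible.exists_lambdaMin_const (S : Admissible f c A) (hx₀ : x₀ ∈ feasible c)
    (hG : IsCompact (levelSet f c x₀)) : ∃ C : ℝ, 0 ≤ C ∧ ∀ z ∈ levelSet f c x₀, ∀ θ : ℝ,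
      (∀ d : Eu n, d ∈ tangent c z → ‖d‖ = 1 → -θ ≤ inner ℝ d (hessian (gFun f A) z d)) →
      ((-(θ + C * ‖gradient (gFun f A) z‖) : ℝ) : EReal) ≤ riemHessLambdaMin f c z := by
  obtain ⟨σ, hσ0, hσ⟩ := exists_uniform_sigma S.p_pos S.c_lip.continuous hG
    ⟨x₀, mem_levelSet_self hx₀⟩ fun x hx => S.licq x hx.1
  obtain ⟨L, hL, hLip⟩ := exists_lipschitz_const S.c_lip (hG.cthickening (r := 1))
  refine ⟨2 * L / σ, by positivity, fun z hz θ hθ => ?_⟩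
  refine le_iInf fun d => le_iInf fun hd => le_iInf fun hd1 => EReal.coe_le_coe_iff.2 ?_
  have hev : ∀ᶠ w in 𝓝 z, ‖fderiv ℝ c w - fderiv ℝ c z‖ ≤ L * ‖w - z‖ := by
    filter_upwards [Metric.closedBall_mem_nhds z one_pos] with w hw
    rw [← norm_transJac_sub]
    exact hLip w (Metric.mem_cthickening_of_dist_le w z 1 _ hz hw) z
      (Metric.self_subset_cthickening _ hz)
  linarith [inner_riemHess_ge S hz.1 hσ0 (hσ z hz) hev hd hd1, hθ d hd hd1]

/-- Ensures that Θ_x is a neighbourhood of x, so that constancy on Θ_x is local constancy. The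
Jacobian varies by at most σ/2 on the ball of radius r. -/
theorem rhoAt_pos (S : Admissible f c A) {x : Eu n} (hx : x ∈ feasible c) : 0 < rhoAt c x := by
  have hσT : sigmaMin (transJac c x) ≠ ∞ := sigmaMin_ne_top S.p_pos _
  set σ := (sigmaMin (transJac c x)).toReal with hσd
  have hσ0 : 0 < σ := ENNReal.toReal_pos (sigmaMin_pos (S.licq x hx)).ne' hσT
  obtain ⟨L, hL, hLip⟩ := exists_lipschitz_const S.c_lip (isCompact_closedBall x 1)
  set r : ℝ := min 1 (σ / (2 * (L + 1)))
  have hr0 : 0 < r := by positivity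
  have hr1 : L * r ≤ σ / 2 := by
    have : r ≤ σ / (2 * (L + 1)) := min_le_right _ _
    rw [le_div_iff₀ (by positivity)] at this
    nlinarith
  refine hr0.trans_le (le_csSup ⟨1, fun r hr => hr.2.1⟩ ⟨hr0, min_le_left _ _, ?_⟩)
  refine le_iInf₂ fun y hy => ?_
  have h1 : sigmaMin (transJac c x) / 2 = ENNReal.ofReal (σ / 2) := by
    rw [ENNReal.ofReal_div_of_pos two_pos, hσd, ENNReal.ofReal_toReal hσT, ENNReal.ofReal_ofNat]
  rw [h1]
  refine ofReal_le_sigmaMin fun u => ?_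
  have h2 := hLip x (Metric.mem_closedBall_self zero_le_one) y
    (Metric.closedBall_subset_closedBall (min_le_left _ _) hy)
  have h3 : ‖x - y‖ ≤ r := by rw [norm_sub_rev]; exact mem_closedBall_iff_norm.1 hy
  have h4 : L * ‖x - y‖ ≤ L * r := by gcongr
  have h5 := (transJac c x - transJac c y).le_opNorm u
  rw [sub_apply] at h5
  have h6 := mul_le_mul_of_nonneg_right (h2.trans (h4.trans hr1)) (norm_nonneg u)
  have h7 := norm_sub_norm_le (transJac c x u) (transJac c y u)
  linarith [sigmaMin_toReal_mul_le (transJac c x) u]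

/-- If the penalty threshold vanishes, then the gradient of `f ∘ A` is locally constant along the
level set. -/
theorem gradient_g_eventually_const (S : Admissible f c A) {x : Eu n} (hx : x ∈ feasible c)
    (hβ : betaAt f c A x = 0) :
    ∀ᶠ w in 𝓝 x, gradient (gFun f A) w = gradient (gFun f A) x := by
  have h1 : 128 * LgAt f c A x * (MaAt c A x + 1) ^ 2 / sigmaAt c x ^ 2 = 0 :=
    nonpos_iff_eq_zero.1 ((le_max_left _ _).trans hβ.le)
  have h2 : LgAt f c A x = 0 := by
    have hσT : sigmaAt c x ^ 2 ≠ ∞ := ENNReal.pow_ne_top (sigmaMin_ne_top S.p_pos _)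
    rcases ENNReal.div_eq_zero_iff.1 h1 with h | h
    · simpa using h
    · exact absurd h hσT
  filter_upwards [Metric.closedBall_mem_nhds x (rhoAt_pos S hx)] with w hw
  have h3 := norm_sub_le_of_lipOn_le ENNReal.zero_ne_top h2.le hw
    (Metric.mem_closedBall_self (rhoAt_nonneg c x))
  rw [ENNReal.toReal_zero, zero_mul] at h3
  exact sub_eq_zero.1 (norm_le_zero_iff.1 h3)

/-- Minimize f over the points of the level set having the same ∇g as x₀. Local constancy of ∇g
makes a minimizer z a local minimizer of f on M, so ∇g(z) = 0, and this is also the value at x₀. -/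
theorem gradient_g_eq_zero_of_betaAt_eq_zero (S : Admissible f c A) (hx₀ : x₀ ∈ feasible c)
    (hG : IsCompact (levelSet f c x₀)) (hβ : ∀ w ∈ levelSet f c x₀, betaAt f c A w = 0) :
    gradient (gFun f A) x₀ = 0 := by
  set T : Set (Eu n) :=
    levelSet f c x₀ ∩ {w | gradient (gFun f A) w = gradient (gFun f A) x₀}
  have hT : IsCompact T := hG.inter_right
    (isClosed_eq (differentiable_gradient S.g_diff2).continuous continuous_const)
  obtain ⟨z, hz, hmin⟩ := hT.exists_isMinOn ⟨x₀, mem_levelSet_self hx₀, rfl⟩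
    S.f_diff.continuous.continuousOn
  have hloc : IsLocalMinOn f (feasible c) z := by
    have h1 := gradient_g_eventually_const S hz.1.1 (hβ z hz.1)
    filter_upwards [nhdsWithin_le_nhds h1, self_mem_nhdsWithin] with w hw hwM
    rcases le_total (f w) (f x₀) with h | h
    · exact hmin ⟨⟨hwM, h⟩, hw.trans hz.2⟩
    · exact hz.1.2.trans h
  have h2 : gradient (gFun f A) z = gradient (gFun f A) x₀ := hz.2
  rw [← h2]
  exact S.gradient_g_of_isLocalMinOn hz.1.1 hloc

end Stationarity

/-! ### The iterates of the momentum method -/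

section Run

variable {f : Eu n → ℝ} {c : Eu n → Eu p} {A : Eu n → Eu n} {x₀ : Eu n} {ζ : ℝ} {β ν : ℝ≥0}
  {ρ : ℝ} {x y : ℕ → Eu n}

/-- The sum of the cubed step lengths before iteration `k`. -/
noncomputable def stepSum (x y : ℕ → Eu n) (k : ℕ) : ℝ :=
  ∑ j ∈ Finset.range k, ‖y (j + 1) - x j‖ ^ 3

/-- The properties of the iterates that are preserved by the algorithm. -/
structure RunInvariant (f : Eu n → ℝ) (c : Eu n → Eu p) (A : Eu n → Eu n) (x₀ : Eu n)
    (β ν : ℝ≥0) (x y : ℕ → Eu n) (k : ℕ) : Prop where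
  x_near : Metric.infDist (x k) (levelSet f c x₀) ≤ 1 / 2
  y_near : Metric.infDist (y k) (levelSet f c x₀) ≤ 1 / 2
  decrease : hFun f c A β (x k) ≤ f x₀ - ν / 12 * stepSum x y k
  -- Quantified over t because it is used with the next momentum weight τ; the term t³/3 is then at
  -- most a third of the next cubed step.
  momentum : ∀ t ∈ Icc (0 : ℝ) 1, t * ‖x k - y k‖ ≤ t ^ 3 / 3 + stepSum x y k

/-- What one iteration guarantees about the new point. -/
structure StepBounds (f : Eu n → ℝ) (c : Eu n → Eu p) (A : Eu n → Eu n) (ζ : ℝ) (β ν : ℝ≥0)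
    (x y : ℕ → Eu n) (k : ℕ) : Prop where
  grad : ‖gradient (hFun f c A β) (y (k + 1))‖ ≤ ν * ‖y (k + 1) - x k‖ ^ 2
  sum_le : stepSum x y (k + 1) ≤ 12 / 25 * ζ
  move_grad : ‖x (k + 1) - y (k + 1)‖ ≤ ν * ‖y (k + 1) - x k‖ ^ 2 * ‖y (k + 1) - y k‖
  move_step : ‖x (k + 1) - y (k + 1)‖ ≤ ‖y (k + 1) - x k‖ * ‖y (k + 1) - y k‖
  move : ‖x (k + 1) - y (k + 1)‖ ≤ ζ + 2 / 5

theorem stepSum_nonneg (x y : ℕ → Eu n) (k : ℕ) : 0 ≤ stepSum x y k :=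
  Finset.sum_nonneg fun _ _ => by positivity

/-- The cubic step is confined by the gap. The momentum point is reached by a jump, so its distance
is bounded first through the sum of cubed steps; if it is selected, its value of h is lower and the
gap applies again. -/
theorem GlobalBounds.run_step (G : GlobalBounds f c A x₀ ζ β ν) (hβ : 0 < β) (hν : 0 < ν)
    (hρ0 : 0 ≤ ρ) (hρ1 : ρ < 1) (hrun : IsCRMRun (hFun f c A β) ρ ν x₀ x y) {k : ℕ}
    (hk : RunInvariant f c A x₀ β ν x y k) :
    RunInvariant f c A x₀ β ν x y (k + 1) ∧ StepBounds f c A ζ β ν x y k := by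
  have S := G.adm
  have hζ := G.ζ_pos
  have hν' : (0 : ℝ) < ν := hν
  have hsum0 := stepSum_nonneg x y k
  have hsum : stepSum x y (k + 1) = stepSum x y k + ‖y (k + 1) - x k‖ ^ 3 :=
    Finset.sum_range_succ _ _
  have hdec0 := hk.decrease
  have hx₀h : hFun f c A β (x k) ≤ f x₀ := by
    have : 0 ≤ (ν : ℝ) / 12 * stepSum x y k := by positivity
    linarith
  obtain ⟨h1, h2, h3⟩ := G.cubic_step hβ hk.x_near hx₀h (hrun.cubic_step k)
  rw [add_sub_cancel] at h1 h2 h3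
  set d := y (k + 1) - x k with hd
  set y' := y (k + 1)
  have hdec : hFun f c A β y' ≤ f x₀ - ν / 12 * stepSum x y (k + 1) := by rw [hsum]; linarith
  have hΓ : ∀ w, Metric.infDist w (levelSet f c x₀) ≤ 1 / 2 → w ∈ gammaSet f c x₀ ζ :=
    fun w hw => by rw [mem_gammaSet]; linarith
  -- The total decrease ν/12 · Σ‖d‖³ is at most g(x₀) - g(y') ≤ νζ/25.
  have hS : stepSum x y (k + 1) ≤ 12 / 25 * ζ := by
    have i1 := G.osc_small (hΓ x₀ (by
      rw [Metric.infDist_zero_of_mem (mem_levelSet_self G.feas)]; norm_num)) (hΓ y' h1)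
    rw [S.g_of_feasible G.feas] at i1
    have i2 : gFun f A y' ≤ hFun f c A β y' := by
      have : 0 ≤ (β : ℝ) / 2 * ‖c y'‖ ^ 2 := by positivity
      rw [hFun, gFun]; linarith
    have i3 : (ν : ℝ) * stepSum x y (k + 1) ≤ ν * (12 / 25 * ζ) := by linarith
    exact le_of_mul_le_mul_left i3 hν'
  set τ := momentumWeight (hFun f c A β) ρ (x k) y' with hτ
  have hτρ : τ ≤ ρ := min_le_left _ _
  have hτg : τ ≤ ‖gradient (hFun f c A β) y'‖ := (min_le_right _ _).trans (min_le_left _ _)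
  have hτd : τ ≤ ‖d‖ := (min_le_right _ _).trans (min_le_right _ _)
  have hτ0 : 0 ≤ τ := le_min hρ0 (le_min (norm_nonneg _) (norm_nonneg _))
  have hτ1 : τ ≤ 1 := hτρ.trans hρ1.le
  set v := momentumPoint (hFun f c A β) ρ (x k) (y k) y' with hv
  have hvy : ‖v - y'‖ = τ * ‖y' - y k‖ := by
    rw [hv, momentumPoint, add_sub_cancel_left, norm_smul, Real.norm_of_nonneg hτ0]
  have hyy : ‖y' - y k‖ ≤ ‖d‖ + ‖x k - y k‖ := by
    have : y' - y k = d + (x k - y k) := by rw [hd]; abel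
    rw [this]; exact norm_add_le _ _
  have hjump : τ * ‖y' - y k‖ ≤ τ * ‖d‖ + ‖d‖ ^ 3 / 3 + stepSum x y k := by
    have i1 := hk.momentum τ ⟨hτ0, hτ1⟩
    have i2 := mul_le_mul_of_nonneg_left hyy hτ0
    have i3 : τ ^ 3 ≤ ‖d‖ ^ 3 := by gcongr
    linarith
  have hd0 := norm_nonneg d
  -- With ‖d‖² ≤ 2/3 · ‖d‖³ + 1/3, the jump is at most 1/3 + Σ‖d‖³ ≤ 1/3 + 12ζ/25. Together with the
  -- distance 1/2 of y', this stays below ζ + 9/10.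
  have hmove : τ * ‖y' - y k‖ ≤ ζ + 2 / 5 := by
    have i1 : τ * ‖d‖ ≤ ‖d‖ * ‖d‖ := by gcongr
    have i2 : ‖d‖ * ‖d‖ ≤ (2 * ‖d‖ ^ 3 + 1) / 3 := by
      nlinarith [mul_nonneg (by linarith : (0:ℝ) ≤ 2 * ‖d‖ + 1) (sq_nonneg (‖d‖ - 1))]
    linarith
  have hstep : hFun f c A β (x (k + 1)) ≤ hFun f c A β y' ∧
      Metric.infDist (x (k + 1)) (levelSet f c x₀) ≤ 1 / 2 ∧
      ‖x (k + 1) - y'‖ ≤ τ * ‖y' - y k‖ := by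
    rw [hrun.select_step k]
    split_ifs with hle
    · exact ⟨le_rfl, h1, by rw [sub_self, norm_zero]; positivity⟩
    · push Not at hle
      have i1 : hFun f c A β v ≤ f x₀ := by
        have : 0 ≤ (ν : ℝ) / 12 * stepSum x y (k + 1) := by
          have := stepSum_nonneg x y (k + 1)
          positivity
        linarith
      refine ⟨hle.le, G.infDist_le_half hβ ?_ i1, hvy.le⟩
      linarith [infDist_le_add_norm (levelSet f c x₀) v y']
  obtain ⟨s1, s2, s3⟩ := hstep
  refine ⟨⟨s2, h1, s1.trans hdec, fun t ht => ?_⟩, ⟨h3, hS, s3.trans ?_, s3.trans ?_,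
    s3.trans hmove⟩⟩
  · have i1 : t * ‖x (k + 1) - y'‖ ≤ t * (τ * ‖d‖ + ‖d‖ ^ 3 / 3 + stepSum x y k) := by
      have := ht.1
      gcongr
      exact s3.trans hjump
    have i2 : t * (τ * ‖d‖) ≤ t * (‖d‖ * ‖d‖) := by
      have := ht.1
      gcongr
    have i3 : t * (‖d‖ ^ 3 / 3 + stepSum x y k) ≤ ‖d‖ ^ 3 / 3 + stepSum x y k :=
      mul_le_of_le_one_left (by positivity) ht.2
    -- Young's inequality, in the form (2s + t)(s - t)² ≥ 0 with s = ‖d‖. Its 2/3 and the 1/3 of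
    -- `i3` make up exactly one new summand ‖d‖³.
    have i4 : t * (‖d‖ * ‖d‖) ≤ t ^ 3 / 3 + 2 / 3 * ‖d‖ ^ 3 := by
      nlinarith [mul_nonneg (by linarith [ht.1] : (0:ℝ) ≤ 2 * ‖d‖ + t) (sq_nonneg (‖d‖ - t))]
    rw [hsum]
    linarith
  · gcongr
    exact hτg.trans h3
  · gcongr

theorem GlobalBounds.run_invariant (G : GlobalBounds f c A x₀ ζ β ν) (hβ : 0 < β) (hν : 0 < ν)
    (hρ0 : 0 ≤ ρ) (hρ1 : ρ < 1) (hrun : IsCRMRun (hFun f c A β) ρ ν x₀ x y) (k : ℕ) :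
    RunInvariant f c A x₀ β ν x y k := by
  induction k with
  | zero =>
    have h0 : Metric.infDist x₀ (levelSet f c x₀) ≤ 1 / 2 := by
      rw [Metric.infDist_zero_of_mem (mem_levelSet_self G.feas)]; norm_num
    refine ⟨by rwa [hrun.x_zero], by rwa [hrun.y_zero], ?_, fun t ht => ?_⟩
    · rw [hrun.x_zero, G.adm.h_of_feasible _ G.feas]
      simp [stepSum]
    · have := ht.1
      rw [hrun.x_zero, hrun.y_zero, sub_self, norm_zero, mul_zero, stepSum,
        Finset.sum_range_zero, add_zero]
      positivity
  | succ k ih => exact (G.run_step hβ hν hρ0 hρ1 hrun ih).1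

/-- The accuracy of the point produced by an iteration in terms of the length of its step. -/
theorem GlobalBounds.exists_accuracy (G : GlobalBounds f c A x₀ ζ β ν) (hβ : 0 < β)
    (hν : 0 < ν) : ∃ C : ℝ, 0 ≤ C ∧ ∀ ρ : ℝ, 0 ≤ ρ → ρ < 1 → ∀ x y : ℕ → Eu n,
      IsCRMRun (hFun f c A β) ρ ν x₀ x y → ∀ k, ∃ z ∈ feasible c,
        Tendsto (fun j : ℕ => A^[j] (x (k + 1))) atTop (𝓝 z) ∧
        ‖riemGrad f c z‖ ≤ C * ‖y (k + 1) - x k‖ ^ 2 ∧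
        ((-(C * (‖y (k + 1) - x k‖ + ‖y (k + 1) - x k‖ ^ 2)) : ℝ) : EReal)
          ≤ riemHessLambdaMin f c z := by
  have S := G.adm
  have hζ := G.ζ_pos
  have hν' : (0 : ℝ) < ν := hν
  obtain ⟨κ, hκ, hlim⟩ := G.exists_limit hβ
  obtain ⟨L, hL, hlam⟩ := S.exists_lambdaMin_const G.feas G.compact
  have hΓc : IsCompact (gammaSet f c x₀ ζ) := isCompact_gammaSet G.feas G.compact
  set Δ := Metric.diam (gammaSet f c x₀ ζ)
  have hΔ : 0 ≤ Δ := Metric.diam_nonneg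
  set c₀ : ℝ := ν + ν * ζ / 2 * (ν * Δ) with hc₀
  have hc₀0 : 0 ≤ c₀ := by positivity
  set c₁ : ℝ := c₀ + ν * ζ / 2 * (κ * c₀) with hc₁
  have hc₁0 : 0 ≤ c₁ := by positivity
  set c₂ : ℝ := 8 / 3 * ν + ν * (1 + Δ) with hc₂
  set c₃ : ℝ := ν * (κ * c₀) + L * c₁ with hc₃
  refine ⟨c₁ + c₂ + c₃, by positivity, fun ρ hρ0 hρ1 x y hrun k => ?_⟩
  have hk := G.run_invariant hβ hν hρ0 hρ1 hrun k
  obtain ⟨hk', hb⟩ := G.run_step hβ hν hρ0 hρ1 hrun hk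
  have hΓ : ∀ w, Metric.infDist w (levelSet f c x₀) ≤ 1 / 2 → w ∈ gammaSet f c x₀ ζ :=
    fun w hw => by rw [mem_gammaSet]; linarith
  set h := hFun f c A β
  set a := ‖y (k + 1) - x k‖ with ha
  have ha0 : 0 ≤ a := norm_nonneg _
  have hΔy : ‖y (k + 1) - y k‖ ≤ Δ := by
    rw [← dist_eq_norm]
    exact Metric.dist_le_diam_of_mem hΓc.isBounded (hΓ _ hk'.y_near) (hΓ _ hk.y_near)
  -- The weight τ is capped by the gradient norm and by the step length. The first cap gives a
  -- quadratic bound for the gradient estimate, the second a linear one for the curvature estimate.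
  have hm1 : ‖x (k + 1) - y (k + 1)‖ ≤ ν * Δ * a ^ 2 := by
    refine hb.move_grad.trans ?_
    calc (ν : ℝ) * a ^ 2 * ‖y (k + 1) - y k‖ ≤ ν * a ^ 2 * Δ := by gcongr
      _ = _ := by ring
  have hm2 : ‖x (k + 1) - y (k + 1)‖ ≤ a * Δ := hb.move_step.trans (by gcongr)
  have hgx : ‖gradient h (x (k + 1))‖ ≤ c₀ * a ^ 2 := by
    have hB : Metric.closedBall (y (k + 1)) (ζ + 2 / 5) ⊆ gammaSet f c x₀ ζ :=
      closedBall_subset_gammaSet (by linarith [hk'.y_near])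
    have i1 := gradient_lipschitz (S.h_diff2 β) (convex_closedBall (y (k + 1)) (ζ + 2 / 5))
      (fun w hw => G.hess_le w (hB hw)) (Metric.mem_closedBall_self (by positivity))
      (mem_closedBall_iff_norm.2 hb.move)
    have i2 := norm_sub_norm_le (gradient h (x (k + 1))) (gradient h (y (k + 1)))
    have i3 : (ν : ℝ) * ζ / 2 * ‖x (k + 1) - y (k + 1)‖ ≤ ν * ζ / 2 * (ν * Δ * a ^ 2) := by gcongr
    rw [hc₀]
    linarith [hb.grad]
  have hhx : h (x (k + 1)) ≤ f x₀ := by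
    have : 0 ≤ (ν : ℝ) / 12 * stepSum x y (k + 1) := by
      have := stepSum_nonneg x y (k + 1)
      positivity
    linarith [hk'.decrease]
  obtain ⟨z, hz, hzt, hz1, hz2⟩ := hlim (x (k + 1)) (by linarith [hk'.x_near]) hhx
  have hz3 : ‖x (k + 1) - z‖ ≤ κ * c₀ * a ^ 2 := by
    refine hz2.trans ?_
    rw [mul_assoc]
    gcongr
  have hBz : Metric.closedBall z (1 / 2 : ℝ) ⊆ gammaSet f c x₀ ζ := G.ball_subset hz (by norm_num)
  have hzB : z ∈ Metric.closedBall z (1 / 2 : ℝ) := Metric.mem_closedBall_self (by norm_num)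
  have hxB : x (k + 1) ∈ Metric.closedBall z (1 / 2 : ℝ) := mem_closedBall_iff_norm.2 hz1
  have hgz : ‖gradient (gFun f A) z‖ ≤ c₁ * a ^ 2 := by
    rw [← S.gradient_h_of_feasible β hz.1]
    have i1 := gradient_lipschitz (S.h_diff2 β) (convex_closedBall z (1 / 2))
      (fun w hw => G.hess_le w (hBz hw)) hzB hxB
    have i2 := norm_sub_norm_le (gradient h z) (gradient h (x (k + 1)))
    rw [norm_sub_rev] at i2
    have i3 : (ν : ℝ) * ζ / 2 * ‖x (k + 1) - z‖ ≤ ν * ζ / 2 * (κ * c₀ * a ^ 2) := by gcongr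
    rw [hc₁]
    linarith
  have hcurv : ∀ d : Eu n, d ∈ tangent c z → ‖d‖ = 1 →
      -(c₂ * a + ν * (κ * c₀) * a ^ 2) ≤ inner ℝ d (hessian (gFun f A) z d) := by
    intro d hd hd1
    rw [← hessian_h_tangent S β hz.1 hd]
    -- The subproblem bounds the Hessian at `x k`; it is carried over to z across the step, the
    -- momentum move and the passage to the limit.
    have i1 := hessian_ge_of_isMinOn (S.h_diff β) (S.h_diff2 β) ν.2 (hrun.cubic_step k) hd1
    have i2 := G.hess_lip z (hBz hzB) (x k) (hΓ _ hk.x_near)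
    have i3 : ‖z - x k‖ ≤ κ * c₀ * a ^ 2 + a * Δ + a := by
      have e : z - x k = -(x (k + 1) - z) + (x (k + 1) - y (k + 1)) + (y (k + 1) - x k) := by abel
      rw [e]
      refine (norm_add₃_le).trans ?_
      rw [norm_neg]
      gcongr
    have i4 : |inner ℝ d ((hessian h z - hessian h (x k)) d)| ≤ ν * ‖z - x k‖ := by
      refine (abs_real_inner_le_norm _ _).trans ?_
      have := (hessian h z - hessian h (x k)).le_opNorm d
      rw [hd1] at this ⊢
      linarith
    rw [sub_apply, inner_sub_right] at i4
    have i5 := (abs_le.1 i4).1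
    have i6 : (ν : ℝ) * ‖z - x k‖ ≤ ν * (κ * c₀ * a ^ 2 + a * Δ + a) := by gcongr
    rw [hc₂]
    change -(8 / 3 * ν * a) ≤ _ at i1
    linarith
  have hpos : 0 ≤ c₂ := by positivity
  have hpos3 : 0 ≤ c₃ := by positivity
  refine ⟨z, hz.1, hzt, (norm_riemGrad_le S hz.1).trans (hgz.trans ?_),
    le_trans (EReal.coe_le_coe_iff.2 ?_) (hlam z hz _ hcurv)⟩
  · gcongr
    linarith
  · have i1 : L * ‖gradient (gFun f A) z‖ ≤ L * (c₁ * a ^ 2) := by gcongr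
    have i2 : c₂ * a + c₃ * a ^ 2 ≤ (c₁ + c₂ + c₃) * (a + a ^ 2) := by
      have : 0 ≤ c₁ * (a + a ^ 2) := by positivity
      have : 0 ≤ c₂ * a ^ 2 := by positivity
      have : 0 ≤ c₃ * a := by positivity
      linarith
    rw [hc₃] at i2
    rw [hc₃]
    linarith

end Run

/-! ### The degenerate cases and the iteration count -/

section Complexity

variable {f : Eu n → ℝ} {c : Eu n → Eu p} {A : Eu n → Eu n} {x₀ : Eu n} {ζ : ℝ}

/-- If `x₀` is a second order stationary point, then its own limit `A^∞(x₀) = x₀` is one. -/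
theorem Admissible.stationary_start (S : Admissible f c A) (hx₀ : x₀ ∈ feasible c)
    (hG : IsCompact (levelSet f c x₀)) (hgrad : gradient (gFun f A) x₀ = 0)
    (hhess : ∀ d ∈ tangent c x₀, hessian (gFun f A) x₀ d = 0) {ε : ℝ} (hε : 0 < ε) :
    Tendsto (fun k : ℕ => A^[k] x₀) atTop (𝓝 x₀) ∧ ‖riemGrad f c x₀‖ ≤ ε ∧
      ((-√ε : ℝ) : EReal) ≤ riemHessLambdaMin f c x₀ := by
  obtain ⟨C, -, hC⟩ := S.exists_lambdaMin_const hx₀ hG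
  refine ⟨?_, (norm_riemGrad_le S hx₀).trans ?_,
    le_trans (EReal.coe_le_coe_iff.2 ?_) (hC x₀ (mem_levelSet_self hx₀) 0 fun d hd _ => ?_)⟩
  · simp only [Function.iterate_fixed (S.A_fix x₀ hx₀)]
    exact tendsto_const_nhds
  · rw [hgrad, norm_zero]
    exact hε.le
  · rw [hgrad, norm_zero]
    have := Real.sqrt_nonneg ε
    linarith
  · rw [hhess d hd, inner_zero_right, neg_zero]

/-- A zero threshold makes every β_w on the level set vanish, so ∇g is locally constant near x₀. -/
theorem Admissible.stationary_of_betaThreshold_le_zero (S : Admissible f c A)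
    (hx₀ : x₀ ∈ feasible c) (hG : IsCompact (levelSet f c x₀)) (hζ : 0 < ζ)
    (hβ : betaThreshold f c A x₀ ζ ≤ 0) :
    gradient (gFun f A) x₀ = 0 ∧ hessian (gFun f A) x₀ = 0 := by
  have hβw : ∀ w ∈ levelSet f c x₀, betaAt f c A w = 0 := fun w hw => by
    refine nonpos_iff_eq_zero.1 (le_trans (le_iSup₂ (f := fun w
      (_ : w ∈ feasible c ∩ gammaSet f c x₀ ζ) => betaAt f c A w) w ⟨hw.1, ?_⟩)
      ((le_max_right _ _).trans ((le_max_left _ _).trans hβ)))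
    rw [mem_gammaSet, Metric.infDist_zero_of_mem hw]
    linarith
  refine ⟨gradient_g_eq_zero_of_betaAt_eq_zero S hx₀ hG hβw, ?_⟩
  have h := gradient_g_eventually_const S hx₀ (hβw x₀ (mem_levelSet_self hx₀))
  exact (Filter.EventuallyEq.fderiv_eq h).trans (fderiv_const_apply _)

/-- Both ∇h and ∇²h vanish at x₀, and they agree there with those of g, the Hessians on tangent
vectors. -/
theorem Admissible.stationary_of_nuValue_le_zero (S : Admissible f c A)
    (hx₀ : x₀ ∈ feasible c) (hζ : 0 < ζ) {β : ℝ≥0} (hν : nuValue f c A β x₀ ζ ≤ 0) :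
    gradient (gFun f A) x₀ = 0 ∧ ∀ d ∈ tangent c x₀, hessian (gFun f A) x₀ d = 0 := by
  have hΓ : x₀ ∈ gammaSet f c x₀ ζ := by
    rw [mem_gammaSet, Metric.infDist_zero_of_mem (mem_levelSet_self hx₀)]
    linarith
  have hν' : nuValue f c A β x₀ ζ ≤ (0 : ℝ≥0) := by simpa using hν
  have h1 := norm_gradient_le_of_nuValue_le hζ hν' hΓ
  have h2 := norm_hessian_le_of_nuValue_le hζ hν' hΓ
  rw [NNReal.coe_zero, zero_mul] at h1 h2
  rw [zero_div] at h2
  refine ⟨?_, fun d hd => ?_⟩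
  · rw [← S.gradient_h_of_feasible β hx₀]
    exact norm_le_zero_iff.1 h1
  · rw [← hessian_h_tangent S β hx₀ hd, norm_le_zero_iff.1 h2, zero_apply]

theorem rpow_three_halves {ε : ℝ} (hε : 0 ≤ ε) : ε ^ (3 / 2 : ℝ) = √ε ^ 3 := by
  rw [Real.sqrt_eq_rpow, ← Real.rpow_natCast, ← Real.rpow_mul hε]
  norm_num

/-- A bound on the sum of the cubed steps produces a short step. -/
theorem exists_step_le_of_stepSum_le {x y : ℕ → Eu n} {K : ℕ} {t : ℝ} (ht : 0 ≤ t) (hK : 0 < K)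
    (h : stepSum x y K ≤ K * t ^ 3) : ∃ k < K, ‖y (k + 1) - x k‖ ≤ t := by
  obtain ⟨k, hk, hle⟩ := Finset.exists_le_of_sum_le (s := Finset.range K)
    (f := fun k => ‖y (k + 1) - x k‖ ^ 3) (g := fun _ => t ^ 3)
    (Finset.nonempty_range_iff.2 hK.ne') (by simpa [stepSum] using h)
  exact ⟨k, Finset.mem_range.1 hk, le_of_pow_le_pow_left₀ (by norm_num) ht hle⟩

/-- Since Σ‖d‖³ ≤ ζ, some step among the first K has length at most κ√ε as soon as K κ³ ε^(3/2) ≥ ζ.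
-/
theorem GlobalBounds.exists_complexity_const {β ν : ℝ≥0} (G : GlobalBounds f c A x₀ ζ β ν)
    (hβ : 0 < β) (hν : 0 < ν) : ∃ C : ℝ, 0 < C ∧
      ∀ ρ : ℝ, 0 ≤ ρ → ρ < 1 →
      ∀ x y : ℕ → Eu n, IsCRMRun (hFun f c A (β : ℝ)) ρ (ν : ℝ) x₀ x y →
      ∀ ε : ℝ, 0 < ε → ε < 1 →
      ∀ K : ℕ, C / ε ^ (3 / 2 : ℝ) ≤ (K : ℝ) →
        ∃ i ≤ K, ∃ z : Eu n,
          Tendsto (fun k : ℕ => A^[k] (x i)) atTop (𝓝 z) ∧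
          z ∈ feasible c ∧
          ‖riemGrad f c z‖ ≤ ε ∧
          ((-√ε : ℝ) : EReal) ≤ riemHessLambdaMin f c z := by
  have hζ := G.ζ_pos
  obtain ⟨C, hC, hacc⟩ := G.exists_accuracy hβ hν
  -- A step of length a ≤ κ√ε with κ ≤ 1 has a² ≤ κε and a + a² ≤ 2κ√ε, so 2Cκ ≤ 1 settles both
  -- accuracy conditions.
  obtain ⟨κ, hκ0, hκ1, hκC⟩ : ∃ κ : ℝ, 0 < κ ∧ κ ≤ 1 ∧ 2 * C * κ ≤ 1 := by
    refine ⟨1 / (1 + 2 * C), by positivity, ?_, ?_⟩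
    · rw [div_le_one (by positivity)]
      linarith
    · rw [mul_one_div, div_le_one (by positivity)]
      linarith
  refine ⟨ζ / κ ^ 3, by positivity, fun ρ hρ0 hρ1 x y hrun ε hε hε1 K hK => ?_⟩
  have hs0 : 0 < √ε := Real.sqrt_pos.2 hε
  have hs1 : √ε ≤ 1 := Real.sqrt_le_one.2 hε1.le
  have hsq : √ε ^ 2 = ε := Real.sq_sqrt hε.le
  rw [rpow_three_halves hε.le, div_div, div_le_iff₀ (by positivity), ← mul_pow] at hK
  have hK0 : 0 < K := by
    rcases Nat.eq_zero_or_pos K with rfl | h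
    · rw [Nat.cast_zero, zero_mul] at hK
      linarith
    · exact h
  have hsum : stepSum x y K ≤ ζ := by
    obtain ⟨k, rfl⟩ := Nat.exists_eq_succ_of_ne_zero hK0.ne'
    have := (G.run_step hβ hν hρ0 hρ1 hrun (G.run_invariant hβ hν hρ0 hρ1 hrun k)).2.sum_le
    change stepSum x y (k + 1) ≤ ζ
    linarith
  obtain ⟨k, hk, ha⟩ := exists_step_le_of_stepSum_le (t := κ * √ε) (by positivity) hK0
    (hsum.trans hK)
  obtain ⟨z, hz, hzt, hz1, hz2⟩ := hacc ρ hρ0 hρ1 x y hrun k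
  set a := ‖y (k + 1) - x k‖
  have ha0 : 0 ≤ a := norm_nonneg _
  have hκs : κ * √ε ≤ 1 := mul_le_one₀ hκ1 hs0.le hs1
  have ha2 : a ^ 2 ≤ κ * ε := by
    calc a ^ 2 ≤ (κ * √ε) ^ 2 := by gcongr
      _ = κ * (κ * ε) := by rw [mul_pow, hsq]; ring
      _ ≤ 1 * (κ * ε) := by gcongr
      _ = κ * ε := one_mul _
  -- The accurate iterate is the one after the short step; k < K gives k + 1 ≤ K.
  refine ⟨k + 1, hk, z, hzt, hz, hz1.trans ?_, le_trans (EReal.coe_le_coe_iff.2 ?_) hz2⟩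
  · calc C * a ^ 2 ≤ C * (κ * ε) := by gcongr
      _ = C * κ * ε := by ring
      _ ≤ 1 * ε := by
        gcongr
        have : 0 ≤ C * κ := by positivity
        linarith
      _ = ε := one_mul _
  · have i1 : a ^ 2 ≤ κ * √ε := by
      calc a ^ 2 = a * a := sq a
        _ ≤ κ * √ε * 1 := by gcongr; exact ha.trans hκs
        _ = κ * √ε := mul_one _
    have i2 : C * (a + a ^ 2) ≤ C * (κ * √ε + κ * √ε) := by gcongr
    have i3 : 2 * C * κ * √ε ≤ 1 * √ε := by gcongr
    linarith

end Complexity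

end CDF

theorem mainTheorem8 {n p : ℕ} (hp : 0 < p)
    (f : CDF.Eu n → ℝ) (c : CDF.Eu n → CDF.Eu p) (A : CDF.Eu n → CDF.Eu n)
    -- twice differentiability of `f`, `c`, `A`
    (hf : Differentiable ℝ f) (hf2 : Differentiable ℝ (fderiv ℝ f))
    (hc : Differentiable ℝ c) (hc2 : Differentiable ℝ (fderiv ℝ c))
    (hA : Differentiable ℝ A) (hA2 : Differentiable ℝ (fderiv ℝ A))
    -- standing assumptions on `f` and `c`
    (hfLip : LocallyLipschitz (gradient f))
    (hcLip : LocallyLipschitz (CDF.transJac c))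
    (hLICQ : ∀ x ∈ CDF.feasible c, Function.Injective (CDF.transJac c x))
    -- standing assumptions on the constraint dissolving operator `A`
    (hALip : LocallyLipschitz (CDF.transJac A))
    (hAfix : ∀ x ∈ CDF.feasible c, A x = x)
    (hAJac : ∀ x ∈ CDF.feasible c, (CDF.transJac A x).comp (CDF.transJac c x) = 0)
    -- coercivity of `f` over the feasible set
    (hcoer : ∀ x ∈ CDF.feasible c, IsCompact (CDF.levelSet f c x))
    -- the Hessian of `g = f ∘ A` is locally Lipschitz
    (hgLip : LocallyLipschitz (CDF.hessian (CDF.gFun f A)))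
    -- initial point and parameters of the algorithm
    (x₀ : CDF.Eu n) (hx₀ : x₀ ∈ CDF.feasible c)
    (ζ : ℝ) (hζ : 0 < ζ)
    (β : ℝ≥0) (hβ : CDF.betaThreshold f c A x₀ ζ ≤ (β : ℝ≥0∞))
    (ν : ℝ≥0) (hν : (ν : ℝ≥0∞) = CDF.nuValue f c A (β : ℝ) x₀ ζ) :
    ∃ C : ℝ, 0 < C ∧
      ∀ ρ : ℝ, 0 ≤ ρ → ρ < 1 →
      ∀ x y : ℕ → CDF.Eu n, CDF.IsCRMRun (CDF.hFun f c A (β : ℝ)) ρ (ν : ℝ) x₀ x y →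
      ∀ ε : ℝ, 0 < ε → ε < 1 →
      ∀ K : ℕ, C / ε ^ (3 / 2 : ℝ) ≤ (K : ℝ) →
        ∃ i ≤ K, ∃ z : CDF.Eu n,
          Tendsto (fun k : ℕ => A^[k] (x i)) atTop (𝓝 z) ∧
          z ∈ CDF.feasible c ∧
          ‖CDF.riemGrad f c z‖ ≤ ε ∧
          ((-Real.sqrt ε : ℝ) : EReal) ≤ CDF.riemHessLambdaMin f c z := by
  have S : CDF.Admissible f c A :=
    ⟨hp, hf, hf2, hc, hc2, hA, hA2, hcLip, hLICQ, hALip, hAfix, hAJac, hgLip⟩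
  have hG := hcoer x₀ hx₀
  -- If this holds, the index 0 works for every ε. Otherwise β and ν are both nonzero, as the
  -- general argument requires.
  by_cases hst : gradient (CDF.gFun f A) x₀ = 0 ∧
      ∀ d ∈ CDF.tangent c x₀, CDF.hessian (CDF.gFun f A) x₀ d = 0
  · refine ⟨1, one_pos, fun ρ _ _ x y hrun ε hε _ K _ => ⟨0, K.zero_le, x₀, ?_⟩⟩
    obtain ⟨h1, h2⟩ := S.stationary_start hx₀ hG hst.1 hst.2 hε
    exact ⟨by rwa [hrun.x_zero], hx₀, h2⟩
  have hβ0 : β ≠ 0 := by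
    rintro rfl
    obtain ⟨h1, h2⟩ := S.stationary_of_betaThreshold_le_zero hx₀ hG hζ (by simpa using hβ)
    exact hst ⟨h1, fun d _ => by rw [h2, zero_apply]⟩
  have hν0 : ν ≠ 0 := by
    rintro rfl
    exact hst (S.stationary_of_nuValue_le_zero hx₀ hζ (β := β) (by simp [← hν]))
  exact (S.globalBounds hx₀ hG hζ hβ hβ0 hν.ge).exists_complexity_const
    (pos_iff_ne_zero.2 hβ0) (pos_iff_ne_zero.2 hν0)
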